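/- All rings are commutative with 1 and Noetherian. **Notation.** For a ring $R$, the normalization $\overline R$ is the integral closure of $R^{red}=R/\mathrm{nil}(R)$ in its total ring of fractions, and $\nu:R\to\overline R$ is the natural map. $R$ is Nagata if it is Noetherian and for every prime $\mathfrak p$ the integral closure of $R/\mathfrak p$ in every finite extension of its fraction field is a finite $R/\mathfrak p$-module. A ring or scheme is normal if all its local rings are integrally closed domains. Let $\mathfrak p^{>1}$ be the intersection of the minimal primes $\mathfrak p$ of $R$ with $\dim R/\mathfrak p>1$ (equal to $R$ if there are none), $R^{>1}=R/\mathfrak p^{>1}$, $X=\operatorname{Spec}R$, $X^{>1}=\operatorname{Spec}R^{>1}$, and $\nu^{>1}:R\to\overline{R^{>1}}$. For an $A$-module $M$ and $t=\mathfrak p\in\operatorname{Spec}A$ put $k(t)=A_{\mathfrak p}/\mathfrak pA_{\mathfrak p}$ and $M(t)=M\otimes_Ak(t)$; for an $A$-algebra $R$, $X_t=\operatorname{Spec}R(t)$. A point of $\operatorname{Spec} R$ is an isolated non-normal singularity if $R$ is not normal at it but is normal at all other points of a neighbourhood of it. A point is called isolated if it is an irreducible component of dimension $0$. For a local ring $(B,\mathfrak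 m)$ that is an algebra over a field $k$, let $\delta_k(B)=\dim_k(\overline B/B^{red})-\dim_k H^0_{\mathfrak m}(B)$, where $H^0_{\mathfrak m}(B)=\{x\in B:\mathfrak m^nx=0\text{ for some }n\}$. For a $k$-algebra $B$ let $\delta_k(\operatorname{Spec}B)=\sum_{\mathfrak m}\delta_k(B_{\mathfrak m})$, summed over the maximal ideals of $B$ (a normal point of positive dimension contributes $0$, and an isolated point contributes $-\dim_kB_{\mathfrak m}$; the sum is $0$ for $B=0$). A *fiberwise normalization* of a morphism of schemes $f:X\to S$ is a finite morphism $m:\widetilde X\to X$ such that $\widetilde f=f\circ m$ is flat, the non-empty fibres of $\widetilde f$ are normal, and for every $t\in f(X)$ the induced map $\widetilde f^{-1}(t)\to f^{-1}(t)$ is birational, i.e. a bijection between the generic points of the irreducible components inducing isomorphisms of their local rings. It is a *simultaneous normalization* if moreover the non-empty fibres of $\widetilde f$ are geometrically normal, i.e. remain normal after every extension of the base field $k(t)$. **Statement.** Let $\varphi:A\to R$ be a flat morphism of rings with $A$ a principal ideal domain and $R$ Nagata, $S=\operatorname{Spec}A$, $f=\operatorname{Spec}\varphi:X\to S$, and let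 $f^{>1}:X^{>1}\to S$ be the restriction of $f$. Assume that * $\operatorname{Coker}(\nu:R\to\overline R)$ and $\operatorname{Ker}(\nu^{>1}:R\to\overline{R^{>1}})$ are finite over $A$; * for each $t\in f(X)$ the fibre $X_t$ has only finitely many non-normal points, these are isolated non-normal singularities, and their residue fields are finite over $k(t)$; * for each $t\in S$ the fibre of $\operatorname{Spec}\overline{R^{>1}}\to S$ over $t$ has no isolated points; * all residue fields $k(t)$, $t\in S$, are perfect. Then: * (2) $\delta_{k(t)}(X_t)$ is constant on $S$ if and only if $f^{>1}:X^{>1}\to S$ admits a simultaneous normalization. * (3) If $A$ is not a field and $X$ has no $1$-dimensional irreducible components, then $f$ admits a simultaneous normalization if and only if $\delta_{k(t)}(X_t)$ is constant on $S$. -/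

import Mathlib

open AlgebraicGeometry CategoryTheory CategoryTheory.Limits

universe u

noncomputable section

namespace INNS

/-! ### Normality, normalization, Nagata rings -/

/-- A domain which is integrally closed in its field of fractions. -/
def IsNormalDomain (R : Type u) [CommRing R] : Prop :=
  IsDomain R ∧ IsIntegrallyClosed R

/-- The normalization of a ring `R`: the integral closure of the reduction of `R` in the total
ring of fractions of that reduction. The normalization map `ν` is
`algebraMap R (Normalization R)`. -/
abbrev Normalization (R : Type u) [CommRing R] : Type u :=
  integralClosure (R ⧸ nilradical R) (FractionRing (R ⧸ nilradical R))

/-- The cokernel of the normalization map of a `k`-algebra `R`, as a `k`-module. -/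
abbrev NormalizationCoker (k R : Type u) [CommRing k] [CommRing R] [Algebra k R] : Type u :=
  Normalization R ⧸ LinearMap.range (IsScalarTower.toAlgHom k R (Normalization R)).toLinearMap

/-- The `N-2` property (used for domains `D`): the integral closure of `D` in every finite
extension of its field of fractions is a finite `D`-module. -/
def IsN2 (D : Type u) [CommRing D] : Prop :=
  ∀ (L : Type u) [Field L] [Algebra D L] [Algebra (FractionRing D) L]
    [IsScalarTower D (FractionRing D) L],
    Module.Finite (FractionRing D) L → Module.Finite D (integralClosure D L)

/-- A Nagata ring is a Noetherian ring all of whose residue domains are `N-2`. -/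
def IsNagata (R : Type u) [CommRing R] : Prop :=
  IsNoetherianRing R ∧ ∀ p : Ideal R, p.IsPrime → IsN2 (R ⧸ p)

/-! ### Parts of given dimension -/

/-- The intersection `𝔭^{>i}` of all minimal primes `𝔭` of `R` with `dim R/𝔭 > i` (it is the
whole ring if there are none). -/
def higherIdeal (R : Type u) [CommRing R] (i : ℕ) : Ideal R :=
  sInf {p | p ∈ minimalPrimes R ∧ ((i : ℕ∞) : WithBot ℕ∞) < ringKrullDim (R ⧸ p)}

/-- The quotient `R^{>i} = R/𝔭^{>i}`. -/
abbrev HigherPart (R : Type u) [CommRing R] (i : ℕ) : Type u :=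
  R ⧸ higherIdeal R i

/-- `Spec R` has no isolated points, i.e. no irreducible component of dimension `0`: no minimal
prime ideal is maximal. -/
def NoIsolatedPoints (R : Type u) [CommRing R] : Prop :=
  ∀ p ∈ minimalPrimes R, ¬ p.IsMaximal

/-! ### Isolated non-normal singularities and the delta invariant -/

/-- The non-normal locus of `R`. -/
def nonNormalLocus (R : Type u) [CommRing R] : Set (PrimeSpectrum R) :=
  {p | ¬ IsNormalDomain (Localization.AtPrime p.asIdeal)}

/-- `R` is normal at all points `≠ p` of some neighbourhood of `p`. -/
def IsINNS (R : Type u) [CommRing R] (p : PrimeSpectrum R) : Prop :=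
  ∃ U : Set (PrimeSpectrum R), IsOpen U ∧ p ∈ U ∧
    ∀ q ∈ U, q ≠ p → IsNormalDomain (Localization.AtPrime q.asIdeal)

/-- `R` has only finitely many non-normal points, all of them are isolated non-normal points, and
their residue fields are finite over `k`. -/
def HasFinitelyManyINNS (k R : Type u) [Field k] [CommRing R] [Algebra k R] : Prop :=
  (nonNormalLocus R).Finite ∧
    ∀ p ∈ nonNormalLocus R, IsINNS R p ∧ Module.Finite k p.asIdeal.ResidueField

/-- The zeroth local cohomology `{x | 𝔪^n x = 0 for some n}` of a local ring `(R, 𝔪)`. -/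
def localCohomologyZero (R : Type u) [CommRing R] [IsLocalRing R] : Ideal R where
  carrier := {x | ∃ n : ℕ, ∀ a ∈ IsLocalRing.maximalIdeal R ^ n, a * x = 0}
  zero_mem' := ⟨0, fun a _ => mul_zero a⟩
  add_mem' := by
    rintro x y ⟨n, hn⟩ ⟨l, hl⟩
    refine ⟨n + l, fun a ha => ?_⟩
    rw [mul_add, hn a (Ideal.pow_le_pow_right (Nat.le_add_right n l) ha),
      hl a (Ideal.pow_le_pow_right (Nat.le_add_left l n) ha), add_zero]
  smul_mem' := by
    rintro c x ⟨n, hn⟩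
    refine ⟨n, fun a ha => ?_⟩
    rw [smul_eq_mul, mul_left_comm, hn a ha, mul_zero]

/-- The epsilon invariant of a local `k`-algebra `R`. -/
def localEpsilon (k R : Type u) [Field k] [CommRing R] [IsLocalRing R] [Algebra k R] : ℕ :=
  Module.finrank k (localCohomologyZero R)

/-- The delta invariant of a local `k`-algebra `R`:
`dim_k (Normalization R / R^red) - ε_k(R)`. -/
def localDelta (k R : Type u) [Field k] [CommRing R] [IsLocalRing R] [Algebra k R] : ℤ :=
  (Module.finrank k (NormalizationCoker k R) : ℤ) - (localEpsilon k R : ℤ)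

/-- The delta invariant of a `k`-algebra `R`: the sum of the delta invariants of its local rings
at closed points. A normal point of positive dimension contributes `0`, so only the non-normal
points and the isolated points of `Spec R` matter; an isolated point with local ring `B`
contributes `-dim_k B`, also if `B` is a field. -/
def delta (k R : Type u) [Field k] [CommRing R] [Algebra k R] : ℤ :=
  ∑ᶠ m : MaximalSpectrum R, localDelta k (Localization.AtPrime m.asIdeal)

/-- `δ` of the fibre `R(𝔭) = k(𝔭) ⊗ R` is the same for all `𝔭 ∈ Spec A`. -/
def DeltaConstant (A R : Type u) [CommRing A] [CommRing R] [Algebra A R] : Prop :=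
  ∀ p q : PrimeSpectrum A,
    delta p.asIdeal.ResidueField (p.asIdeal.Fiber R) =
      delta q.asIdeal.ResidueField (q.asIdeal.Fiber R)

/-! ### Fiberwise and simultaneous normalization of morphisms of schemes -/

/-- A scheme is normal if all its local rings are integrally closed domains. -/
def IsNormalScheme (X : Scheme.{u}) : Prop :=
  ∀ x : X, IsNormalDomain (X.presheaf.stalk x)

/-- A morphism is birational if it is a bijection between the generic points (of the irreducible
components) and an isomorphism of the corresponding local rings. -/
def IsBirational {X Y : Scheme.{u}} (g : X ⟶ Y) : Prop :=
  Set.BijOn g (genericPoints X) (genericPoints Y) ∧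
    ∀ x ∈ genericPoints X, IsIso (g.stalkMap x)

/-- The map `m_t : (f ∘ m)⁻¹(t) → f⁻¹(t)` of scheme-theoretic fibres induced by `m`. -/
def fiberMap {X' X S : Scheme.{u}} (m : X' ⟶ X) (f : X ⟶ S) (t : S) :
    (m ≫ f).fiber t ⟶ f.fiber t :=
  pullback.lift ((m ≫ f).fiberι t ≫ m) ((m ≫ f).fiberToSpecResidueField t)
    (by rw [Category.assoc]; exact (m ≫ f).fiber_fac t)

/-- `m` is a fiberwise normalization of `f`. -/
structure IsFiberwiseNormalization {X' X S : Scheme.{u}} (m : X' ⟶ X) (f : X ⟶ S) : Prop where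
  finite : IsFinite m
  flat : Flat (m ≫ f)
  normal_fiber : ∀ t : S, IsNormalScheme ((m ≫ f).fiber t)
  birational_fiber : ∀ t ∈ Set.range f, IsBirational (fiberMap m f t)

/-- `m` is a simultaneous normalization of `f`: a fiberwise normalization such that the fibres of
`f ∘ m` are geometrically normal, i.e. remain normal after every extension of the base field. -/
structure IsSimultaneousNormalization {X' X S : Scheme.{u}} (m : X' ⟶ X) (f : X ⟶ S) : Prop
    extends IsFiberwiseNormalization m f where
  geometricallyNormal_fiber : ∀ t : S,
    geometrically IsNormalScheme ((m ≫ f).fiberToSpecResidueField t)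

/-- `f` admits a simultaneous normalization. -/
def AdmitsSimultaneousNormalization {X S : Scheme.{u}} (f : X ⟶ S) : Prop :=
  ∃ (X' : Scheme.{u}) (m : X' ⟶ X), IsSimultaneousNormalization m f

/-- The morphism `Spec R → Spec A` of an `A`-algebra `R`. -/
abbrev structureMap (A R : Type u) [CommRing A] [CommRing R] [Algebra A R] :
    Spec (CommRingCat.of R) ⟶ Spec (CommRingCat.of A) :=
  Spec.map (CommRingCat.ofHom (algebraMap A R))

end INNS

end

/-! Let N be the normalization of R^{>1}, and let N(t), R(t) be the fibres over t. Constancy of δ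
and existence of a simultaneous normalization are both shown equivalent to one condition: every N(t)
is a normal ring.

Constancy of δ. The map R → N has finite kernel and cokernel over A: the kernel by hypothesis, the
cokernel because the normalization of R maps onto N. Moreover N is torsion-free, hence flat, over
the principal ideal domain A. So the difference χ of the dimensions of the cokernel and the kernel
of R(t) → N(t) does not depend on t (`exists_finrank_coker_sub_finrank_ker_eq`). The ring N(t) is
reduced. Over the generic point it is a localization of N. Over a closed point it is N/wN, which has
no embedded primes because N is integrally closed (`mem_minimalPrimes_of_isAssociatedPrime`), while
R(t) is normal at every non-closed point and agrees there with N(t). Since N(t) is reduced without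
isolated points, the kernel of R(t) → N(t) is locally the zeroth local cohomology, and at
non-isolated closed points N(t) lies between R(t)^red and its normalization. Hence δ(X_t) = χ + e_t
with e_t ≥ 0, and e_t = 0 exactly when N(t) is normal (`exists_delta_eq`). Generically N(t) is
normal, so e = 0 there, and δ is constant if and only if every e_t vanishes (`deltaConstant_iff`).

Simultaneous normalization. If all N(t) are normal, Spec N itself works: finite-dimensional kernels
and cokernels do not affect generic points that are not closed, and over a perfect field normality
is geometric. Conversely, let M be the algebra of a simultaneous normalization. Normality of the
generic fibre lets an integral fraction be written with denominator in A, and reducedness of the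
closed fibres removes the prime factors of that denominator. So M is integrally closed. By
birationality over the generic point it has the same total ring of fractions as the reduced base, so
M ≅ N.

For (3), a zero-dimensional component of X would be a field, finite over A and containing A, which
forces A to be a field. Hence, without one-dimensional components, X^{>1} is the reduction of X and
the same comparison applies to f.

Normality is handled through `IsNormalRing`, an equational condition that passes to localizations
and directed unions without mention of fraction fields. -/

namespace INNS

/-! ### Normal rings via integrally closed principal ideals -/

section NormalRing

open Finset Polynomial

/-- Rings all of whose principal ideals are integrally closed. By `isNormalRing_iff` these are the
rings all of whose local rings are integrally closed domains. -/
def IsNormalRing (C : Type*) [CommRing C] : Prop :=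
  ∀ (a b : C) (n : ℕ) (c : ℕ → C), a ^ n = ∑ i ∈ range n, c i * a ^ i * b ^ (n - i) → b ∣ a

variable {C : Type*} [CommRing C]

theorem isIntegral_iff_exists_pow_eq_sum {Q : Type*} [CommRing Q] [Algebra C Q] {z : Q} :
    IsIntegral C z ↔
      ∃ (n : ℕ) (c : ℕ → C), z ^ n = ∑ i ∈ range n, algebraMap C Q (c i) * z ^ i := by
  constructor
  · rintro ⟨p, hp, hz⟩
    refine ⟨p.natDegree, fun i => -p.coeff i, ?_⟩
    rw [eval₂_eq_sum_range, sum_range_succ, hp.coeff_natDegree, map_one, one_mul] at hz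
    simp only [map_neg, neg_mul, sum_neg_distrib]
    exact eq_neg_of_add_eq_zero_right hz
  · rintro ⟨n, c, h⟩
    nontriviality C
    refine ⟨X ^ n - ∑ i ∈ range n, Polynomial.C (c i) * X ^ i, ?_, ?_⟩
    · refine monic_X_pow_sub ?_
      refine (degree_sum_le _ _).trans_lt ?_
      refine (Finset.sup_lt_iff (WithBot.bot_lt_coe n)).mpr fun i hi => ?_
      exact (degree_C_mul_X_pow_le _ _).trans_lt (Nat.cast_lt.mpr (mem_range.mp hi))
    · simp [eval₂_finsetSum, h]

theorem IsNormalRing.isReduced (h : IsNormalRing C) : IsReduced C := by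
  refine ⟨fun a ⟨n, hn⟩ => ?_⟩
  exact zero_dvd_iff.mp (h a 0 n 0 (by simp [hn]))

theorem IsNormalRing.of_subsingleton [Subsingleton C] : IsNormalRing C :=
  fun _ _ _ _ _ => ⟨0, Subsingleton.elim _ _⟩

theorem IsNormalRing.of_ringEquiv {D : Type*} [CommRing D] (e : C ≃+* D) (h : IsNormalRing C) :
    IsNormalRing D := by
  intro a b n c hrel
  have := h (e.symm a) (e.symm b) n (fun i => e.symm (c i)) (by
    rw [← map_pow, hrel]; simp)
  simpa using map_dvd e this

/-- A ring which is a directed union of images of normal rings is normal. -/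
theorem IsNormalRing.of_directed {ι : Type*} (D : ι → Type*) [∀ i, CommRing (D i)]
    (f : ∀ i, D i →+* C) (hD : ∀ i, IsNormalRing (D i))
    (hinj : ∀ i, Function.Injective (f i))
    (hcov : ∀ s : Finset C, ∃ i, (s : Set C) ⊆ Set.range (f i)) : IsNormalRing C := by
  classical
  intro a b n c hrel
  obtain ⟨i, hi⟩ := hcov ({a, b} ∪ (range n).image c)
  obtain ⟨a', rfl⟩ := hi (show a ∈ _ by simp)
  obtain ⟨b', rfl⟩ := hi (show b ∈ _ by simp)
  have : ∀ j, ∃ c', j < n → f i c' = c j := by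
    intro j
    by_cases hj : j < n
    · obtain ⟨c', hc'⟩ := hi (show c j ∈ _ by
        simp only [coe_union, Set.mem_union, mem_coe, mem_image, mem_range]
        exact Or.inr ⟨j, hj, rfl⟩)
      exact ⟨c', fun _ => hc'⟩
    · exact ⟨0, fun h => absurd h hj⟩
  choose c' hc' using this
  refine map_dvd (f i) (hD i a' b' n c' (hinj i ?_))
  rw [map_pow, hrel, map_sum]
  refine sum_congr rfl fun j hj => ?_
  rw [map_mul, map_mul, map_pow, map_pow, hc' j (mem_range.mp hj)]

/-- If `z = a / b` in an extension, an integral equation of `z` gives a homogeneous relation. -/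
theorem exists_pow_eq_sum_of_isIntegral {Q : Type*} [CommRing Q] [Algebra C Q]
    (hinj : Function.Injective (algebraMap C Q)) {z : Q} {a b : C}
    (hz : algebraMap C Q b * z = algebraMap C Q a) (hint : IsIntegral C z) :
    ∃ (n : ℕ) (c : ℕ → C), a ^ n = ∑ i ∈ range n, c i * a ^ i * b ^ (n - i) := by
  obtain ⟨n, c, hrel⟩ := isIntegral_iff_exists_pow_eq_sum.mp hint
  refine ⟨n, c, hinj ?_⟩
  simp only [map_pow, map_sum, map_mul]
  rw [← hz, mul_pow, hrel, mul_sum]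
  refine sum_congr rfl fun i hi => ?_
  rw [mul_pow]
  have : n = (n - i) + i := by have := mem_range.mp hi; omega
  conv_lhs => rw [this, pow_add]
  ring

theorem IsNormalRing.mem_range_of_isIntegral {Q : Type*} [CommRing Q] [Algebra C Q]
    (h : IsNormalRing C) (hinj : Function.Injective (algebraMap C Q)) {z : Q} {a b : C}
    (hb : IsSMulRegular Q (algebraMap C Q b)) (hz : algebraMap C Q b * z = algebraMap C Q a)
    (hint : IsIntegral C z) : ∃ d, algebraMap C Q d = z := by
  obtain ⟨n, c, hrel⟩ := exists_pow_eq_sum_of_isIntegral hinj hz hint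
  obtain ⟨d, hd⟩ := h a b n c hrel
  refine ⟨d, hb ?_⟩
  simp only [smul_eq_mul]
  rw [hz, hd, map_mul]

/-- A ring which is integrally closed in a reduced von Neumann regular ring is normal. -/
theorem IsNormalRing.of_isIntegrallyClosedIn {Q : Type*} [CommRing Q] [Algebra C Q] [IsReduced Q]
    (hvnr : ∀ x : Q, ∃ w, x * w * x = x) (hinj : Function.Injective (algebraMap C Q))
    (hcl : ∀ z : Q, IsIntegral C z → ∃ d, algebraMap C Q d = z) : IsNormalRing C := by
  intro a b n c hrel
  obtain ⟨w, hw⟩ := hvnr (algebraMap C Q b)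
  set α := algebraMap C Q a
  set β := algebraMap C Q b
  have hrelQ : α ^ n = ∑ i ∈ range n, algebraMap C Q (c i) * α ^ i * β ^ (n - i) := by
    have := congrArg (algebraMap C Q) hrel
    simpa [map_sum] using this
  -- The element βw is the idempotent cutting out the part of Q on which β is invertible. It is
  -- integral over C, so it comes from C.
  have hidem : (β * w) ^ 2 = β * w := by
    calc (β * w) ^ 2 = β * w * β * w := by ring
      _ = β * w := by rw [hw]
  have hidemint : IsIntegral C (β * w) :=
    ⟨X ^ 2 - X, by
      nontriviality C
      exact monic_X_pow_sub (by rw [degree_X]; exact_mod_cast one_lt_two), by simp [hidem]⟩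
  obtain ⟨e, he⟩ := hcl _ hidemint
  have hepow : ∀ k, k ≠ 0 → (β * w) ^ k = β * w := by
    intro k hk
    induction k with
    | zero => exact absurd rfl hk
    | succ k ih =>
      rcases Nat.eq_zero_or_pos k with rfl | hk'
      · simp
      · rw [pow_succ, ih hk'.ne', ← pow_two, hidem]
  -- The quotient is αw. Multiplying the relation by w^n turns β^(n-i) into (βw)^(n-i) = βw, an
  -- element of C, which gives a monic equation.
  obtain ⟨d, hd⟩ := hcl (α * w) (by
    rw [isIntegral_iff_exists_pow_eq_sum]
    rcases Nat.eq_zero_or_pos n with rfl | hn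
    · exact ⟨0, 0, by
        have : (1 : Q) = 0 := by simpa using hrelQ
        simpa using this⟩
    refine ⟨n, fun i => c i * e, ?_⟩
    rw [mul_pow, hrelQ, sum_mul]
    refine sum_congr rfl fun i hi => ?_
    rw [map_mul, he, ← hepow (n - i) (by have := mem_range.mp hi; omega)]
    have : n = (n - i) + i := by have := mem_range.mp hi; omega
    conv_lhs => rw [this, pow_add]
    rw [show n - i + i - i = n - i by omega]
    ring)
  refine ⟨d, hinj ?_⟩
  rw [map_mul, hd]
  -- The idempotent 1 - βw kills β, hence every term of the relation and so α^n. Reducedness does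
  -- the rest.
  have hz : (1 - β * w) * α = 0 := by
    have : IsNilpotent ((1 - β * w) * α) := by
      refine ⟨n + 1, ?_⟩
      have h0 : (1 - β * w) * α ^ n = 0 := by
        rw [hrelQ, mul_sum]
        refine sum_eq_zero fun i hi => ?_
        have : n - i = (n - i - 1) + 1 := by have := mem_range.mp hi; omega
        rw [this, pow_succ]
        have : (1 - β * w) * β = 0 := by
          rw [sub_mul, one_mul, hw, sub_self]
        linear_combination (algebraMap C Q (c i) * α ^ i * β ^ (n - i - 1)) * this
      calc ((1 - β * w) * α) ^ (n + 1)
          = (1 - β * w) ^ n * α * ((1 - β * w) * α ^ n) := by rw [mul_pow, pow_succ, pow_succ]; ring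
        _ = 0 := by rw [h0, mul_zero]
    exact this.eq_zero
  linear_combination hz

theorem IsNormalRing.of_isLocalization (S : Submonoid C) (D : Type*) [CommRing D] [Algebra C D]
    [IsLocalization S D] (h : IsNormalRing C) : IsNormalRing D := by
  classical
  intro a b n c hrel
  rcases eq_or_ne n 0 with rfl | hn
  · have h1 : (1 : D) = 0 := by simpa using hrel
    have := subsingleton_of_zero_eq_one h1.symm
    exact ⟨0, Subsingleton.elim _ _⟩
  obtain ⟨s, hs⟩ := IsLocalization.exist_integer_multiples_of_finset S
    (({a, b} : Finset D) ∪ (range n).image c)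
  obtain ⟨a₀, ha₀⟩ := hs a (by simp)
  obtain ⟨b₀, hb₀⟩ := hs b (by simp)
  have hc : ∀ i, ∃ c₀, i < n → algebraMap C D c₀ = algebraMap C D s * c i := by
    intro i
    by_cases hi : i < n
    · obtain ⟨c₀, hc₀⟩ := hs (c i) (by
        simp only [mem_union, mem_image, mem_range]; exact Or.inr ⟨i, hi, rfl⟩)
      exact ⟨c₀, fun _ => by rw [hc₀, Algebra.smul_def]⟩
    · exact ⟨0, fun h => absurd h hi⟩
  choose c₀ hc₀ using hc
  rw [Algebra.smul_def] at ha₀ hb₀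
  -- Since i < n in every term, the additional factor s on `a₀` leaves at least one spare s per term
  -- to clear the denominator of c i.
  have key : algebraMap C D ((s * a₀) ^ n) = algebraMap C D
      (∑ i ∈ range n, (c₀ i * s ^ (n - i - 1)) * (s * a₀) ^ i * b₀ ^ (n - i)) := by
    simp only [map_pow, map_mul, map_sum]
    rw [ha₀, hb₀, mul_pow, mul_pow, hrel, mul_sum, mul_sum]
    refine sum_congr rfl fun i hi => ?_
    have hi := mem_range.mp hi
    rw [hc₀ i hi]
    obtain ⟨k, rfl⟩ : ∃ k, n = i + k + 1 := ⟨n - i - 1, by omega⟩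
    rw [show i + k + 1 - i - 1 = k by omega, show i + k + 1 - i = k + 1 by omega]
    ring
  obtain ⟨u, hu⟩ := IsLocalization.exists_of_eq (M := S) key
  -- The relation holds in C only after multiplication by u. The same device, scaling the first
  -- argument, absorbs u into the coefficients.
  obtain ⟨d, hd⟩ := h (u * (s * a₀)) b₀ n
    (fun i => c₀ i * s ^ (n - i - 1) * (u : C) ^ (n - i)) (by
      rw [mul_pow, ← Nat.sub_add_cancel (Nat.pos_of_ne_zero hn), pow_succ, mul_assoc,
        Nat.sub_add_cancel (Nat.pos_of_ne_zero hn), hu, mul_sum, mul_sum]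
      refine sum_congr rfl fun i hi => ?_
      have hi := mem_range.mp hi
      obtain ⟨k, rfl⟩ : ∃ k, n = i + k + 1 := ⟨n - i - 1, by omega⟩
      rw [show i + k + 1 - i - 1 = k by omega, show i + k + 1 - i = k + 1 by omega,
        show i + k + 1 - 1 = i + k by omega]
      ring)
  have hsu := IsLocalization.map_units D s
  have huu := IsLocalization.map_units D u
  have h2 := congrArg (algebraMap C D) hd
  simp only [map_mul] at h2
  rw [ha₀, hb₀, mul_assoc] at h2
  have : b ∣ algebraMap C D u * (algebraMap C D s * (algebraMap C D s * a)) :=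
    ⟨algebraMap C D s * algebraMap C D d, by rw [h2]; ring⟩
  rwa [huu.dvd_mul_left, hsu.dvd_mul_left, hsu.dvd_mul_left] at this

/-- Divisibility is local: an element which is divisible by `b` near every maximal ideal is
divisible by `b`. -/
theorem dvd_of_forall_isMaximal {a b : C}
    (h : ∀ m : Ideal C, m.IsMaximal → ∃ s ∉ m, b ∣ s * a) : b ∣ a := by
  by_contra hab
  let I : Ideal C := Submodule.colon (Ideal.span {b}) {a}
  have hI : ∀ s, s ∈ I ↔ b ∣ s * a := fun s => by
    rw [Submodule.mem_colon_singleton, smul_eq_mul, Ideal.mem_span_singleton]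
  have : I ≠ ⊤ := by
    rw [Ne, Ideal.eq_top_iff_one, hI, one_mul]; exact hab
  obtain ⟨m, hm, hIm⟩ := Ideal.exists_le_maximal I this
  obtain ⟨s, hs, hsa⟩ := h m hm
  exact hs (hIm ((hI s).mpr hsa))

theorem exists_dvd_mul_of_algebraMap_dvd (S : Submonoid C) (D : Type*) [CommRing D] [Algebra C D]
    [IsLocalization S D] {a b : C} (h : algebraMap C D b ∣ algebraMap C D a) :
    ∃ s ∈ S, b ∣ s * a := by
  obtain ⟨d, hd⟩ := h
  obtain ⟨⟨d₀, s⟩, rfl⟩ := IsLocalization.mk'_surjective S d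
  have : algebraMap C D (s * a) = algebraMap C D (b * d₀) := by
    rw [map_mul, map_mul, hd]
    linear_combination (algebraMap C D b) * IsLocalization.mk'_spec' D d₀ s
  obtain ⟨u, hu⟩ := IsLocalization.exists_of_eq (M := S) this
  exact ⟨u * s, mul_mem u.2 s.2, u * d₀, by rw [mul_assoc, hu]; ring⟩

/-- Normality is a local property. -/
theorem IsNormalRing.of_forall_isMaximal
    (h : ∀ m : Ideal C, m.IsMaximal → ∃ (S : Submonoid C) (D : Type _) (_ : CommRing D)
      (_ : Algebra C D) (_ : IsLocalization S D), (∀ s ∈ S, s ∉ m) ∧ IsNormalRing D) :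
    IsNormalRing C := by
  intro a b n c hrel
  refine dvd_of_forall_isMaximal fun m hm => ?_
  obtain ⟨S, D, _, _, _, hS, hD⟩ := h m hm
  obtain ⟨s, hs, hd⟩ := exists_dvd_mul_of_algebraMap_dvd S D
    (hD (algebraMap C D a) (algebraMap C D b) n (fun i => algebraMap C D (c i)) (by
      rw [← map_pow, hrel]; simp [map_sum]))
  exact ⟨s, hS s hs, hd⟩

theorem IsNormalDomain.isNormalRing (h : IsNormalDomain C) : IsNormalRing C := by
  have := h.1
  have := h.2
  refine .of_isIntegrallyClosedIn (Q := FractionRing C) (fun x => ?_)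
    (IsFractionRing.injective C _) fun z hz => IsIntegrallyClosed.algebraMap_eq_of_integral hz
  by_cases hx : x = 0
  · exact ⟨0, by simp [hx]⟩
  · exact ⟨x⁻¹, by simp [hx]⟩

/-- In a local ring one of d and 1 - d is a unit, so this is what makes local normal rings domains.
-/
theorem IsNormalRing.exists_mul_eq_zero (h : IsNormalRing C) {x y : C} (hxy : x * y = 0) :
    ∃ d, d * y = 0 ∧ (1 - d) * x = 0 := by
  have hred := h.isReduced
  -- Since xy = 0, the relation used is x² = x(x + y), and d plays the role of x / (x + y).
  obtain ⟨d, hd⟩ := h x (x + y) 2 (fun i => if i = 1 then 1 else 0) (by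
    simp only [sum_range_succ, range_zero, sum_empty]; simp; linear_combination -hxy)
  have h1 : (1 - d) * x = 0 := by
    refine hred.eq_zero _ ⟨2, ?_⟩
    linear_combination (1 - d) * x * hd + (1 - d) * d * hxy
  exact ⟨d, by linear_combination -hd + h1, h1⟩

theorem IsNormalRing.isNormalDomain_of_isLocalRing [IsLocalRing C] (h : IsNormalRing C) :
    IsNormalDomain C := by
  have hdom : IsDomain C := by
    have : NoZeroDivisors C := ⟨fun {x y} hxy => by
      obtain ⟨d, hd, hd'⟩ := h.exists_mul_eq_zero hxy
      rcases IsLocalRing.isUnit_or_isUnit_one_sub_self d with hu | hu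
      · exact Or.inr (hu.mul_right_eq_zero.mp hd)
      · exact Or.inl (hu.mul_right_eq_zero.mp hd')⟩
    exact NoZeroDivisors.to_isDomain C
  refine ⟨hdom, (isIntegrallyClosed_iff (FractionRing C)).mpr fun {z} hz => ?_⟩
  obtain ⟨a, b, hb, rfl⟩ := IsFractionRing.div_surjective (A := C) z
  have hb' : algebraMap C (FractionRing C) b ≠ 0 := by
    simpa using nonZeroDivisors.ne_zero hb
  exact h.mem_range_of_isIntegral (IsFractionRing.injective C _) (a := a) (b := b)
    (fun x y hxy => mul_left_cancel₀ hb' hxy) (by field_simp) hz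

theorem isNormalDomain_iff_isNormalRing [IsLocalRing C] : IsNormalDomain C ↔ IsNormalRing C :=
  ⟨fun h => h.isNormalRing, fun h => h.isNormalDomain_of_isLocalRing⟩

end NormalRing

/-! ### Comparison with normality of the local rings -/

section NormalRing

variable {C : Type u} [CommRing C]

theorem IsNormalRing.isNormalDomain (h : IsNormalRing C) (p : Ideal C) [p.IsPrime] :
    IsNormalDomain (Localization.AtPrime p) :=
  (h.of_isLocalization p.primeCompl (Localization.AtPrime p)).isNormalDomain_of_isLocalRing

theorem isNormalRing_iff : IsNormalRing C ↔
    ∀ p : PrimeSpectrum C, IsNormalDomain (Localization.AtPrime p.asIdeal) :=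
  ⟨fun h p => h.isNormalDomain p.asIdeal, fun h => .of_forall_isMaximal fun m hm =>
    ⟨m.primeCompl, Localization.AtPrime m, inferInstance, inferInstance, inferInstance, fun _ hs => hs,
      (h ⟨m, hm.isPrime⟩).isNormalRing⟩⟩

end NormalRing


/-! ### Normality is geometric over perfect fields -/

section GeometricallyNormal

open TensorProduct

theorem exists_mul_mul_eq_self_of_isArtinianRing {Q : Type*} [CommRing Q] [IsArtinianRing Q]
    [_root_.IsReduced Q] (x : Q) : ∃ w, x * w * x = x := by
  obtain ⟨n, y, hy⟩ := IsArtinian.exists_pow_succ_smul_dvd x (1 : Q)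
  refine ⟨y, ?_⟩
  have : IsNilpotent (x * y * x - x) := by
    refine ⟨n + 1, ?_⟩
    have hy' : x ^ n * (x * y - 1) = 0 := by
      simp only [smul_eq_mul, mul_one, Nat.succ_eq_add_one] at hy
      rw [pow_succ] at hy
      linear_combination hy
    calc (x * y * x - x) ^ (n + 1) = (x * (x * y - 1)) ^ (n + 1) := by ring_nf
      _ = x * (x * y - 1) ^ n * (x ^ n * (x * y - 1)) := by rw [mul_pow, pow_succ, pow_succ]; ring
      _ = 0 := by rw [hy', mul_zero]
  exact sub_eq_zero.mp this.eq_zero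

/-- Normality of a tensor product can be checked after localizing the left factor. -/
theorem IsNormalRing.tensorProduct_of_localization (k C K : Type u) [CommRing k] [CommRing C]
    [Algebra k C] [CommRing K] [Algebra k K]
    (h : ∀ (p : Ideal C) [p.IsPrime], IsNormalRing (Localization.AtPrime p ⊗[k] K)) :
    IsNormalRing (C ⊗[k] K) := by
  refine .of_forall_isMaximal fun m hm => ?_
  let p : Ideal C := m.comap (algebraMap C (C ⊗[k] K))
  have : p.IsPrime := Ideal.comap_isPrime _ _
  let f : C ⊗[k] K →ₐ[C] Localization.AtPrime p ⊗[k] K :=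
    Algebra.TensorProduct.map (Algebra.ofId C _) (AlgHom.id k K)
  let := f.toRingHom.toAlgebra
  have : IsScalarTower C (C ⊗[k] K) (Localization.AtPrime p ⊗[k] K) :=
    .of_algebraMap_eq' f.comp_algebraMap.symm
  have hloc := IsLocalization.tensorProduct_tensorProduct k K p.primeCompl
    (Localization.AtPrime p) (by
      ext x
      change f (1 ⊗ₜ x) = _
      simp [f])
  refine ⟨_, _, inferInstance, inferInstance, hloc, ?_, h p⟩
  rintro _ ⟨s, hs, rfl⟩ hsm
  exact hs hsm

/-- L is étale over k, and integral closure commutes with smooth base change, so C ⊗ L is integrally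
closed in C ⊗ L ⊗ Frac C. The latter is finite étale over Frac C, hence reduced Artinian and von
Neumann regular. -/
theorem IsNormalRing.tensorProduct_of_isSeparable_of_isNormalDomain (k C L : Type u) [Field k]
    [CommRing C] [Algebra k C] [Field L] [Algebra k L] [Algebra.IsSeparable k L]
    [Module.Finite k L] (h : IsNormalDomain C) : IsNormalRing (C ⊗[k] L) := by
  have := h.1
  have := h.2
  have : Algebra.FormallyEtale k L := Algebra.FormallyEtale.of_isSeparable k L
  have : Algebra.FinitePresentation k L := Algebra.FinitePresentation.of_finiteType.mp inferInstance
  have : Algebra.Etale k L := {}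
  let F := FractionRing C
  let S := C ⊗[k] L
  have : Algebra.Etale F (F ⊗[C] S) := inferInstance
  have : Module.Finite F (F ⊗[C] S) := inferInstance
  have : IsArtinianRing (F ⊗[C] S) := IsArtinianRing.of_finite F _
  have : _root_.IsReduced (F ⊗[C] S) := Algebra.FormallyUnramified.isReduced_of_field F _
  let e : F ⊗[C] S ≃ₐ[C] S ⊗[C] F := Algebra.TensorProduct.comm C F S
  have : IsArtinianRing (S ⊗[C] F) := e.toRingEquiv.surjective.isArtinianRing
  have : _root_.IsReduced (S ⊗[C] F) := isReduced_of_injective e.symm e.symm.injective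
  refine .of_isIntegrallyClosedIn (Q := S ⊗[C] F) exists_mul_mul_eq_self_of_isArtinianRing ?_ ?_
  · exact Algebra.TensorProduct.includeLeft_injective (S := C) (IsFractionRing.injective C F)
  · intro z hz
    obtain ⟨y, hy⟩ := (TensorProduct.toIntegralClosure_bijective_of_smooth
      (R := C) (S := S) (B := F)).surjective ⟨z, hz⟩
    have hy' : Algebra.TensorProduct.map (AlgHom.id S S) (integralClosure C F).val y = z :=
      congrArg Subtype.val hy
    rw [← hy']
    clear hy hy'
    induction y with
    | zero => exact ⟨0, by simp⟩
    | add x y hx hy =>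
      obtain ⟨a, ha⟩ := hx
      obtain ⟨b, hb⟩ := hy
      exact ⟨a + b, by rw [map_add, map_add, ha, hb]⟩
    | tmul x y =>
      obtain ⟨c, hc⟩ := IsIntegrallyClosed.algebraMap_eq_of_integral y.2
      refine ⟨c • x, ?_⟩
      rw [Algebra.TensorProduct.map_tmul]
      change (c • x) ⊗ₜ[C] (1 : F) = x ⊗ₜ[C] (y : F)
      rw [← hc, Algebra.algebraMap_eq_smul_one, smul_tmul]

theorem IsNormalRing.tensorProduct_of_isSeparable (k C L : Type u) [Field k]
    [CommRing C] [Algebra k C] [Field L] [Algebra k L] [Algebra.IsSeparable k L]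
    [Module.Finite k L] (h : IsNormalRing C) : IsNormalRing (C ⊗[k] L) :=
  .tensorProduct_of_localization k C L fun p _ =>
    .tensorProduct_of_isSeparable_of_isNormalDomain k _ L (h.isNormalDomain p)

/-- Over the fraction field the polynomial ring is factorial, hence integrally closed. A polynomial
integral over C[σ] has coefficients integral over C, so it descends. -/
theorem isIntegrallyClosed_mvPolynomial (σ : Type u) (C : Type u) [CommRing C] [IsDomain C]
    [IsIntegrallyClosed C] : IsIntegrallyClosed (MvPolynomial σ C) := by
  let K := FractionRing C
  have : IsIntegrallyClosed (MvPolynomial σ K) := UniqueFactorizationMonoid.instIsIntegrallyClosed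
  let := MvPolynomial.algebraMvPolynomial (σ := σ) (R := C) (S := K)
  suffices IsIntegrallyClosedIn (MvPolynomial σ C) (MvPolynomial σ K) from
    .of_isIntegrallyClosed_of_isIntegrallyClosedIn _ (MvPolynomial σ K)
  refine isIntegrallyClosedIn_iff.mpr
    ⟨MvPolynomial.map_injective _ (IsFractionRing.injective _ _), fun {p} hp => ?_⟩
  have hc : ∀ n, ∃ c, algebraMap C K c = p.coeff n := fun n =>
    IsIntegrallyClosed.isIntegral_iff.mp (MvPolynomial.isIntegral_iff_isIntegral_coeff.mp hp n)
  have : p ∈ Set.range (MvPolynomial.map (σ := σ) (algebraMap C K)) := by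
    rw [MvPolynomial.mem_range_map_iff_coeffs_subset]
    intro x hx
    obtain ⟨n, -, rfl⟩ := MvPolynomial.mem_coeffs_iff.mp hx
    exact hc n
  exact this

theorem IsNormalRing.tensorProduct_mvPolynomial (k C σ : Type u) [CommRing k] [CommRing C]
    [Algebra k C] (h : IsNormalRing C) : IsNormalRing (C ⊗[k] MvPolynomial σ k) := by
  refine .tensorProduct_of_localization k C _ fun p _ => ?_
  have hp := h.isNormalDomain p
  have := hp.1
  have := hp.2
  have : IsNormalRing (MvPolynomial σ (Localization.AtPrime p)) :=
    IsNormalDomain.isNormalRing ⟨inferInstance, isIntegrallyClosed_mvPolynomial σ _⟩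
  exact this.of_ringEquiv (MvPolynomial.algebraTensorAlgEquiv k _).symm.toRingEquiv

theorem IsNormalRing.tensorProduct_of_isLocalization (k C U V : Type u) [CommRing k] [CommRing C]
    [Algebra k C] [CommRing U] [Algebra k U] [CommRing V] [Algebra k V] [Algebra U V]
    [IsScalarTower k U V] (M : Submonoid U) [IsLocalization M V] (h : IsNormalRing (C ⊗[k] U)) :
    IsNormalRing (C ⊗[k] V) := by
  let f : C ⊗[k] U →ₐ[C] C ⊗[k] V :=
    Algebra.TensorProduct.map (AlgHom.id C C) (IsScalarTower.toAlgHom k U V)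
  let := f.toRingHom.toAlgebra
  have : IsScalarTower C (C ⊗[k] U) (C ⊗[k] V) := .of_algebraMap_eq' f.comp_algebraMap.symm
  have := IsLocalization.tensorProduct_tensorProduct_right k C M V (by
      ext x
      change f (1 ⊗ₜ x) = _
      simp [f])
  exact h.of_isLocalization (M.map (Algebra.TensorProduct.includeRight (R := k) (A := C))) _

/-- A purely transcendental extension is a localization of a polynomial ring. -/
theorem IsNormalRing.tensorProduct_adjoin (k C K : Type u) [Field k] [CommRing C] [Algebra k C]
    [Field K] [Algebra k K] (s : Set K) (hs : AlgebraicIndependent k ((↑) : s → K))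
    (h : IsNormalRing C) : IsNormalRing (C ⊗[k] IntermediateField.adjoin k s) := by
  have h1 : IsNormalRing (C ⊗[k] Algebra.adjoin k s) := by
    have e : MvPolynomial s k ≃ₐ[k] Algebra.adjoin k s :=
      hs.aevalEquiv.trans (Subalgebra.equivOfEq _ _ (by rw [Subtype.range_coe]))
    exact (IsNormalRing.tensorProduct_mvPolynomial k C s h).of_ringEquiv
      (Algebra.TensorProduct.congr (AlgEquiv.refl (R := k) (A₁ := C)) e).toRingEquiv
  open scoped IntermediateField.algebraAdjoinAdjoin in
  exact h1.tensorProduct_of_isLocalization k C (Algebra.adjoin k s) _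
    (nonZeroDivisors (Algebra.adjoin k s))

theorem IsNormalRing.tensorProduct_tower (k C E K : Type u) [Field k] [CommRing C] [Algebra k C]
    [Field E] [Algebra k E] [Field K] [Algebra k K] [Algebra E K] [IsScalarTower k E K]
    [Module.Finite E K] [Algebra.IsSeparable E K] (h : IsNormalRing (C ⊗[k] E)) :
    IsNormalRing (C ⊗[k] K) := by
  have h1 : IsNormalRing (E ⊗[k] C) := h.of_ringEquiv (Algebra.TensorProduct.comm k C E).toRingEquiv
  have h2 : IsNormalRing ((E ⊗[k] C) ⊗[E] K) := .tensorProduct_of_isSeparable E _ K h1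
  exact ((h2.of_ringEquiv (Algebra.TensorProduct.comm E _ K).toRingEquiv).of_ringEquiv
    (Algebra.TensorProduct.cancelBaseChange k E E K C).toRingEquiv).of_ringEquiv
    (Algebra.TensorProduct.comm k K C).toRingEquiv

/-- A finitely generated extension of a perfect field has a separating transcendence basis, so it
splits into a purely transcendental step and a finite separable one. -/
theorem IsNormalRing.tensorProduct_of_essFiniteType (k C K : Type u) [Field k] [PerfectField k]
    [CommRing C] [Algebra k C] [Field K] [Algebra k K] [Algebra.EssFiniteType k K]
    (h : IsNormalRing C) : IsNormalRing (C ⊗[k] K) := by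
  obtain ⟨s, hs, hsep⟩ := exists_isTranscendenceBasis_and_isSeparable_of_perfectField k K
  let E := IntermediateField.adjoin k (s : Set K)
  have : Algebra.EssFiniteType E K := Algebra.EssFiniteType.of_comp k E K
  have : Algebra.FormallyUnramified E K := Algebra.FormallyUnramified.of_isSeparable E K
  have : Module.Finite E K := Algebra.FormallyUnramified.finite_of_free E K
  exact (IsNormalRing.tensorProduct_adjoin k C K s hs.1 h).tensorProduct_tower k C E K

/-- A tensor involves only finitely many elements of K, and flatness of C over k keeps the maps C ⊗
E i → C ⊗ K injective. -/
theorem IsNormalRing.tensorProduct_of_directed (k C K : Type u) [Field k] [CommRing C]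
    [Algebra k C] [CommRing K] [Algebra k K] {ι : Type*} (E : ι → Type u) [∀ i, CommRing (E i)]
    [∀ i, Algebra k (E i)] (g : ∀ i, E i →ₐ[k] K) (hg : ∀ i, Function.Injective (g i))
    (hcov : ∀ s : Finset K, ∃ i, (s : Set K) ⊆ Set.range (g i))
    (h : ∀ i, IsNormalRing (C ⊗[k] E i)) : IsNormalRing (C ⊗[k] K) := by
  classical
  let f : ∀ i, C ⊗[k] E i →ₐ[C] C ⊗[k] K := fun i =>
    Algebra.TensorProduct.map (AlgHom.id C C) (g i)
  have hone : ∀ z : C ⊗[k] K, ∃ s : Finset K, ∀ i, (s : Set K) ⊆ Set.range (g i) →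
      z ∈ Set.range (f i) := by
    intro z
    induction z with
    | zero => exact ⟨∅, fun i _ => ⟨0, by simp⟩⟩
    | add x y hx hy =>
      obtain ⟨s, hs⟩ := hx
      obtain ⟨s', hs'⟩ := hy
      refine ⟨s ∪ s', fun i hi => ?_⟩
      rw [Finset.coe_union, Set.union_subset_iff] at hi
      obtain ⟨a, ha⟩ := hs i hi.1
      obtain ⟨b, hb⟩ := hs' i hi.2
      exact ⟨a + b, by rw [map_add, ha, hb]⟩
    | tmul c x =>
      refine ⟨{x}, fun i hi => ?_⟩
      obtain ⟨y, rfl⟩ := hi (Finset.mem_singleton_self x)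
      exact ⟨c ⊗ₜ y, by simp [f]⟩
  choose S hS using hone
  refine .of_directed (fun i => C ⊗[k] E i) (fun i => (f i).toRingHom) h (fun i => ?_)
    fun t => ?_
  · exact Module.Flat.lTensor_preserves_injective_linearMap (M := C) (g i).toLinearMap (hg i)
  · obtain ⟨i, hi⟩ := hcov (t.biUnion S)
    refine ⟨i, fun z hz => hS z i (subset_trans ?_ hi)⟩
    exact_mod_cast Finset.subset_biUnion_of_mem S hz

/-- Normal algebras over a perfect field are geometrically normal. -/
theorem IsNormalRing.tensorProduct_of_perfectField (k C K : Type u) [Field k] [PerfectField k]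
    [CommRing C] [Algebra k C] [Field K] [Algebra k K]
    (h : IsNormalRing C) : IsNormalRing (C ⊗[k] K) := by
  refine .tensorProduct_of_directed k C K
    (fun s : Finset K => IntermediateField.adjoin k (s : Set K))
    (fun s => (IntermediateField.adjoin k (s : Set K)).val) (fun s => Subtype.val_injective)
    (fun s => ⟨s, fun x hx => ⟨⟨x, IntermediateField.subset_adjoin k _ hx⟩, rfl⟩⟩) fun s => ?_
  have : Algebra.EssFiniteType k (IntermediateField.adjoin k (s : Set K)) :=
    (IntermediateField.essFiniteType_iff).mpr (IntermediateField.fg_adjoin_finset s)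
  exact .tensorProduct_of_essFiniteType k C _ h

end GeometricallyNormal


/-! ### Translation between schemes and rings -/

section Schemes

open TensorProduct

theorem isNormalScheme_of_iso {X Y : Scheme.{u}} (e : X ≅ Y) (h : IsNormalScheme Y) :
    IsNormalScheme X := by
  intro x
  have e' : Y.presheaf.stalk (e.hom x) ≃+* X.presheaf.stalk x :=
    (asIso (e.hom.stalkMap x)).commRingCatIsoToRingEquiv
  have := isNormalDomain_iff_isNormalRing.mp (h (e.hom x))
  exact isNormalDomain_iff_isNormalRing.mpr (this.of_ringEquiv e')

instance : ObjectProperty.IsClosedUnderIsomorphisms (IsNormalScheme : ObjectProperty Scheme.{u}) :=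
  ⟨fun e h => isNormalScheme_of_iso e.symm h⟩

theorem isNormalScheme_Spec_iff {C : Type u} [CommRing C] :
    IsNormalScheme (Spec (CommRingCat.of C)) ↔ IsNormalRing C := by
  rw [isNormalRing_iff]
  refine forall_congr' fun (x : PrimeSpectrum C) => ?_
  have e : (Spec (CommRingCat.of C)).presheaf.stalk x ≃+* Localization.AtPrime x.asIdeal :=
    (AlgebraicGeometry.Spec.stalkIso (CommRingCat.of C) x).commRingCatIsoToRingEquiv
  have : IsLocalRing ((Spec (CommRingCat.of C)).presheaf.stalk x) := e.symm.isLocalRing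
  rw [isNormalDomain_iff_isNormalRing, isNormalDomain_iff_isNormalRing]
  exact ⟨fun h => h.of_ringEquiv e, fun h => h.of_ringEquiv e.symm⟩

theorem mem_genericPoints_of_homeomorph {X Y : Type*} [TopologicalSpace X] [TopologicalSpace Y]
    (e : X ≃ₜ Y) {x : X} (hx : x ∈ genericPoints X) : e x ∈ genericPoints Y := by
  have h : closure {e x} = e '' closure {x} := by
    rw [← Set.image_singleton, e.image_closure]
  change closure {e x} ∈ irreducibleComponents Y
  rw [h, irreducibleComponents_eq_maximals_closed]
  have hx : closure {x} ∈ irreducibleComponents X := hx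
  rw [irreducibleComponents_eq_maximals_closed] at hx
  refine ⟨⟨e.isClosed_image.mpr hx.1.1, hx.1.2.image e e.continuous.continuousOn⟩, ?_⟩
  rintro t ⟨ht1, ht2⟩ hle
  have := hx.2 (y := e.symm '' t) ⟨e.symm.isClosed_image.mpr ht1,
    ht2.image e.symm e.symm.continuous.continuousOn⟩ (by
      intro y hy
      exact ⟨e y, hle ⟨y, hy, rfl⟩, e.symm_apply_apply y⟩)
  intro z hz
  exact ⟨e.symm z, this ⟨z, hz, rfl⟩, e.apply_symm_apply z⟩

theorem isBirational_of_isIso {X Y : Scheme.{u}} (g : X ⟶ Y) [IsIso g] : IsBirational g := by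
  let e := g.homeomorph
  refine ⟨⟨fun x hx => mem_genericPoints_of_homeomorph e hx, e.injective.injOn, fun y hy =>
    ⟨e.symm y, mem_genericPoints_of_homeomorph e.symm hy, e.apply_symm_apply y⟩⟩, fun x _ => ?_⟩
  infer_instance

theorem IsBirational.comp {X Y Z : Scheme.{u}} {f : X ⟶ Y} {g : Y ⟶ Z} (hf : IsBirational f)
    (hg : IsBirational g) : IsBirational (f ≫ g) := by
  refine ⟨?_, fun x hx => ?_⟩
  · have := hg.1.comp hf.1
    exact this.congr fun x _ => by simp
  · have h1 := hf.2 x hx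
    have h2 := hg.2 (f x) (hf.1.mapsTo hx)
    rw [Scheme.Hom.stalkMap_comp]
    exact IsIso.comp_isIso' h2 h1

/-- The ring-theoretic counterpart of `IsBirational`. -/
def IsBirationalHom {B C : Type*} [CommRing B] [CommRing C] (φ : B →+* C) : Prop :=
  Set.BijOn (PrimeSpectrum.comap φ) {q | q.asIdeal ∈ minimalPrimes C}
    {p | p.asIdeal ∈ minimalPrimes B} ∧
  ∀ q : PrimeSpectrum C, q.asIdeal ∈ minimalPrimes C → Function.Bijective
    (Localization.localRingHom (PrimeSpectrum.comap φ q).asIdeal q.asIdeal φ rfl)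

theorem genericPoints_Spec (C : CommRingCat.{u}) :
    genericPoints (Spec C) = {q : PrimeSpectrum C | q.asIdeal ∈ minimalPrimes C} := by
  refine Set.ext fun (q : PrimeSpectrum C) => ?_
  have := (PrimeSpectrum.vanishingIdeal_mem_minimalPrimes (s := {q})).symm
  rwa [PrimeSpectrum.vanishingIdeal_singleton] at this

theorem isBirational_Spec_iff {B C : CommRingCat.{u}} (φ : B ⟶ C) :
    IsBirational (Spec.map φ) ↔ IsBirationalHom φ.hom := by
  rw [IsBirational, IsBirationalHom, genericPoints_Spec, genericPoints_Spec]
  refine and_congr Iff.rfl (forall_congr' fun q => forall_congr' fun _ => ?_)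
  have := (MorphismProperty.isomorphisms CommRingCat).arrow_mk_iso_iff
    (Scheme.arrowStalkMapSpecIso φ q)
  simp only [MorphismProperty.isomorphisms.iff] at this
  rw [this, ConcreteCategory.isIso_iff_bijective]
  rfl

theorem Spec_map_hom_comp_map_inv_comp {B C : CommRingCat.{u}} (e : B ≅ C) {X : Scheme.{u}}
    (j : Spec C ⟶ X) : Spec.map e.hom ≫ (Spec.map e.inv ≫ j) = Spec.map (𝟙 _) ≫ j := by
  rw [← Category.assoc, ← Spec.map_comp, Iso.inv_hom_id]

section Fiber

variable {X X' S P P' : Scheme.{u}} {f : X ⟶ S} {m : X' ⟶ X} {t : S} {a : P ⟶ X}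
  {b : P ⟶ Spec (S.residueField t)} {a' : P' ⟶ X'} {b' : P' ⟶ Spec (S.residueField t)}

/-- A pullback along the inclusion of the residue field is isomorphic to the fibre. -/
noncomputable def isoFiber (h : IsPullback a b f (S.fromSpecResidueField t)) : P ≅ f.fiber t :=
  h.isoPullback

theorem isoFiber_hom_fiberι (h : IsPullback a b f (S.fromSpecResidueField t)) :
    (isoFiber h).hom ≫ f.fiberι t = a :=
  h.isoPullback_hom_fst

theorem isoFiber_hom_fiberToSpecResidueField (h : IsPullback a b f (S.fromSpecResidueField t)) :
    (isoFiber h).hom ≫ f.fiberToSpecResidueField t = b :=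
  h.isoPullback_hom_snd

theorem fiberMap_fiberι (m : X' ⟶ X) (f : X ⟶ S) (t : S) :
    fiberMap m f t ≫ f.fiberι t = (m ≫ f).fiberι t ≫ m :=
  pullback.lift_fst _ _ _

theorem fiberMap_fiberToSpecResidueField (m : X' ⟶ X) (f : X ⟶ S) (t : S) :
    fiberMap m f t ≫ f.fiberToSpecResidueField t = (m ≫ f).fiberToSpecResidueField t :=
  pullback.lift_snd _ _ _

theorem fiber_hom_ext {g g' : P ⟶ f.fiber t} (h1 : g ≫ f.fiberι t = g' ≫ f.fiberι t)
    (h2 : g ≫ f.fiberToSpecResidueField t = g' ≫ f.fiberToSpecResidueField t) : g = g' :=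
  pullback.hom_ext h1 h2

theorem isoFiber_hom_fiberMap (h : IsPullback a b f (S.fromSpecResidueField t))
    (h' : IsPullback a' b' (m ≫ f) (S.fromSpecResidueField t)) (g : P' ⟶ P)
    (hga : g ≫ a = a' ≫ m) (hgb : g ≫ b = b') :
    (isoFiber h').hom ≫ fiberMap m f t = g ≫ (isoFiber h).hom := by
  apply fiber_hom_ext
  · rw [Category.assoc, Category.assoc, fiberMap_fiberι, isoFiber_hom_fiberι, hga,
      ← Category.assoc, isoFiber_hom_fiberι]
  · rw [Category.assoc, Category.assoc, fiberMap_fiberToSpecResidueField,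
      isoFiber_hom_fiberToSpecResidueField, isoFiber_hom_fiberToSpecResidueField, hgb]

theorem isBirational_fiberMap_iff_of_isPullback (h : IsPullback a b f (S.fromSpecResidueField t))
    (h' : IsPullback a' b' (m ≫ f) (S.fromSpecResidueField t)) (g : P' ⟶ P)
    (hga : g ≫ a = a' ≫ m) (hgb : g ≫ b = b') :
    IsBirational (fiberMap m f t) ↔ IsBirational g := by
  have key := isoFiber_hom_fiberMap h h' g hga hgb
  constructor
  · intro hb
    have : g = ((isoFiber h').hom ≫ fiberMap m f t) ≫ (isoFiber h).inv := by
      rw [key, Category.assoc, Iso.hom_inv_id, Category.comp_id]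
    rw [this]
    exact ((isBirational_of_isIso _).comp hb).comp (isBirational_of_isIso _)
  · intro hb
    have : fiberMap m f t = (isoFiber h').inv ≫ g ≫ (isoFiber h).hom := by
      rw [← key, Iso.inv_hom_id_assoc]
    rw [this]
    exact (isBirational_of_isIso _).comp (hb.comp (isBirational_of_isIso _))

end Fiber

variable {A : Type u} [CommRing A]

/-- The scheme is only assumed isomorphic to Spec R, because the source of a finite morphism is
affine without being a spectrum on the nose. -/
theorem isPullback_fiber (R : Type u) [CommRing R] [Algebra A R] {X : Scheme.{u}}
    (e : Spec (CommRingCat.of R) ≅ X) (g : X ⟶ Spec (CommRingCat.of A))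
    (hg : e.hom ≫ g = structureMap A R) (p : PrimeSpectrum A) :
    IsPullback
      (Spec.map (CommRingCat.ofHom
        (Algebra.TensorProduct.includeRight : R →ₐ[A] p.asIdeal.Fiber R).toRingHom) ≫ e.hom)
      (Spec.map (CommRingCat.ofHom (algebraMap p.asIdeal.ResidueField (p.asIdeal.Fiber R))) ≫
        Spec.map (Scheme.Spec.residueFieldIso (CommRingCat.of A) p).hom)
      g ((Spec (CommRingCat.of A)).fromSpecResidueField p) := by
  have h1 : IsPullback
      (Spec.map (CommRingCat.ofHom
        (Algebra.TensorProduct.includeRight : R →ₐ[A] p.asIdeal.Fiber R).toRingHom))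
      (Spec.map (CommRingCat.ofHom (algebraMap p.asIdeal.ResidueField (p.asIdeal.Fiber R))))
      (structureMap A R)
      (Spec.map (CommRingCat.ofHom (algebraMap A p.asIdeal.ResidueField))) :=
    isPullback_SpecMap_of_isPushout _ _ _ _
      (CommRingCat.isPushout_tensorProduct A p.asIdeal.ResidueField R).flip
  refine h1.of_iso (Iso.refl _) e
    (Scheme.Spec.mapIso (Scheme.Spec.residueFieldIso (CommRingCat.of A) p).symm.op).symm
    (Iso.refl _) ?_ ?_ ?_ ?_
  · simp
  · simp
  · simp [hg]
  -- The residue field of the scheme Spec A at p and that of the ideal are only isomorphic, so the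
  -- two inclusions into Spec A are compared through `residueFieldIso`.
  · have h2 := congrArg (Spec.map (Scheme.Spec.residueFieldIso (CommRingCat.of A) p).hom ≫ ·)
      (Scheme.Spec.map_residueFieldIso_inv_eq_fromSpecResidueField (CommRingCat.of A) p)
    have h3 := (Spec_map_hom_comp_map_inv_comp
      (Scheme.Spec.residueFieldIso (CommRingCat.of A) p)
      (Spec.map (CommRingCat.ofHom (algebraMap A p.asIdeal.ResidueField)))).symm.trans h2
    rw [Iso.refl_hom, Category.comp_id]
    rw [Spec.map_id, Category.id_comp] at h3
    exact h3

/-- The homomorphism of fibres induced by a homomorphism of algebras. -/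
noncomputable abbrev fiberAlgHom (p : PrimeSpectrum A) {R N : Type u} [CommRing R] [Algebra A R]
    [CommRing N] [Algebra A N] (φ : R →ₐ[A] N) :
    p.asIdeal.Fiber R →ₐ[p.asIdeal.ResidueField] p.asIdeal.Fiber N :=
  Algebra.TensorProduct.map (AlgHom.id _ _) φ

theorem isNormalScheme_fiber_iff (R : Type u) [CommRing R] [Algebra A R] {X : Scheme.{u}}
    (e : Spec (CommRingCat.of R) ≅ X) (g : X ⟶ Spec (CommRingCat.of A))
    (hg : e.hom ≫ g = structureMap A R) (p : PrimeSpectrum A) :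
    IsNormalScheme (g.fiber p) ↔ IsNormalRing (p.asIdeal.Fiber R) := by
  rw [← isNormalScheme_Spec_iff]
  have i := (isPullback_fiber R e g hg p).isoPullback
  exact ⟨isNormalScheme_of_iso i, isNormalScheme_of_iso i.symm⟩

theorem isBirational_fiberMap_iff {R N : Type u} [CommRing R] [Algebra A R] [CommRing N]
    [Algebra A N] (φ : R →ₐ[A] N) {X' : Scheme.{u}} (e : Spec (CommRingCat.of N) ≅ X')
    (m : X' ⟶ Spec (CommRingCat.of R)) (hm : e.hom ≫ m = Spec.map (CommRingCat.ofHom φ.toRingHom))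
    (h : e.hom ≫ m ≫ structureMap A R = structureMap A N) (p : PrimeSpectrum A) :
    IsBirational (fiberMap m (structureMap A R) p) ↔
      IsBirationalHom (fiberAlgHom p φ).toRingHom := by
  have h1 := isBirational_Spec_iff (CommRingCat.ofHom (fiberAlgHom p φ).toRingHom)
  rw [CommRingCat.hom_ofHom] at h1
  rw [← h1]
  refine isBirational_fiberMap_iff_of_isPullback
    (isPullback_fiber R (Iso.refl _) (structureMap A R) (by simp) p)
    (isPullback_fiber N e (m ≫ structureMap A R) h p) _ ?_ ?_
  · rw [Category.assoc, hm, Iso.refl_hom, Category.comp_id, ← Spec.map_comp, ← Spec.map_comp,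
      ← CommRingCat.ofHom_comp, ← CommRingCat.ofHom_comp]
    congr 2
  · rw [← Category.assoc, ← Spec.map_comp, ← CommRingCat.ofHom_comp]
    congr 3
    exact (fiberAlgHom p φ).comp_algebraMap

theorem geometrically_isNormalScheme_fiber (R : Type u) [CommRing R] [Algebra A R]
    (p : PrimeSpectrum A) [PerfectField p.asIdeal.ResidueField]
    (h : IsNormalRing (p.asIdeal.Fiber R)) :
    geometrically IsNormalScheme ((structureMap A R).fiberToSpecResidueField p) := by
  rw [(geometrically IsNormalScheme).arrow_mk_iso_iff (Spec.fiberToSpecResidueFieldIso A R p),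
    geometrically_iff_of_commRing_of_isClosedUnderIsomorphisms]
  intro K _ _
  exact isNormalScheme_of_iso (pullbackSpecIso p.asIdeal.ResidueField (p.asIdeal.Fiber R) K)
    (isNormalScheme_Spec_iff.mpr (h.tensorProduct_of_perfectField _ _ K))

/-- The conditions on a ring homomorphism which make it a fiberwise normalization. -/
structure IsFiberwiseNormalizationHom {R N : Type u} [CommRing R] [Algebra A R] [CommRing N]
    [Algebra A N] (φ : R →ₐ[A] N) : Prop where
  finite : φ.toRingHom.Finite
  flat : Module.Flat A N
  normal : ∀ p : PrimeSpectrum A, IsNormalRing (p.asIdeal.Fiber N)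
  birational : ∀ p ∈ Set.range (PrimeSpectrum.comap (algebraMap A R)),
    IsBirationalHom (fiberAlgHom p φ).toRingHom

theorem IsFiberwiseNormalizationHom.admitsSimultaneousNormalization {R N : Type u} [CommRing R]
    [Algebra A R] [CommRing N] [Algebra A N] {φ : R →ₐ[A] N} (h : IsFiberwiseNormalizationHom φ)
    (hp : ∀ p : PrimeSpectrum A, PerfectField p.asIdeal.ResidueField) :
    AdmitsSimultaneousNormalization (structureMap A R) := by
  let m := Spec.map (CommRingCat.ofHom φ.toRingHom)
  have hm : m ≫ structureMap A R = structureMap A N := by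
    rw [← Spec.map_comp, ← CommRingCat.ofHom_comp]
    congr 2
    exact φ.comp_algebraMap
  refine ⟨_, m, ⟨(IsFinite.SpecMap_iff _).mpr h.finite, ?_, fun p => ?_, fun p hp => ?_⟩,
    fun p => ?_⟩
  · rw [hm]
    refine (HasRingHomProperty.Spec_iff (P := @Flat)).mpr ?_
    exact RingHom.flat_algebraMap_iff.mpr h.flat
  · exact (isNormalScheme_fiber_iff N (Iso.refl _) _ (by simpa using hm) p).mpr (h.normal p)
  · exact (isBirational_fiberMap_iff φ (Iso.refl _) m (by simp [m]) (by simpa using hm) p).mpr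
      (h.birational p hp)
  · have := hp p
    have := geometrically_isNormalScheme_fiber N p (h.normal p)
    rwa [hm]

/-- A finite morphism is affine, so the source is the spectrum of its global sections. Geometric
normality is dropped: the converse direction needs only the fiberwise conditions. -/
theorem AdmitsSimultaneousNormalization.exists_hom {R : Type u} [CommRing R]
    [Algebra A R] (h : AdmitsSimultaneousNormalization (structureMap A R)) :
    ∃ (N : Type u) (_ : CommRing N) (_ : Algebra A N) (φ : R →ₐ[A] N),
      IsFiberwiseNormalizationHom φ := by
  obtain ⟨X', m, hm⟩ := h
  have := hm.finite
  have : IsAffine X' := isAffine_of_isAffineHom m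
  obtain ⟨ψ, hψ⟩ := Spec.map_surjective (X'.isoSpec.inv ≫ m)
  let N := Γ(X', ⊤)
  let alg : Algebra A N := (ψ.hom.comp (algebraMap A R)).toAlgebra
  let φ : R →ₐ[A] N := { ψ.hom with commutes' := fun r => rfl }
  have e1 : X'.isoSpec.symm.hom ≫ m = Spec.map (CommRingCat.ofHom φ.toRingHom) := hψ.symm
  have e2 : X'.isoSpec.symm.hom ≫ m ≫ structureMap A R = structureMap A N := by
    rw [← Category.assoc, e1, ← Spec.map_comp]
    rfl
  refine ⟨N, inferInstance, alg, φ, ⟨?_, ?_, fun p => ?_, fun p hp => ?_⟩⟩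
  · have : IsFinite (Spec.map (CommRingCat.ofHom φ.toRingHom)) := by rw [← e1]; infer_instance
    exact (IsFinite.SpecMap_iff _).mp this
  · have := hm.flat
    have h3 : Flat (structureMap A N) := by rw [← e2]; infer_instance
    exact RingHom.flat_algebraMap_iff.mp ((HasRingHomProperty.Spec_iff (P := @Flat)).mp h3)
  · exact (isNormalScheme_fiber_iff N X'.isoSpec.symm _ e2 p).mp (hm.normal_fiber p)
  · exact (isBirational_fiberMap_iff φ X'.isoSpec.symm m e1 e2 p).mp (hm.birational_fiber p hp)

end Schemes


/-! ### Constancy of the Euler characteristic of a complex with finite cohomology -/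

section EulerCharacteristic

open TensorProduct

/-- Dimension count in the exact sequence 0 → ker f → ker (f + g) → U → coker f → 0. -/
theorem finrank_coker_sub_finrank_ker_of_coprod {k V U W : Type*} [Field k] [AddCommGroup V]
    [Module k V] [AddCommGroup U] [Module k U] [AddCommGroup W] [Module k W] [Module.Finite k U]
    (f : V →ₗ[k] W) (g : U →ₗ[k] W) (hsurj : Function.Surjective (f.coprod g))
    [Module.Finite k (LinearMap.ker (f.coprod g))] :
    Module.Finite k (LinearMap.ker f) ∧ Module.Finite k (W ⧸ LinearMap.range f) ∧
      (Module.finrank k (W ⧸ LinearMap.range f) : ℤ) - Module.finrank k (LinearMap.ker f) =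
        Module.finrank k U - Module.finrank k (LinearMap.ker (f.coprod g)) := by
  let i : LinearMap.ker f →ₗ[k] LinearMap.ker (f.coprod g) :=
    ((LinearMap.inl k V U).comp (LinearMap.ker f).subtype).codRestrict _ fun x => by simp
  have hi : Function.Injective i := fun x y hxy => by
    have := congrArg (fun z : LinearMap.ker (f.coprod g) => (z : V × U).1) hxy
    exact Subtype.ext this
  let q : U →ₗ[k] W ⧸ LinearMap.range f := (LinearMap.range f).mkQ.comp g
  have hq : Function.Surjective q := by
    intro y
    obtain ⟨w, rfl⟩ := Submodule.mkQ_surjective _ y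
    obtain ⟨⟨v, u⟩, rfl⟩ := hsurj w
    refine ⟨u, ?_⟩
    simp only [q, LinearMap.comp_apply, LinearMap.coprod_apply, map_add]
    rw [eq_comm, add_eq_right, Submodule.mkQ_apply, Submodule.Quotient.mk_eq_zero]
    exact ⟨v, rfl⟩
  let s : LinearMap.ker (f.coprod g) →ₗ[k] U := (LinearMap.snd k V U).comp (Submodule.subtype _)
  have hs : LinearMap.range s = LinearMap.ker q := by
    ext u
    simp only [LinearMap.mem_range, LinearMap.mem_ker, q, LinearMap.comp_apply,
      Submodule.mkQ_apply, Submodule.Quotient.mk_eq_zero]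
    constructor
    · rintro ⟨⟨⟨v, u'⟩, h⟩, rfl⟩
      refine ⟨-v, ?_⟩
      have h : f v + g u' = 0 := h
      rw [map_neg]
      exact (eq_neg_of_add_eq_zero_right h).symm
    · rintro ⟨v, hv⟩
      exact ⟨⟨(-v, u), by simp [hv]⟩, rfl⟩
  have hk : LinearMap.range i = LinearMap.ker s := by
    ext ⟨⟨v, u⟩, h⟩
    have h' : f v + g u = 0 := h
    simp only [LinearMap.mem_range, LinearMap.mem_ker]
    constructor
    · rintro ⟨x, hx⟩
      rw [← hx]; rfl
    · intro hu
      have hu : u = 0 := hu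
      subst hu
      exact ⟨⟨v, by simpa using h'⟩, rfl⟩
  have h1 : Module.Finite k (LinearMap.ker f) := Module.Finite.of_injective i hi
  have h2 : Module.Finite k (W ⧸ LinearMap.range f) := Module.Finite.of_surjective q hq
  refine ⟨h1, h2, ?_⟩
  have e1 := LinearMap.finrank_range_add_finrank_ker s
  have e2 := LinearMap.finrank_range_add_finrank_ker q
  rw [hs, ← hk, LinearMap.finrank_range_of_inj hi] at e1
  rw [LinearMap.range_eq_top.mpr hq, finrank_top] at e2
  omega

/-- For a homomorphism into a flat module with finite kernel and cokernel over a principal ideal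
domain the Euler characteristic of the base changes to fields is constant. -/
theorem exists_finrank_coker_sub_finrank_ker_eq (A : Type u) [CommRing A] [IsDomain A]
    [IsPrincipalIdealRing A] {R N : Type u} [AddCommGroup R] [Module A R] [AddCommGroup N]
    [Module A N] [Module.IsTorsionFree A R] [Module.Flat A N] (φ : R →ₗ[A] N)
    [Module.Finite A (LinearMap.ker φ)] [Module.Finite A (N ⧸ LinearMap.range φ)] :
    ∃ χ : ℤ, ∀ (k : Type u) [Field k] [Algebra A k],
      Module.Finite k (LinearMap.ker (φ.baseChange k)) ∧
      Module.Finite k (k ⊗[A] N ⧸ LinearMap.range (φ.baseChange k)) ∧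
      (Module.finrank k (k ⊗[A] N ⧸ LinearMap.range (φ.baseChange k)) : ℤ) -
        Module.finrank k (LinearMap.ker (φ.baseChange k)) = χ := by
  -- Adding a free module that hits lifts of generators of the cokernel makes the map surjective, so
  -- that only a kernel remains to be controlled.
  obtain ⟨n, c, hc⟩ := Module.Finite.exists_fin (R := A) (M := N ⧸ LinearMap.range φ)
  choose l hl using fun i => Submodule.mkQ_surjective _ (c i)
  let g : (Fin n → A) →ₗ[A] N := Fintype.linearCombination A l
  let ψ : R × (Fin n → A) →ₗ[A] N := φ.coprod g
  have hψ : Function.Surjective ψ := by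
    intro y
    have hy : (LinearMap.range φ).mkQ y ∈ Submodule.span A (Set.range c) := by rw [hc]; trivial
    obtain ⟨a, ha⟩ := (Submodule.mem_span_range_iff_exists_fun A).mp hy
    have : (LinearMap.range φ).mkQ (y - g a) = 0 := by
      rw [map_sub, ← ha, sub_eq_zero]
      simp [g, Fintype.linearCombination_apply, map_sum, ← hl]
    rw [Submodule.mkQ_apply, Submodule.Quotient.mk_eq_zero] at this
    obtain ⟨r, hr⟩ := this
    exact ⟨(r, a), by simp [ψ, hr]⟩
  let M := LinearMap.ker ψ
  -- M is an extension of a submodule of A^n by ker φ. It is also torsion-free, hence free over A.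
  have hM : Module.Finite A M := by
    let i : LinearMap.ker φ →ₗ[A] M :=
      ((LinearMap.inl A R (Fin n → A)).comp (LinearMap.ker φ).subtype).codRestrict _
        fun x => LinearMap.mem_ker.mpr (by simp [ψ])
    let s : M →ₗ[A] (Fin n → A) := (LinearMap.snd A R _).comp (Submodule.subtype _)
    have : IsNoetherian A M := isNoetherian_of_range_eq_ker i s (by
      ext ⟨⟨v, u⟩, h⟩
      have h' : φ v + g u = 0 := h
      simp only [LinearMap.mem_range, LinearMap.mem_ker]
      constructor
      · rintro ⟨x, hx⟩
        rw [← hx]; rfl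
      · intro hu
        have hu : u = 0 := hu
        subst hu
        exact ⟨⟨v, by simpa using h'⟩, rfl⟩)
    infer_instance
  have hMfree : Module.Free A M := inferInstance
  refine ⟨n - Module.finrank A M, fun k _ _ => ?_⟩
  -- Flatness of N keeps 0 → M → R × A^n → N → 0 exact after base change, so the new kernel has
  -- dimension rank M and the Euler characteristic is n - rank M for every k.
  have hinj : Function.Injective (M.subtype.lTensor k) :=
    LinearMap.lTensor_injective_of_exact_of_flat ψ hψ M.subtype M.subtype_injective
      (LinearMap.exact_subtype_ker_map ψ) k
  have hex : Function.Exact (M.subtype.lTensor k) (ψ.lTensor k) :=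
    lTensor_exact k (LinearMap.exact_subtype_ker_map ψ) hψ
  let e := TensorProduct.prodRight A k k R (Fin n → A)
  have hcomp : (φ.baseChange k).coprod (g.baseChange k) =
      (ψ.baseChange k).comp e.symm.toLinearMap := by
    rw [LinearEquiv.eq_comp_toLinearMap_symm]
    ext <;> simp [e, ψ]
  have hker : Module.Finite k (LinearMap.ker (ψ.baseChange k)) ∧
      Module.finrank k (LinearMap.ker (ψ.baseChange k)) = Module.finrank A M := by
    have h1 : LinearMap.ker (ψ.baseChange k) = LinearMap.range (M.subtype.baseChange k) := by
      ext x
      exact hex x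
    rw [h1]
    refine ⟨inferInstance, ?_⟩
    rw [LinearMap.finrank_range_of_inj (f := M.subtype.baseChange k) hinj,
      Module.finrank_baseChange]
  have hker' : LinearMap.ker ((φ.baseChange k).coprod (g.baseChange k)) =
      (LinearMap.ker (ψ.baseChange k)).map e.toLinearMap := by
    rw [hcomp, LinearMap.ker_comp]
    exact (Submodule.map_equiv_eq_comap_symm _ _).symm
  have := hker.1
  have hfin : Module.Finite k (LinearMap.ker ((φ.baseChange k).coprod (g.baseChange k))) := by
    rw [hker']; infer_instance
  have := finrank_coker_sub_finrank_ker_of_coprod (φ.baseChange k) (g.baseChange k) (by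
    rw [hcomp]
    exact (LinearMap.lTensor_surjective k hψ).comp e.symm.surjective)
  refine ⟨this.1, this.2.1, ?_⟩
  rw [this.2.2, hker', LinearEquiv.finrank_map_eq, hker.2, Module.finrank_baseChange,
    Module.finrank_fin_fun]

end EulerCharacteristic


/-! ### Finite-dimensional modules are the sum of their localizations -/

section FiniteDimensional

/-- The image of M is finite-dimensional, and a denominator acts on it injectively, hence
bijectively. So division by s stays inside the image. -/
theorem surjective_of_isLocalizedModule (k : Type*) {B M P : Type*} [Field k]
    [CommRing B] [Algebra k B]
    [AddCommGroup M] [Module B M] [Module k M] [IsScalarTower k B M] [Module.Finite k M]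
    [AddCommGroup P] [Module B P] [Module k P] [IsScalarTower k B P] (S : Submonoid B)
    (l : M →ₗ[B] P) [IsLocalizedModule S l] : Function.Surjective l := by
  intro y
  obtain ⟨⟨x, s⟩, h⟩ := IsLocalizedModule.surj S l y
  let V := LinearMap.range l
  have hV : Module.Finite k V := by
    have : Module.Finite k (LinearMap.range (l.restrictScalars k)) := inferInstance
    exact this
  have hinj : Function.Injective ((LinearMap.lsmul B V (s : B)).restrictScalars k) := by
    intro a b hab
    have hab : (s : B) • (a : P) = (s : B) • (b : P) := congrArg Subtype.val hab
    exact Subtype.ext (IsLocalizedModule.smul_injective l s hab)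
  obtain ⟨⟨_, x', rfl⟩, hx'⟩ := LinearMap.injective_iff_surjective.mp hinj ⟨l x, x, rfl⟩
  refine ⟨x', IsLocalizedModule.smul_injective l s ?_⟩
  have h2 : (s : B) • l x' = l x := congrArg Subtype.val hx'
  exact h2.trans h.symm

theorem finite_of_isLocalizedModule (k : Type*) {B M P : Type*} [Field k] [CommRing B] [Algebra k B]
    [AddCommGroup M] [Module B M] [Module k M] [IsScalarTower k B M] [Module.Finite k M]
    [AddCommGroup P] [Module B P] [Module k P] [IsScalarTower k B P] (S : Submonoid B)
    (l : M →ₗ[B] P) [IsLocalizedModule S l] : Module.Finite k P :=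
  Module.Finite.of_surjective (l.restrictScalars k) (surjective_of_isLocalizedModule k S l)

/-- The chain m^n P stabilizes, and Nakayama gives r ≡ 1 modulo m killing the stable term. Such an r
lies outside m, hence acts injectively on P. -/
theorem exists_pow_smul_eq_zero_of_isLocalizedModule (k : Type*) {B M P : Type*} [Field k] [CommRing B] [Algebra k B]
    [AddCommGroup M] [Module B M] [Module k M] [IsScalarTower k B M] [Module.Finite k M]
    [AddCommGroup P] [Module B P] [Module k P] [IsScalarTower k B P]
    (m : Ideal B) [m.IsPrime] (l : M →ₗ[B] P)
    [IsLocalizedModule m.primeCompl l] : ∃ n : ℕ, ∀ a ∈ m ^ n, ∀ y : P, a • y = 0 := by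
  have := finite_of_isLocalizedModule k m.primeCompl l
  have hart : IsArtinian B P := isArtinian_of_tower k inferInstance
  have hnoe : IsNoetherian B P := isNoetherian_of_tower k inferInstance
  obtain ⟨n, hn⟩ := IsArtinian.monotone_stabilizes (R := B) (M := P)
    ⟨fun n => OrderDual.toDual (m ^ n • (⊤ : Submodule B P)), fun i j hij =>
      Submodule.smul_mono_left (Ideal.pow_le_pow_right hij)⟩
  have h1 : m ^ n • (⊤ : Submodule B P) = m ^ (n + 1) • ⊤ := hn (n + 1) (Nat.le_succ n)
  obtain ⟨r, hr, hr0⟩ := Submodule.exists_sub_one_mem_and_smul_eq_zero_of_fg_of_le_smul m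
    (m ^ n • (⊤ : Submodule B P)) (IsNoetherian.noetherian _) (by
      rw [← Submodule.mul_smul, ← pow_succ', ← h1])
  refine ⟨n, fun a ha y => ?_⟩
  have hrm : r ∈ m.primeCompl := fun hm => by
    have := m.sub_mem hm hr
    rw [sub_sub_cancel] at this
    exact (Ideal.ne_top_iff_one m).mp ‹m.IsPrime›.ne_top this
  have := hr0 _ (Submodule.smul_mem_smul ha (Submodule.mem_top (x := y)))
  exact IsLocalizedModule.smul_injective l (⟨r, hrm⟩ : m.primeCompl) (this.trans (smul_zero _).symm)

theorem finrank_eq_sum_of_isLocalizedModule (k : Type*) {B M : Type*} [Field k] [CommRing B]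
    [Algebra k B] [AddCommGroup M] [Module B M] [Module k M] [IsScalarTower k B M]
    [Module.Finite k M] (T : Finset (MaximalSpectrum B))
    (hT : ∀ m : MaximalSpectrum B, Module.annihilator B M ≤ m.asIdeal → m ∈ T)
    (P : MaximalSpectrum B → Type*) [∀ m, AddCommGroup (P m)] [∀ m, Module B (P m)]
    [∀ m, Module k (P m)] [∀ m, IsScalarTower k B (P m)] (l : ∀ m, M →ₗ[B] P m)
    [∀ m, IsLocalizedModule m.asIdeal.primeCompl (l m)] :
    Module.finrank k M = ∑ m ∈ T, Module.finrank k (P m) := by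
  have := fun m : MaximalSpectrum B => finite_of_isLocalizedModule k m.asIdeal.primeCompl (l m)
  let Φ : M →ₗ[k] ∀ m : T, P m := LinearMap.pi fun m => (l m).restrictScalars k
  have hinj : Function.Injective Φ := by
    rw [← LinearMap.ker_eq_bot, LinearMap.ker_eq_bot']
    intro x hx
    by_contra hx0
    -- The annihilator of a nonzero x lies in some maximal ideal, which also contains the
    -- annihilator of M and so belongs to T. There x survives.
    have hne : LinearMap.ker (LinearMap.toSpanSingleton B M x) ≠ ⊤ := fun h => hx0 (by
      have : (1 : B) ∈ LinearMap.ker (LinearMap.toSpanSingleton B M x) := by rw [h]; trivial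
      simpa using this)
    obtain ⟨m, hm, hle⟩ := Ideal.exists_le_maximal _ hne
    obtain ⟨m, rfl⟩ : ∃ m' : MaximalSpectrum B, m'.asIdeal = m := ⟨⟨m, hm⟩, rfl⟩
    have hmT : m ∈ T := hT _ fun a ha => hle (by
      simpa using Module.mem_annihilator.mp ha x)
    have h0 : l m x = 0 := congrFun hx ⟨m, hmT⟩
    obtain ⟨s, hs⟩ := (IsLocalizedModule.eq_zero_iff m.asIdeal.primeCompl (l m)).mp h0
    exact s.2 (hle (by simpa [Submonoid.smul_def] using hs))
  have hsurj : Function.Surjective Φ := by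
    intro y
    choose n hn using fun m : MaximalSpectrum B =>
      exists_pow_smul_eq_zero_of_isLocalizedModule k m.asIdeal (l m)
    choose x hx using fun m : T => surjective_of_isLocalizedModule k m.1.asIdeal.primeCompl (l m)
      (y m)
    have hcop : Pairwise fun i j : T => IsCoprime (i.1.asIdeal ^ n i) (j.1.asIdeal ^ n j) := by
      intro i j hij
      refine IsCoprime.pow (Ideal.isCoprime_iff_sup_eq.mpr ?_)
      refine Ideal.IsMaximal.coprime_of_ne i.1.isMaximal j.1.isMaximal fun h => hij ?_
      exact Subtype.ext (MaximalSpectrum.ext h)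
    classical
    -- By the Chinese remainder theorem, e m acts as the identity on P m and as zero on the other
    -- summands, since each summand is killed by a power of its ideal.
    choose e he using fun m : T => Ideal.exists_forall_sub_mem_ideal hcop
      (fun j => if j = m then (1 : B) else 0)
    refine ⟨∑ m, e m • x m, funext fun j => ?_⟩
    change l j (∑ m, e m • x m) = y j
    rw [map_sum, Finset.sum_eq_single j]
    · have := hn j _ (he j j) (y j)
      rw [if_pos rfl, sub_smul, one_smul, sub_eq_zero] at this
      rw [map_smul, hx, this]
    · intro i _ hij
      have := hn j _ (he i j) (l j (x i))
      rwa [if_neg hij.symm, sub_zero, ← map_smul] at this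
    · simp
  rw [LinearEquiv.finrank_eq (LinearEquiv.ofBijective Φ ⟨hinj, hsurj⟩), Module.finrank_pi_fintype,
    ← Finset.sum_coe_sort T fun m => Module.finrank k (P m)]

end FiniteDimensional


/-! ### Reduced Noetherian rings and their total rings of fractions -/

section Reduced

open nonZeroDivisors

theorem mem_nonZeroDivisors_iff_forall_minimalPrimes {D : Type*} [CommRing D] [_root_.IsReduced D]
    {x : D} : x ∈ D⁰ ↔ ∀ p ∈ minimalPrimes D, x ∉ p := by
  refine ⟨fun hx p hp h => notMem_nonZeroDivisors_of_mem_mem_minimalPrimes h hp hx, fun h => ?_⟩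
  refine mem_nonZeroDivisors_iff_right.mpr fun y hy => ?_
  have : y ∈ (⊥ : Ideal D).radical := by
    rw [← Ideal.sInf_minimalPrimes]
    refine Submodule.mem_sInf.mpr fun p hp => ?_
    have := hp.isPrime
    exact (this.mem_or_mem (show y * x ∈ p by rw [hy]; exact zero_mem p)).resolve_right (h p hp)
  exact (mem_nilradical.mp this).eq_zero

theorem exists_mem_forall_notMem_of_finite {D : Type*} [CommRing D] {s : Set (Ideal D)}
    (hs : s.Finite) (hp : ∀ p ∈ s, p.IsPrime) {I : Ideal D} (h : ∀ p ∈ s, ¬ I ≤ p) :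
    ∃ x ∈ I, ∀ p ∈ s, x ∉ p := by
  by_contra! hc
  obtain ⟨p, hps, hle⟩ := (Ideal.subset_union_prime (s := hs.toFinset) (f := fun p => p) ⊥ ⊥
    (fun p hps _ _ => hp p (hs.mem_toFinset.mp hps)) (I := I)).mp (fun x hx => by
      obtain ⟨p, hp, hxp⟩ := hc x hx
      exact Set.mem_biUnion (by simpa using hp) hxp)
  exact h p (hs.mem_toFinset.mp hps) hle

theorem exists_mem_nonZeroDivisors_of_not_le {D : Type*} [CommRing D] [_root_.IsReduced D]
    [IsNoetherianRing D] {I : Ideal D} (h : ∀ p ∈ minimalPrimes D, ¬ I ≤ p) : ∃ x ∈ I, x ∈ D⁰ := by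
  obtain ⟨x, hx, hx'⟩ := exists_mem_forall_notMem_of_finite
    (minimalPrimes.finite_of_isNoetherianRing D) (fun p hp => hp.isPrime) h
  exact ⟨x, hx, mem_nonZeroDivisors_iff_forall_minimalPrimes.mpr hx'⟩

/-- Prime avoidance inside the intersection of the finitely many minimal primes outside s. -/
theorem exists_mem_forall_mem_forall_notMem {D : Type*} [CommRing D] [IsNoetherianRing D]
    {s : Set (Ideal D)} (hs : s ⊆ minimalPrimes D) :
    ∃ y : D, (∀ p ∈ s, y ∉ p) ∧ ∀ p ∈ minimalPrimes D, p ∉ s → y ∈ p := by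
  have hfin := minimalPrimes.finite_of_isNoetherianRing D
  let t := (hfin.subset (Set.sdiff_subset (t := s))).toFinset
  obtain ⟨y, hy, hy'⟩ := exists_mem_forall_notMem_of_finite (hfin.subset hs)
    (fun p hp => (hs hp).isPrime) (I := t.inf id) (fun p hp hle => by
      obtain ⟨q, hq, hqp⟩ := (hs hp).isPrime.inf_le'.mp hle
      have hq : q ∈ minimalPrimes D ∧ q ∉ s := by simpa [t] using hq
      have hqp' : q = p := le_antisymm hqp ((hs hp).2 ⟨hq.1.isPrime, bot_le⟩ hqp)
      exact hq.2 (hqp' ▸ hp))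
  refine ⟨y, hy', fun p hp hps => ?_⟩
  have hpt : p ∈ t := by simpa [t] using ⟨hp, hps⟩
  exact Finset.inf_le (f := id) hpt hy

theorem exists_mul_eq_zero_add_mem_nonZeroDivisors {D : Type*} [CommRing D] [_root_.IsReduced D]
    [IsNoetherianRing D] (x : D) : ∃ y : D, x * y = 0 ∧ x + y ∈ D⁰ := by
  obtain ⟨y, hy, hy'⟩ := exists_mem_forall_mem_forall_notMem (D := D)
    (s := {p | p ∈ minimalPrimes D ∧ x ∈ p}) (fun p hp => hp.1)
  refine ⟨y, ?_, mem_nonZeroDivisors_iff_forall_minimalPrimes.mpr fun p hp hxy => ?_⟩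
  · have : x * y ∈ (⊥ : Ideal D).radical := by
      rw [← Ideal.sInf_minimalPrimes]
      refine Submodule.mem_sInf.mpr fun p hp => ?_
      by_cases hx : x ∈ p
      · exact Ideal.mul_mem_right _ p hx
      · exact Ideal.mul_mem_left p _ (hy' p hp fun h => hx h.2)
    exact (mem_nilradical.mp this).eq_zero
  · by_cases hx : x ∈ p
    · exact hy p ⟨hp, hx⟩ ((Ideal.add_mem_iff_right p hx).mp hxy)
    · exact hx ((Ideal.add_mem_iff_left p (hy' p hp fun h => hx h.2)).mp hxy)

theorem exists_mul_mul_eq_self_of_isFractionRing (D : Type*) {F : Type*} [CommRing D]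
    [_root_.IsReduced D] [IsNoetherianRing D] [CommRing F] [Algebra D F] [IsFractionRing D F]
    (x : F) : ∃ w, x * w * x = x := by
  obtain ⟨⟨a, s⟩, h⟩ := IsLocalization.surj D⁰ x
  obtain ⟨b, hab, hb⟩ := exists_mul_eq_zero_add_mem_nonZeroDivisors a
  obtain ⟨u, hu⟩ := (IsLocalization.map_units F ⟨a + b, hb⟩).exists_left_inv
  obtain ⟨v, hv⟩ := (IsLocalization.map_units F s).exists_left_inv
  -- For x = a/s and b complementary to a, the weak inverse is s/(a + b), since a² = a(a + b).
  refine ⟨algebraMap D F s * u, ?_⟩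
  have h1 : algebraMap D F a * algebraMap D F b = 0 := by rw [← map_mul, hab, map_zero]
  have hu' : u * (algebraMap D F a + algebraMap D F b) = 1 := by rw [← map_add]; exact hu
  have hx : x = v * algebraMap D F a := by
    rw [← h, mul_comm x, ← mul_assoc, hv, one_mul]
  rw [hx]
  linear_combination (v * algebraMap D F a) * hu' - v * u * h1 +
    (v * algebraMap D F a * algebraMap D F a * u) * hv

theorem isReduced_of_isFractionRing (D : Type*) {F : Type*} [CommRing D]
    [_root_.IsReduced D] [IsNoetherianRing D] [CommRing F] [Algebra D F] [IsFractionRing D F] :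
    _root_.IsReduced F := by
  refine (isReduced_iff_pow_one_lt 2 one_lt_two).mpr fun x hx => ?_
  obtain ⟨w, hw⟩ := exists_mul_mul_eq_self_of_isFractionRing D x
  rw [← hw]
  linear_combination w * hx

/-- If `D ⊆ E` are rings and `s E ⊆ D` for some nonzerodivisor `s`, then `D` and `E` have the same
total ring of fractions. -/
theorem isFractionRing_of_smul_mem_range {D E F : Type*} [CommRing D] [CommRing E] [CommRing F]
    [Algebra D E] [Algebra E F] [Algebra D F] [IsScalarTower D E F] [IsFractionRing E F]
    (hinj : Function.Injective (algebraMap D E)) {s : D} (hs : ∀ y : E, ∃ d, algebraMap D E d = s • y)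
    (hreg : ∀ y : E, s • y = 0 → y = 0) : IsFractionRing D F := by
  have hF := IsFractionRing.injective E F
  have key : ∀ d ∈ D⁰, algebraMap D E d ∈ E⁰ := by
    refine fun d hd => mem_nonZeroDivisors_iff_right.mpr fun y hy => hreg y ?_
    obtain ⟨c, hc⟩ := hs y
    have : c * d = 0 := hinj (by
      rw [map_mul, hc, map_zero, smul_mul_assoc, hy, smul_zero])
    rw [← hc, (mem_nonZeroDivisors_iff_right.mp hd) c this, map_zero]
  refine ⟨fun d => ?_, fun z => ?_, fun {x y} hxy => ⟨1, ?_⟩⟩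
  · rw [IsScalarTower.algebraMap_apply D E F]
    exact IsLocalization.map_units F (⟨_, key d d.2⟩ : E⁰)
  · obtain ⟨⟨y, z'⟩, h⟩ := IsLocalization.surj E⁰ z
    obtain ⟨c, hc⟩ := hs y
    obtain ⟨d, hd⟩ := hs z'
    have hdD : d ∈ D⁰ := mem_nonZeroDivisors_iff_right.mpr fun x hx => by
      have h2 : s • (algebraMap D E x) = 0 := by
        refine (mem_nonZeroDivisors_iff_right.mp z'.2) _ ?_
        rw [smul_mul_assoc, ← mul_smul_comm, ← hd, ← map_mul, hx, map_zero]
      exact hinj ((hreg _ h2).trans (map_zero _).symm)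
    refine ⟨⟨c, ⟨d, hdD⟩⟩, ?_⟩
    simp only [IsScalarTower.algebraMap_apply D E F, hc, hd, Algebra.smul_def, map_mul]
    rw [mul_left_comm, h]
  · simpa using hinj (hF (by simpa only [IsScalarTower.algebraMap_apply D E F] using hxy))

end Reduced


/-! ### The delta invariant of a local ring -/

section LocalDelta

open nonZeroDivisors IsLocalRing

/-- Dévissage along IM ⊆ M: the quotient M/IM is finite over B/I, and IM is killed by a smaller
power of I. -/
theorem finite_of_pow_smul_eq_zero (k : Type*) {B : Type*} [Field k] [CommRing B] [Algebra k B]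
    [IsNoetherianRing B] (I : Ideal B) [Module.Finite k (B ⧸ I)] (n : ℕ) :
    ∀ (M : Type u) [AddCommGroup M] [Module B M] [Module k M] [IsScalarTower k B M]
      [Module.Finite B M], (∀ a ∈ I ^ n, ∀ x : M, a • x = 0) → Module.Finite k M := by
  induction n with
  | zero =>
    intro M _ _ _ _ _ h
    have : Subsingleton M := ⟨fun x y => by
      rw [← one_smul B x, ← one_smul B y, h 1 (by simp), h 1 (by simp)]⟩
    infer_instance
  | succ n ih =>
    intro M _ _ _ _ _ h
    let V : Submodule B M := I • ⊤
    have : Module.Finite k V := by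
      have h0 : ∀ a ∈ I ^ n, ∀ x ∈ V, a • x = 0 := by
        intro a ha x hx
        refine Submodule.smul_induction_on hx (fun b hb y _ => ?_) (fun y z hy hz => ?_)
        · rw [smul_smul]
          exact h _ (by rw [pow_succ]; exact Ideal.mul_mem_mul ha hb) y
        · rw [smul_add, hy, hz, add_zero]
      exact ih V fun a ha x => Subtype.ext (h0 a ha x x.2)
    have : Module.Finite k (V.restrictScalars k) := this
    have h1 : Module.Finite (B ⧸ I) (M ⧸ V) := Module.Finite.of_restrictScalars_finite B _ _
    have h2 : IsScalarTower k (B ⧸ I) (M ⧸ V) := ⟨fun a b x => by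
      obtain ⟨b, rfl⟩ := Ideal.Quotient.mk_surjective b
      rw [← algebraMap_smul (B ⧸ I) a (Ideal.Quotient.mk I b), IsScalarTower.algebraMap_apply k B,
        smul_eq_mul]
      change Ideal.Quotient.mk I (algebraMap k B a * b) • x = a • b • x
      rw [← algebraMap_smul B a (b • x), smul_smul]
      rfl⟩
    have : Module.Finite k (M ⧸ V) := Module.Finite.trans (B ⧸ I) _
    have : Module.Finite k (M ⧸ V.restrictScalars k) :=
      Module.Finite.equiv (Submodule.Quotient.restrictScalarsEquiv k V).symm
    exact Module.Finite.of_submodule_quotient (V.restrictScalars k)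

/-- No prime other than the maximal ideal contains the annihilator, so the maximal ideal lies in its
radical. -/
theorem exists_pow_maximalIdeal_smul_eq_zero {L M : Type*} [CommRing L] [IsLocalRing L]
    [IsNoetherianRing L] [AddCommGroup M] [Module L M] [Module.Finite L M]
    (h : ∀ P : Ideal L, P.IsPrime → P ≠ maximalIdeal L → ∀ x : M, ∃ s ∉ P, s • x = 0) :
    ∃ n : ℕ, ∀ a ∈ maximalIdeal L ^ n, ∀ x : M, a • x = 0 := by
  have hle : maximalIdeal L ≤ (Module.annihilator L M).radical := by
    rw [Ideal.radical_eq_sInf]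
    refine le_sInf fun P hP => ?_
    have hP2 : P.IsPrime := hP.2
    by_contra hne
    obtain ⟨n, c, hc⟩ := Module.Finite.exists_fin (R := L) (M := M)
    choose s hs hs0 using fun i => h P hP2 (fun hP' => hne hP'.ge) (c i)
    have : ∏ i, s i ∈ Module.annihilator L M := by
      rw [← Submodule.annihilator_top, ← hc, Submodule.mem_annihilator_span]
      rintro ⟨_, i, rfl⟩
      rw [← Finset.prod_erase_mul _ _ (Finset.mem_univ i), mul_smul, hs0, smul_zero]
    obtain ⟨i, -, hi⟩ := (hP2.prod_mem_iff).mp (hP.1 this)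
    exact hs i hi
  obtain ⟨n, hn⟩ := Ideal.exists_pow_le_of_le_radical_of_fg hle (IsNoetherian.noetherian _)
  exact ⟨n, fun a ha x => Module.mem_annihilator.mp (hn ha) x⟩

/-- Injectivity of g makes 0 → coker f → coker (g ∘ f) → coker g → 0 exact. -/
theorem finrank_coker_comp {k V U W : Type*} [Field k] [AddCommGroup V] [Module k V]
    [AddCommGroup U] [Module k U] [AddCommGroup W] [Module k W] (f : V →ₗ[k] U) (g : U →ₗ[k] W)
    (hg : Function.Injective g) [Module.Finite k (W ⧸ LinearMap.range (g ∘ₗ f))] :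
    Module.Finite k (W ⧸ LinearMap.range g) ∧
      Module.finrank k (W ⧸ LinearMap.range (g ∘ₗ f)) =
        Module.finrank k (U ⧸ LinearMap.range f) + Module.finrank k (W ⧸ LinearMap.range g) := by
  have hle : LinearMap.range (g ∘ₗ f) ≤ LinearMap.range g := LinearMap.range_comp_le_range f g
  let q := Submodule.factor hle
  have hq : Function.Surjective q := Submodule.factor_surjective hle
  let i : (U ⧸ LinearMap.range f) →ₗ[k] (W ⧸ LinearMap.range (g ∘ₗ f)) :=
    Submodule.mapQ _ _ g (by rintro _ ⟨v, rfl⟩; exact ⟨v, rfl⟩)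
  have hi : Function.Injective i := by
    rw [← LinearMap.ker_eq_bot, LinearMap.ker_eq_bot']
    intro x hx
    obtain ⟨x, rfl⟩ := Submodule.mkQ_surjective _ x
    simp only [i, Submodule.mkQ_apply, Submodule.mapQ_apply, Submodule.Quotient.mk_eq_zero] at hx ⊢
    obtain ⟨v, hv⟩ := hx
    exact ⟨v, hg hv⟩
  have hr : LinearMap.range i = LinearMap.ker q := by
    ext x
    obtain ⟨w, rfl⟩ := Submodule.mkQ_surjective _ x
    rw [LinearMap.mem_ker, Submodule.mkQ_apply,
      show q (Submodule.Quotient.mk w) = Submodule.Quotient.mk w from rfl,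
      Submodule.Quotient.mk_eq_zero]
    constructor
    · rintro ⟨y, hy⟩
      obtain ⟨y, rfl⟩ := Submodule.mkQ_surjective _ y
      simp only [i, Submodule.mkQ_apply, Submodule.mapQ_apply] at hy
      obtain ⟨v, hv⟩ := (Submodule.Quotient.eq _).mp hy
      exact ⟨y - f v, by rw [map_sub, sub_eq_iff_eq_add, ← sub_eq_iff_eq_add']; exact hv.symm⟩
    · rintro ⟨y, rfl⟩
      exact ⟨Submodule.Quotient.mk y, rfl⟩
  refine ⟨Module.Finite.of_surjective q hq, ?_⟩
  have e := LinearMap.finrank_range_add_finrank_ker q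
  rw [LinearMap.range_eq_top.mpr hq, finrank_top, ← hr, LinearMap.finrank_range_of_inj hi] at e
  omega

theorem algebraMap_normalization_surjective {L : Type u} [CommRing L]
    (h : IsNormalRing (L ⧸ nilradical L)) :
    Function.Surjective (algebraMap L (Normalization L)) := by
  rintro ⟨z, hz⟩
  obtain ⟨⟨a, s⟩, has⟩ := IsLocalization.surj (L ⧸ nilradical L)⁰ z
  obtain ⟨d, hd⟩ := h.mem_range_of_isIntegral (IsFractionRing.injective _ _) (a := a) (b := s.1)
    (z := z) ((IsLocalization.map_units (FractionRing (L ⧸ nilradical L)) s).isSMulRegular _)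
    (by rw [mul_comm]; exact has) hz
  obtain ⟨d, rfl⟩ := Ideal.Quotient.mk_surjective d
  exact ⟨d, Subtype.ext hd⟩

theorem finrank_normalizationCoker_eq_zero (k : Type u) {L : Type u} [Field k] [CommRing L]
    [Algebra k L] (h : IsNormalRing (L ⧸ nilradical L)) :
    Module.finrank k (NormalizationCoker k L) = 0 := by
  have : Subsingleton (NormalizationCoker k L) := by
    rw [Submodule.Quotient.subsingleton_iff, LinearMap.range_eq_top]
    exact algebraMap_normalization_surjective h
  exact Module.finrank_zero_of_subsingleton

end LocalDelta


/-! ### The local δ as an Euler characteristic plus an error term -/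

section LocalDelta

open nonZeroDivisors IsLocalRing

/-- An integral equation of z = a/b lifts to L only up to a nilpotent. That nilpotent dies in the
reduced ring L_P, where normality then gives divisibility by b. -/
theorem exists_smul_mem_range_normalization {L : Type u} [CommRing L] (P : Ideal L) [P.IsPrime]
    (h : IsNormalRing (Localization.AtPrime P)) (z : Normalization L) :
    ∃ s ∉ P, ∃ d, algebraMap L (Normalization L) d = s • z := by
  obtain ⟨z, hz⟩ := z
  obtain ⟨⟨a, b⟩, hab⟩ := IsLocalization.surj (L ⧸ nilradical L)⁰ z
  obtain ⟨n, c, hrel⟩ := isIntegral_iff_exists_pow_eq_sum.mp hz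
  obtain ⟨a', ha'⟩ := Ideal.Quotient.mk_surjective a
  obtain ⟨b', hb'⟩ := Ideal.Quotient.mk_surjective b.1
  choose c' hc' using fun i => Ideal.Quotient.mk_surjective (c i)
  have hF := IsFractionRing.injective (L ⧸ nilradical L) (FractionRing (L ⧸ nilradical L))
  have h1 : a ^ n = ∑ i ∈ Finset.range n, c i * a ^ i * b.1 ^ (n - i) := hF (by
    simp only [map_pow, map_sum, map_mul] at hab ⊢
    rw [← hab, mul_pow, hrel, Finset.sum_mul]
    refine Finset.sum_congr rfl fun i hi => ?_
    rw [mul_pow]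
    have : n = (n - i) + i := by have := Finset.mem_range.mp hi; omega
    conv_lhs => rw [this, pow_add]
    ring)
  have h2 : IsNilpotent (a' ^ n - ∑ i ∈ Finset.range n, c' i * a' ^ i * b' ^ (n - i)) := by
    rw [← mem_nilradical, ← Ideal.Quotient.eq_zero_iff_mem]
    simp only [map_sub, map_pow, map_sum, map_mul, ha', hb', hc', h1, sub_self]
  have hred := h.isReduced
  have h3 := (h2.map (algebraMap L (Localization.AtPrime P))).eq_zero
  simp only [map_sub, map_pow, map_sum, map_mul, sub_eq_zero] at h3
  obtain ⟨s, hs, t, ht⟩ := exists_dvd_mul_of_algebraMap_dvd P.primeCompl _ (h _ _ n _ h3)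
  refine ⟨s, hs, t, Subtype.ext ?_⟩
  refine (IsLocalization.map_units (FractionRing (L ⧸ nilradical L)) b).mul_right_cancel ?_
  change algebraMap (L ⧸ nilradical L) _ (Ideal.Quotient.mk _ t) * _ = (s • z) * _
  rw [smul_mul_assoc, hab, ← map_mul, ← hb', ← map_mul, mul_comm, ← ht, map_mul, map_mul, ha',
    Algebra.smul_def]
  rfl

/-- The cokernel is finite over L and vanishes at all non-maximal primes, so it has finite length
with residue field finite over k. -/
theorem finite_normalizationCoker (k : Type u) {L : Type u} [Field k] [CommRing L] [IsLocalRing L]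
    [IsNoetherianRing L] [Algebra k L] [Module.Finite L (Normalization L)]
    [Module.Finite k (L ⧸ maximalIdeal L)]
    (h : ∀ (P : Ideal L) [P.IsPrime], P ≠ maximalIdeal L → IsNormalRing (Localization.AtPrime P)) :
    Module.Finite k (NormalizationCoker k L) := by
  let V : Submodule L (Normalization L) := LinearMap.range (Algebra.linearMap L (Normalization L))
  obtain ⟨n, hn⟩ := exists_pow_maximalIdeal_smul_eq_zero (L := L) (M := Normalization L ⧸ V)
    fun P hP hPm x => by
      obtain ⟨z, rfl⟩ := Submodule.mkQ_surjective _ x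
      obtain ⟨s, hs, d, hd⟩ := exists_smul_mem_range_normalization P (h P hPm) z
      refine ⟨s, hs, ?_⟩
      rw [← map_smul, Submodule.mkQ_apply, Submodule.Quotient.mk_eq_zero]
      exact ⟨d, hd⟩
  have := finite_of_pow_smul_eq_zero k (maximalIdeal L) n (Normalization L ⧸ V) hn
  exact Module.Finite.equiv (Submodule.Quotient.restrictScalarsEquiv k V).symm

/-- E sits between the image of D and the integral closure of D in F, and e is the codimension of E
in that closure. Since F is reduced and von Neumann regular, E is normal exactly when it is
integrally closed in F. -/
theorem exists_finrank_coker_integralClosure_eq (k D E F : Type*) [Field k] [CommRing D]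
    [Algebra k D] [CommRing E] [_root_.IsReduced E] [IsNoetherianRing E] [Algebra k E] [Algebra D E]
    [IsScalarTower k D E] [Algebra.IsIntegral D E] [CommRing F] [Algebra k F] [Algebra D F]
    [Algebra E F] [IsScalarTower k D F] [IsScalarTower D E F] [IsFractionRing E F]
    [hfin : Module.Finite k (integralClosure D F ⧸
      LinearMap.range (IsScalarTower.toAlgHom k D (integralClosure D F)).toLinearMap)] :
    ∃ e : ℕ, Module.finrank k (integralClosure D F ⧸
        LinearMap.range (IsScalarTower.toAlgHom k D (integralClosure D F)).toLinearMap) =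
      Module.finrank k (E ⧸ LinearMap.range (IsScalarTower.toAlgHom k D E).toLinearMap) + e ∧
      (e = 0 ↔ IsNormalRing E) := by
  have : IsScalarTower k E F := IsScalarTower.of_algebraMap_eq fun x => by
    rw [IsScalarTower.algebraMap_apply k D F, IsScalarTower.algebraMap_apply D E F,
      IsScalarTower.algebraMap_apply k D E]
  have hint : ∀ y : E, IsIntegral D (algebraMap E F y) := fun y =>
    (Algebra.IsIntegral.isIntegral (R := D) y).map (IsScalarTower.toAlgHom D E F)
  let g : E →ₗ[k] integralClosure D F :=
    { toFun := fun y => ⟨algebraMap E F y, hint y⟩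
      map_add' := fun x y => Subtype.ext (map_add _ x y)
      map_smul' := fun c x => Subtype.ext (by
        change algebraMap E F (c • x) = c • algebraMap E F x
        exact map_smul (IsScalarTower.toAlgHom k E F) c x) }
  have hF := IsFractionRing.injective E F
  have hg : Function.Injective g := fun x y hxy => hF (congrArg Subtype.val hxy)
  have hcomp : (IsScalarTower.toAlgHom k D (integralClosure D F)).toLinearMap =
      g ∘ₗ (IsScalarTower.toAlgHom k D E).toLinearMap := by
    ext d
    exact IsScalarTower.algebraMap_apply D E F d
  rw [hcomp] at hfin ⊢
  obtain ⟨_, hrank⟩ := finrank_coker_comp (IsScalarTower.toAlgHom k D E).toLinearMap g hg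
  refine ⟨_, hrank, ?_⟩
  rw [Module.finrank_eq_zero_iff_of_free, Submodule.Quotient.subsingleton_iff,
    LinearMap.range_eq_top]
  constructor
  · intro hsurj
    have := isReduced_of_isFractionRing E (F := F)
    refine IsNormalRing.of_isIntegrallyClosedIn (exists_mul_mul_eq_self_of_isFractionRing E) hF
      fun z hz => ?_
    obtain ⟨y, hy⟩ := hsurj ⟨z, isIntegral_trans z hz⟩
    exact ⟨y, congrArg Subtype.val hy⟩
  · rintro h ⟨z, hz⟩
    obtain ⟨⟨a, s⟩, has⟩ := IsLocalization.surj E⁰ z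
    obtain ⟨d, hd⟩ := h.mem_range_of_isIntegral hF (a := a) (b := s.1)
      (z := z) ((IsLocalization.map_units F s).isSMulRegular _)
      (by rw [mul_comm]; exact has) hz.tower_top
    exact ⟨d, Subtype.ext hd⟩

theorem exists_pow_maximalIdeal_smul_eq_zero_of_finite (k : Type*) {L M : Type*} [Field k]
    [CommRing L] [IsLocalRing L] [Algebra k L] [AddCommGroup M] [Module L M] [Module k M]
    [IsScalarTower k L M] [Module.Finite k M] :
    ∃ n : ℕ, ∀ a ∈ maximalIdeal L ^ n, ∀ x : M, a • x = 0 := by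
  have : IsLocalizedModule (maximalIdeal L).primeCompl (LinearMap.id : M →ₗ[L] M) := by
    have hu : ∀ s : (maximalIdeal L).primeCompl, IsUnit (s : L) := fun s => by
      simpa [Ideal.primeCompl] using show ¬ (s : L) ∈ maximalIdeal L from s.2
    refine ⟨fun s => (hu s).map (algebraMap L (Module.End L M)), fun y => ⟨⟨y, 1⟩, one_smul _ y⟩,
      fun h => ⟨1, by simpa using h⟩⟩
  exact exists_pow_smul_eq_zero_of_isLocalizedModule k (maximalIdeal L) LinearMap.id

/-- The kernel of a finite homomorphism from a local ring `L` to a ring in which no nonzero element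
is killed by a power of the maximal ideal is the zeroth local cohomology of `L`. -/
theorem localCohomologyZero_eq_ker (k : Type*) {L E : Type u} [Field k] [CommRing L] [IsLocalRing L]
    [Algebra k L] [CommRing E] [Algebra L E]
    [Module.Finite k (LinearMap.ker (Algebra.linearMap L E))]
    (hH : ∀ (y : E) (n : ℕ), (∀ a ∈ maximalIdeal L ^ n, a • y = 0) → y = 0) :
    localCohomologyZero L = LinearMap.ker (Algebra.linearMap L E) := by
  refine le_antisymm (fun x hx => ?_) fun x hx => ?_
  · obtain ⟨n, hn⟩ : ∃ n : ℕ, ∀ a ∈ maximalIdeal L ^ n, a * x = 0 := hx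
    refine hH _ n fun a ha => ?_
    rw [Algebra.linearMap_apply, Algebra.smul_def, ← map_mul, hn a ha, map_zero]
  · obtain ⟨n, hn⟩ := exists_pow_maximalIdeal_smul_eq_zero_of_finite k (L := L)
      (M := LinearMap.ker (Algebra.linearMap L E))
    exact ⟨n, fun a ha => congrArg Subtype.val (hn a ha ⟨x, hx⟩)⟩

/-- The delta invariant of a local ring in terms of a finite algebra with finite-dimensional kernel
and cokernel. -/
theorem exists_localDelta_eq (k : Type u) {L E : Type u} [Field k] [CommRing L] [IsLocalRing L]
    [IsNoetherianRing L] [Algebra k L] [CommRing E] [_root_.IsReduced E] [Algebra L E] [Algebra k E]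
    [IsScalarTower k L E] [Module.Finite L E]
    [Module.Finite k (LinearMap.ker (Algebra.linearMap L E))]
    [Module.Finite k (E ⧸ LinearMap.range (Algebra.linearMap L E))]
    (hH : ∀ (y : E) (n : ℕ), (∀ a ∈ maximalIdeal L ^ n, a • y = 0) → y = 0)
    [Module.Finite k (NormalizationCoker k L)] :
    ∃ e : ℕ, localDelta k L = Module.finrank k (E ⧸ LinearMap.range (Algebra.linearMap L E)) -
      Module.finrank k (LinearMap.ker (Algebra.linearMap L E)) + e ∧ (e = 0 ↔ IsNormalRing E) := by
  have hker := localCohomologyZero_eq_ker k hH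
  rw [localDelta, localEpsilon, hker]
  -- If L is Artinian, a power of its maximal ideal is zero, so E = 0. The whole ring L is then the
  -- kernel and contributes with a minus sign.
  by_cases hmin : maximalIdeal L ∈ minimalPrimes L
  · have hnil : nilradical L = maximalIdeal L := by
      refine le_antisymm (nilradical_le_prime _) ?_
      rw [nilradical, Ideal.radical_eq_sInf]
      exact le_sInf fun P hP => hmin.2 ⟨hP.2, bot_le⟩ (le_maximalIdeal hP.2.ne_top)
    obtain ⟨n, hn⟩ := IsNoetherianRing.isNilpotent_nilradical L
    rw [hnil] at hn
    have : Subsingleton E := ⟨fun x y => by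
      rw [hH x n (fun a ha => by rw [hn] at ha; rw [ha, zero_smul]),
        hH y n (fun a ha => by rw [hn] at ha; rw [ha, zero_smul])]⟩
    refine ⟨0, ?_, fun _ => IsNormalRing.of_subsingleton, fun _ => rfl⟩
    have : (nilradical L).IsMaximal := by rw [hnil]; infer_instance
    let := Ideal.Quotient.field (nilradical L)
    rw [finrank_normalizationCoker_eq_zero k
      (IsNormalDomain.isNormalRing ⟨inferInstance, inferInstance⟩)]
    rw [Module.finrank_zero_of_subsingleton (M := E ⧸ LinearMap.range (Algebra.linearMap L E))]
    simp
  -- No minimal prime is maximal here, so elements killed by a power of the maximal ideal lie in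
  -- every minimal prime. Conversely, E is reduced.
  · have hkernil : ∀ x, algebraMap L E x = 0 ↔ x ∈ nilradical L := by
      intro x
      constructor
      · intro hx
        obtain ⟨n, hn⟩ : ∃ n : ℕ, ∀ a ∈ maximalIdeal L ^ n, a * x = 0 :=
          show x ∈ localCohomologyZero L by rw [hker]; exact hx
        rw [nilradical, ← Ideal.sInf_minimalPrimes]
        refine Submodule.mem_sInf.mpr fun (p : Ideal L) (hp : p ∈ minimalPrimes L) => ?_
        have hpp : p.IsPrime := hp.isPrime
        have : ¬ maximalIdeal L ^ n ≤ p := fun hle => hmin (by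
          have := hpp.le_of_pow_le hle
          rwa [← le_antisymm this (le_maximalIdeal hpp.ne_top)] at hp)
        obtain ⟨a, ha, hap⟩ := Set.not_subset.mp this
        exact (hpp.mem_or_mem (show a * x ∈ p by rw [hn a ha]; exact zero_mem p)).resolve_left hap
      · intro hx
        exact ((mem_nilradical.mp hx).map (algebraMap L E)).eq_zero
    let D := L ⧸ nilradical L
    let algDE : Algebra D E := (Ideal.Quotient.lift (nilradical L) (algebraMap L E)
      fun x hx => (hkernil x).mpr hx).toAlgebra
    have : IsScalarTower L D E := IsScalarTower.of_algebraMap_eq fun x => rfl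
    have : IsScalarTower k D E := IsScalarTower.of_algebraMap_eq fun x => by
      rw [IsScalarTower.algebraMap_apply k L E, IsScalarTower.algebraMap_apply k L D,
        IsScalarTower.algebraMap_apply L D E]
    have hinj : Function.Injective (algebraMap D E) := by
      rw [injective_iff_map_eq_zero]
      intro d hd
      obtain ⟨x, rfl⟩ := Ideal.Quotient.mk_surjective d
      exact Ideal.Quotient.eq_zero_iff_mem.mpr ((hkernil x).mp hd)
    obtain ⟨n, hn⟩ := exists_pow_maximalIdeal_smul_eq_zero_of_finite k (L := L)
      (M := E ⧸ LinearMap.range (Algebra.linearMap L E))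
    have hred : _root_.IsReduced D := (Ideal.isRadical_iff_quotient_reduced _).mp
      (Ideal.radical_isRadical _)
    have hns : ∀ a ∈ maximalIdeal L ^ n, ∀ y : E, ∃ d : L, algebraMap L E d = a • y := by
      intro a ha y
      have := hn a ha (Submodule.Quotient.mk y)
      rwa [← Submodule.Quotient.mk_smul, Submodule.Quotient.mk_eq_zero] at this
    -- A power of the maximal ideal multiplies E into D and lies in no minimal prime, so it contains
    -- a nonzerodivisor s with sE ⊆ D. This s identifies the two total rings of fractions.
    obtain ⟨s, hsI, hsD⟩ := exists_mem_nonZeroDivisors_of_not_le (D := D)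
      (I := (maximalIdeal L ^ n).map (Ideal.Quotient.mk _)) fun p hp hle => hmin (by
        have hpp : p.IsPrime := hp.isPrime
        have h1 : p.comap (Ideal.Quotient.mk _) ∈ minimalPrimes L := by
          have := Ideal.comap_minimalPrimes_eq_of_surjective
            (Ideal.Quotient.mk_surjective (I := nilradical L)) ⊥
          rw [← RingHom.ker_eq_comap_bot, Ideal.mk_ker, nilradical, Ideal.radical_minimalPrimes]
            at this
          change _ ∈ Ideal.minimalPrimes 0
          rw [this]
          exact ⟨p, hp, rfl⟩
        have h2 : (p.comap (Ideal.Quotient.mk (nilradical L))).IsPrime := h1.isPrime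
        have h3 := h2.le_of_pow_le (Ideal.map_le_iff_le_comap.mp hle)
        rwa [← le_antisymm h3 (le_maximalIdeal h2.ne_top)] at h1)
    obtain ⟨s, hs, rfl⟩ := (Ideal.mem_map_iff_of_surjective _ Ideal.Quotient.mk_surjective).mp hsI
    have hfrac : IsFractionRing D (FractionRing E) := by
      refine isFractionRing_of_smul_mem_range (E := E) hinj (s := Ideal.Quotient.mk _ s)
        (fun y => ?_) (fun y hy => ?_)
      · obtain ⟨d, hd⟩ := hns s hs y
        exact ⟨Ideal.Quotient.mk _ d, hd.trans (algebraMap_smul D s y).symm⟩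
      · refine hH y n fun a ha => ?_
        obtain ⟨d, hd⟩ := hns a ha y
        have h0 : (Ideal.Quotient.mk _ d : D) * Ideal.Quotient.mk _ s = 0 := hinj (by
          rw [map_mul, map_zero]
          change algebraMap L E d * algebraMap L E s = 0
          have hy : s • y = 0 := (algebraMap_smul D s y).symm.trans hy
          rw [hd, smul_mul_assoc, mul_comm, ← Algebra.smul_def, hy, smul_zero])
        have := (mem_nonZeroDivisors_iff_right.mp hsD) _ h0
        rw [← hd]
        exact (hkernil d).mpr (Ideal.Quotient.eq_zero_iff_mem.mp this)
    let F := FractionRing D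
    let eF : FractionRing E ≃ₐ[D] F := IsLocalization.algEquiv D⁰ _ _
    let : Algebra E F := (eF.toRingHom.comp (algebraMap E (FractionRing E))).toAlgebra
    let eE : FractionRing E ≃ₐ[E] F := { eF with commutes' := fun _ => rfl }
    have : IsFractionRing E F := IsLocalization.isLocalization_of_algEquiv E⁰ eE
    have : IsScalarTower D E F := IsScalarTower.of_algebraMap_eq fun x => by
      change algebraMap D F x = eF (algebraMap E (FractionRing E) (algebraMap D E x))
      rw [← IsScalarTower.algebraMap_apply, AlgEquiv.commutes]
    have : Module.Finite D E := Module.Finite.of_restrictScalars_finite L D E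
    have hnoe : IsNoetherianRing E := IsNoetherianRing.of_finite L E
    have hrange : LinearMap.range (IsScalarTower.toAlgHom k L (Normalization L)).toLinearMap =
        LinearMap.range (IsScalarTower.toAlgHom k D (integralClosure D F)).toLinearMap := by
      ext z
      constructor
      · rintro ⟨x, rfl⟩
        exact ⟨Ideal.Quotient.mk _ x, rfl⟩
      · rintro ⟨x, rfl⟩
        obtain ⟨x, rfl⟩ := Ideal.Quotient.mk_surjective x
        exact ⟨x, rfl⟩
    have hrange' : LinearMap.range (IsScalarTower.toAlgHom k D E).toLinearMap =
        (LinearMap.range (Algebra.linearMap L E)).restrictScalars k := by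
      ext z
      constructor
      · rintro ⟨x, rfl⟩
        obtain ⟨x, rfl⟩ := Ideal.Quotient.mk_surjective x
        exact ⟨x, rfl⟩
      · rintro ⟨x, rfl⟩
        exact ⟨Ideal.Quotient.mk _ x, rfl⟩
    have hfin : Module.Finite k (integralClosure D F ⧸
        LinearMap.range (IsScalarTower.toAlgHom k D (integralClosure D F)).toLinearMap) := by
      rw [← hrange]; assumption
    obtain ⟨e, he, he0⟩ := exists_finrank_coker_integralClosure_eq k D E F
    refine ⟨e, ?_, he0⟩
    rw [← hrange, hrange', (Submodule.Quotient.restrictScalarsEquiv k _).finrank_eq] at he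
    rw [show Module.finrank k (NormalizationCoker k L) = _ from he]
    push_cast
    ring

end LocalDelta


/-! ### Finiteness of normalization over Nagata rings -/

section Nagata

open nonZeroDivisors

/-- By `hf`, D is a localization of R/ker f, so both have the same fraction field. Generators of the
integral closure of R/ker f generate that of D after clearing denominators. -/
theorem finite_integralClosure_of_isNagata {R D : Type u} [CommRing R] (hR : IsNagata R)
    [CommRing D] [IsDomain D] (f : R →+* D) (hf : ∀ b, ∃ s, IsUnit (f s) ∧ ∃ r, f r = f s * b) :
    Module.Finite D (integralClosure D (FractionRing D)) := by
  let p := RingHom.ker f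
  have hp : p.IsPrime := RingHom.ker_isPrime f
  let E := R ⧸ p
  let K := FractionRing D
  let : Algebra E D := (RingHom.kerLift f).toAlgebra
  have hED : Function.Injective (algebraMap E D) := RingHom.kerLift_injective f
  have hEK : Function.Injective (algebraMap E K) := by
    rw [IsScalarTower.algebraMap_eq E D K]
    exact (IsFractionRing.injective D K).comp hED
  have : FaithfulSMul E K := (faithfulSMul_iff_algebraMap_injective E K).mpr hEK
  let : Algebra (FractionRing E) K := FractionRing.liftAlgebra E K
  have : IsScalarTower E (FractionRing E) K := FractionRing.isScalarTower_liftAlgebra E K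
  let M : Submonoid E := (IsUnit.submonoid D).comap (algebraMap E D)
  have : IsLocalization M D := by
    refine ⟨fun s => s.2, fun b => ?_, fun h => ⟨1, by rw [hED h]⟩⟩
    obtain ⟨s, hs, r, hr⟩ := hf b
    exact ⟨⟨Ideal.Quotient.mk _ r, ⟨Ideal.Quotient.mk _ s, hs⟩⟩, (mul_comm _ _).trans hr.symm⟩
  have hsurj : Function.Surjective (algebraMap (FractionRing E) K) := by
    intro z
    obtain ⟨a, b, hb, rfl⟩ := IsFractionRing.div_surjective (A := D) z
    obtain ⟨⟨a', s⟩, ha⟩ := IsLocalization.surj M a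
    obtain ⟨⟨b', t⟩, hb'⟩ := IsLocalization.surj M b
    refine ⟨algebraMap E _ (a' * t) / algebraMap E _ (b' * s), ?_⟩
    have hK := fun (d : D) (h : d ≠ 0) => (map_ne_zero_iff _ (IsFractionRing.injective D K)).mpr h
    have hb0 := hK b (nonZeroDivisors.ne_zero hb)
    have hs0 := hK _ (IsLocalization.map_units D s).ne_zero
    have ht0 := hK _ (IsLocalization.map_units D t).ne_zero
    simp only [map_div₀, ← IsScalarTower.algebraMap_apply E (FractionRing E) K]
    simp only [IsScalarTower.algebraMap_apply E D K, map_mul, ← ha, ← hb']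
    rw [mul_assoc, mul_assoc,
      mul_comm (algebraMap D K (algebraMap E D t)) (algebraMap D K (algebraMap E D s)),
      mul_div_mul_right _ _ (mul_ne_zero hs0 ht0)]
  have hfin : Module.Finite (FractionRing E) K :=
    Module.Finite.of_surjective (Algebra.linearMap (FractionRing E) K) hsurj
  obtain ⟨n, c, hc⟩ := (hR.2 p hp K hfin).exists_fin
  have hint : ∀ z : integralClosure E K, IsIntegral D (z : K) := fun z => z.2.tower_top
  let c' : Fin n → integralClosure D K := fun i => ⟨c i, hint (c i)⟩
  refine ⟨Submodule.fg_def.mpr ⟨Set.range c', Set.finite_range c', ?_⟩⟩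
  rw [eq_top_iff]
  rintro ⟨z, hz⟩ -
  obtain ⟨m, hm⟩ := IsIntegral.exists_multiple_integral_of_isLocalization M z hz
  have h1 : (⟨m • z, hm⟩ : integralClosure E K) ∈ Submodule.span E (Set.range c) := by
    rw [hc]; trivial
  obtain ⟨a, ha⟩ := (Submodule.mem_span_range_iff_exists_fun E).mp h1
  have ha : ∑ i, a i • (c i : K) = m • z := by simpa using congrArg Subtype.val ha
  obtain ⟨v, hv⟩ := (IsLocalization.map_units D m).exists_left_inv
  have h2 : (⟨z, hz⟩ : integralClosure D K) =
      ∑ i, (v * algebraMap E D (a i)) • c' i := by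
    have h3 : ∀ i, ((((v * algebraMap E D (a i)) • c' i : integralClosure D K)) : K) =
        v • (a i • (c i : K)) := fun i => by
      rw [← algebraMap_smul D (a i), smul_smul]
      rfl
    refine Subtype.ext ?_
    rw [AddSubmonoidClass.coe_finsetSum, Finset.sum_congr rfl fun i _ => h3 i, ← Finset.smul_sum,
      ha, Submonoid.smul_def, ← algebraMap_smul D (m : E) z, smul_smul, hv, one_smul]
  rw [h2]
  exact Submodule.sum_mem _ fun i _ => Submodule.smul_mem _ _ (Submodule.subset_span ⟨i, rfl⟩)

/-- The integral closure embeds in the finite product of the integral closures of the D/P, which is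
a Noetherian D-module. -/
theorem finite_integralClosure_fractionRing {D : Type u} [CommRing D] [_root_.IsReduced D]
    [IsNoetherianRing D]
    (h : ∀ P ∈ minimalPrimes D, Module.Finite (D ⧸ P) (integralClosure (D ⧸ P)
      (FractionRing (D ⧸ P)))) : Module.Finite D (integralClosure D (FractionRing D)) := by
  have := (minimalPrimes.finite_of_isNoetherianRing D).to_subtype
  have hP : ∀ P : minimalPrimes D, P.1.IsPrime := fun P => P.2.isPrime
  let K := fun P : minimalPrimes D => FractionRing (D ⧸ P.1)
  let C := fun P : minimalPrimes D => integralClosure (D ⧸ P.1) (K P)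
  let F := FractionRing D
  have hC : ∀ P : minimalPrimes D, Module.Finite D (C P) := fun P => by
    have := h P P.2
    exact Module.Finite.trans (D ⧸ P.1) _
  let f : ∀ P : minimalPrimes D, F →ₐ[D] K P := fun P => IsLocalization.liftAlgHom (M := D⁰)
    (f := Algebra.ofId D (K P)) fun s => by
      have : (Ideal.Quotient.mk P.1 s) ≠ 0 := fun h0 =>
        mem_nonZeroDivisors_iff_forall_minimalPrimes.mp s.2 P P.2
          (Ideal.Quotient.eq_zero_iff_mem.mp h0)
      exact ((map_ne_zero_iff _ (IsFractionRing.injective (D ⧸ P.1) (K P))).mpr this).isUnit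
  let g : integralClosure D F →ₗ[D] ∀ P, C P := LinearMap.pi fun P =>
    { toFun := fun z => ⟨f P z, (z.2.map (f P)).tower_top⟩
      map_add' := fun x y => Subtype.ext (map_add (f P) x.1 y.1)
      map_smul' := fun c x => Subtype.ext (map_smul (f P) c x.1) }
  have hg : Function.Injective g := by
    rw [← LinearMap.ker_eq_bot, LinearMap.ker_eq_bot']
    rintro ⟨z, hz⟩ h0
    obtain ⟨⟨a, s⟩, has⟩ := IsLocalization.surj D⁰ z
    have ha : a ∈ (⊥ : Ideal D).radical := by
      rw [← Ideal.sInf_minimalPrimes]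
      refine Submodule.mem_sInf.mpr fun P hP => ?_
      have h1 : f ⟨P, hP⟩ z = 0 := congrArg Subtype.val (congrFun h0 ⟨P, hP⟩)
      have h2 := congrArg (f ⟨P, hP⟩) has
      rw [map_mul, h1, zero_mul, AlgHom.commutes,
        IsScalarTower.algebraMap_apply D (D ⧸ P) (FractionRing (D ⧸ P))] at h2
      exact Ideal.Quotient.eq_zero_iff_mem.mp
        ((map_eq_zero_iff _ (IsFractionRing.injective (D ⧸ P) _)).mp h2.symm)
    rw [(mem_nilradical.mp ha).eq_zero, map_zero] at has
    exact Subtype.ext ((IsLocalization.map_units F s).mul_left_eq_zero.mp has)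
  exact Module.Finite.of_injective g hg

/-- The normalization of an algebra which is a localization of a quotient of a Nagata ring
is finite. -/
theorem finite_normalization_of_isNagata {R B : Type u} [CommRing R] (hR : IsNagata R)
    [CommRing B] [IsNoetherianRing B] (f : R →+* B)
    (hf : ∀ b, ∃ s, IsUnit (f s) ∧ ∃ r, f r = f s * b) : Module.Finite B (Normalization B) := by
  let D := B ⧸ nilradical B
  have hred : _root_.IsReduced D := (Ideal.isRadical_iff_quotient_reduced _).mp
    (Ideal.radical_isRadical _)
  have : Module.Finite D (Normalization B) := by
    refine finite_integralClosure_fractionRing fun P hP => ?_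
    have : P.IsPrime := hP.isPrime
    refine finite_integralClosure_of_isNagata hR
      ((Ideal.Quotient.mk P).comp ((Ideal.Quotient.mk (nilradical B)).comp f)) fun b => ?_
    obtain ⟨b, rfl⟩ := Ideal.Quotient.mk_surjective b
    obtain ⟨b, rfl⟩ := Ideal.Quotient.mk_surjective b
    obtain ⟨s, hs, r, hr⟩ := hf b
    exact ⟨s, (hs.map (Ideal.Quotient.mk (nilradical B))).map (Ideal.Quotient.mk P), r, by
      simp only [RingHom.comp_apply, hr, map_mul]⟩
  exact Module.Finite.trans D _

end Nagata


/-! ### The delta invariant of an algebra over a field -/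

section Delta

open IsLocalRing

section Localized

variable {B B' : Type*} (L E : Type*) [CommRing B] [CommRing B'] [CommRing L] [CommRing E]
  [Algebra B B'] [Algebra B L] [Algebra B E] [Algebra B' E] [Algebra L E] [IsScalarTower B B' E]
  [IsScalarTower B L E] (S : Submonoid B) [IsLocalization S L]
  [IsLocalization (Algebra.algebraMapSubmonoid B' S) E]

/-- Identifies the localization of B → B' with L → E, so that kernels and cokernels of the local
maps are localizations of the global ones. -/
theorem extendScalars_map_linearMap :
    (IsLocalizedModule.map S (Algebra.linearMap B L) (IsScalarTower.toAlgHom B B' E).toLinearMap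
      (Algebra.linearMap B B')).extendScalarsOfIsLocalization S L = Algebra.linearMap L E := by
  refine LinearMap.ext_ring ?_
  have := IsLocalizedModule.map_apply S (Algebra.linearMap B L)
    (IsScalarTower.toAlgHom B B' E).toLinearMap (Algebra.linearMap B B') 1
  simpa using this

theorem localized_ker_linearMap :
    (LinearMap.ker (Algebra.linearMap B B')).localized' L S (Algebra.linearMap B L) =
      LinearMap.ker (Algebra.linearMap L E) := by
  rw [← extendScalars_map_linearMap (B' := B') L E S]
  exact LinearMap.localized'_ker_eq_ker_localizedMap L S (Algebra.linearMap B L)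
    (IsScalarTower.toAlgHom B B' E).toLinearMap (Algebra.linearMap B B')

theorem localized_range_linearMap :
    (LinearMap.range (Algebra.linearMap B B')).localized' L S
      (IsScalarTower.toAlgHom B B' E).toLinearMap = LinearMap.range (Algebra.linearMap L E) := by
  rw [← extendScalars_map_linearMap (B' := B') L E S]
  exact LinearMap.localized'_range_eq_range_localizedMap L S (Algebra.linearMap B L)
    (IsScalarTower.toAlgHom B B' E).toLinearMap (Algebra.linearMap B B')

/-- The localization map of the kernel of an algebra. -/
noncomputable def kerToLocalization : LinearMap.ker (Algebra.linearMap B B') →ₗ[B]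
    LinearMap.ker (Algebra.linearMap L E) :=
  ((LinearEquiv.ofEq _ _ (localized_ker_linearMap L E S)).restrictScalars B).toLinearMap ∘ₗ
    (LinearMap.ker (Algebra.linearMap B B')).toLocalized' L S (Algebra.linearMap B L)

/-- The localization map of the cokernel of an algebra. -/
noncomputable def cokerToLocalization : (B' ⧸ LinearMap.range (Algebra.linearMap B B')) →ₗ[B]
    E ⧸ LinearMap.range (Algebra.linearMap L E) :=
  ((Submodule.quotEquivOfEq _ _ (localized_range_linearMap L E S)).restrictScalars B).toLinearMap
    ∘ₗ (LinearMap.range (Algebra.linearMap B B')).toLocalizedQuotient' L S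
      (IsScalarTower.toAlgHom B B' E).toLinearMap

instance : IsLocalizedModule S (kerToLocalization (B := B) (B' := B') L E S) :=
  IsLocalizedModule.of_linearEquiv S _ _

instance : IsLocalizedModule S (cokerToLocalization (B := B) (B' := B') L E S) :=
  IsLocalizedModule.of_linearEquiv S _ _

end Localized

/-- For each minimal prime q of E, some element of m^n is nonzero modulo q and forces y into q. -/
theorem eq_zero_of_forall_smul_eq_zero {L E : Type*} [CommRing L] [CommRing E] [Algebra L E]
    [_root_.IsReduced E] (m : Ideal L) [m.IsMaximal]
    (hq : ∀ q ∈ minimalPrimes E, q.comap (algebraMap L E) ≠ m) (y : E) (n : ℕ)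
    (hy : ∀ a ∈ m ^ n, a • y = 0) : y = 0 := by
  have : y ∈ (⊥ : Ideal E).radical := by
    rw [← Ideal.sInf_minimalPrimes]
    refine Submodule.mem_sInf.mpr fun (q : Ideal E) (hqm : q ∈ minimalPrimes E) => ?_
    have hqp : q.IsPrime := hqm.isPrime
    have hle : ¬ m ^ n ≤ q.comap (algebraMap L E) := fun hle => hq q hqm
      (Ideal.IsMaximal.eq_of_le ‹_› (hqp.comap _).ne_top ((hqp.comap _).le_of_pow_le hle)).symm
    obtain ⟨a, ha, haq⟩ := Set.not_subset.mp hle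
    have h0 : algebraMap L E a * y ∈ q := by
      rw [← Algebra.smul_def, hy a ha]; exact zero_mem q
    exact (hqp.mem_or_mem h0).resolve_left haq
  exact (mem_nilradical.mp this).eq_zero

theorem isMaximal_of_finite_residueField (k : Type*) {B : Type*} [Field k] [CommRing B]
    [Algebra k B] (p : Ideal B) [p.IsPrime] [Module.Finite k p.ResidueField] : p.IsMaximal := by
  refine Ideal.Quotient.maximal_of_isField _ ?_
  have hinj := Ideal.injective_algebraMap_quotient_residueField p
  have : Algebra.IsIntegral k (B ⧸ p) := ⟨fun x => by
    have h1 : IsIntegral k (algebraMap (B ⧸ p) p.ResidueField x) := Algebra.IsIntegral.isIntegral _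
    exact (isIntegral_algHom_iff (IsScalarTower.toAlgHom k (B ⧸ p) p.ResidueField) hinj).mp h1⟩
  exact isField_of_isIntegral_of_isField' (R := k) (Field.toIsField k)

/-- B modulo the annihilator embeds in End_k(M). -/
theorem finite_quotient_annihilator (k B M : Type*) [Field k] [CommRing B] [Algebra k B]
    [AddCommGroup M] [Module B M] [Module k M] [IsScalarTower k B M] [Module.Finite k M] :
    Module.Finite k (B ⧸ Module.annihilator B M) := by
  let I := Module.annihilator B M
  let f : B →ₗ[k] (M →ₗ[k] M) := (Algebra.lsmul k k M).toLinearMap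
  have hf : LinearMap.ker f = I.restrictScalars k := by
    ext b
    simp [I, f, Module.mem_annihilator, LinearMap.ext_iff]
  have h1 : Module.Finite k (B ⧸ I.restrictScalars k) := by
    rw [← hf]
    exact Module.Finite.equiv f.quotKerEquivRange.symm
  exact Module.Finite.equiv (Submodule.Quotient.restrictScalarsEquiv k I)

theorem isMaximal_of_annihilator_le (k : Type*) {B M : Type*} [Field k] [CommRing B] [Algebra k B]
    [AddCommGroup M] [Module B M] [Module k M] [IsScalarTower k B M] [Module.Finite k M]
    (p : Ideal B) [p.IsPrime] (h : Module.annihilator B M ≤ p) : p.IsMaximal := by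
  have := finite_quotient_annihilator k B M
  have : Module.Finite k (B ⧸ p) := Module.Finite.of_surjective
    (Ideal.Quotient.factorₐ k h).toLinearMap (Ideal.Quotient.factor_surjective h)
  exact Ideal.Quotient.maximal_of_isField _
    (isField_of_isIntegral_of_isField' (R := k) (Field.toIsField k))

theorem finite_setOf_annihilator_le (k : Type*) {B M : Type*} [Field k] [CommRing B] [Algebra k B]
    [AddCommGroup M] [Module B M] [Module k M] [IsScalarTower k B M] [Module.Finite k M] :
    {m : MaximalSpectrum B | Module.annihilator B M ≤ m.asIdeal}.Finite := by
  let I := Module.annihilator B M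
  have : Module.Finite k (B ⧸ I) := finite_quotient_annihilator k B M
  have : IsArtinianRing (B ⧸ I) := isArtinian_of_tower k inferInstance
  have hfin : Finite (MaximalSpectrum (B ⧸ I)) := inferInstance
  refine (Set.finite_range fun J : MaximalSpectrum (B ⧸ I) =>
    (⟨J.asIdeal.comap (Ideal.Quotient.mk I), Ideal.comap_isMaximal_of_surjective _
      Ideal.Quotient.mk_surjective (H := J.isMaximal)⟩ : MaximalSpectrum B)).subset fun m hm => ?_
  have hmap : (m.asIdeal.map (Ideal.Quotient.mk I)).comap (Ideal.Quotient.mk I) = m.asIdeal := by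
    rw [Ideal.comap_map_of_surjective _ Ideal.Quotient.mk_surjective, ← RingHom.ker_eq_comap_bot,
      Ideal.mk_ker]
    exact sup_eq_left.mpr hm
  have hmax : (m.asIdeal.map (Ideal.Quotient.mk I)).IsMaximal := by
    refine (Ideal.map_eq_top_or_isMaximal_of_surjective _ Ideal.Quotient.mk_surjective
      m.isMaximal).resolve_left fun h => m.isMaximal.ne_top ?_
    rw [← hmap, h, Ideal.comap_top]
  exact ⟨⟨_, hmax⟩, MaximalSpectrum.ext hmap⟩

theorem isNormalRing_quotient_nilradical {L : Type*} [CommRing L] (h : IsNormalRing L) :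
    IsNormalRing (L ⧸ nilradical L) := by
  have := h.isReduced
  rw [nilradical_eq_zero]
  exact h.of_ringEquiv (RingEquiv.quotientBot L).symm

theorem finite_normalizationCoker_atPrime (k : Type u) {B : Type u} [Field k] [CommRing B]
    [IsNoetherianRing B] [Algebra k B] (h : HasFinitelyManyINNS k B) (m : Ideal B) [m.IsMaximal]
    [Module.Finite (Localization.AtPrime m) (Normalization (Localization.AtPrime m))] :
    Module.Finite k (NormalizationCoker k (Localization.AtPrime m)) := by
  let L := Localization.AtPrime m
  by_cases hm : IsNormalDomain L
  · have : Subsingleton (NormalizationCoker k L) := by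
      rw [Submodule.Quotient.subsingleton_iff, LinearMap.range_eq_top]
      exact algebraMap_normalization_surjective (isNormalRing_quotient_nilradical hm.isNormalRing)
    infer_instance
  · have hres : Module.Finite k (L ⧸ maximalIdeal L) := (h.2 ⟨m, inferInstance⟩ hm).2
    refine finite_normalizationCoker k fun P _ hP => ?_
    -- A non-normal point is closed because its residue field is finite over k, so it cannot be a
    -- proper generization of m.
    have hq : IsNormalDomain (Localization.AtPrime (P.comap (algebraMap B L))) := by
      by_contra hq
      have : Module.Finite k (P.comap (algebraMap B L)).ResidueField :=
        (h.2 ⟨P.comap (algebraMap B L), inferInstance⟩ hq).2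
      have hmax := isMaximal_of_finite_residueField k (P.comap (algebraMap B L))
      have hle : P.comap (algebraMap B L) ≤ (maximalIdeal L).comap (algebraMap B L) :=
        Ideal.comap_mono (le_maximalIdeal (Ideal.IsPrime.ne_top ‹_›))
      have heq := hmax.eq_of_le (Ideal.IsPrime.ne_top inferInstance) hle
      exact hP ((IsLocalization.map_under m.primeCompl L P).symm.trans
        ((congrArg (Ideal.map (algebraMap B L)) heq).trans
          (IsLocalization.map_under m.primeCompl L _)))
    exact hq.isNormalRing.of_ringEquiv (IsLocalization.algEquiv
      (P.comap (algebraMap B L)).primeCompl _ (Localization.AtPrime P)).toRingEquiv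

instance {k B B' : Type*} [CommRing k] [CommRing B] [CommRing B'] [Algebra k B] [Algebra k B']
    [Algebra B B'] [IsScalarTower k B B'] (S : Submonoid B) :
    IsScalarTower k (Localization S) (Localization (Algebra.algebraMapSubmonoid B' S)) :=
  IsScalarTower.of_algebraMap_eq fun x => by
    let L := Localization S
    let E := Localization (Algebra.algebraMapSubmonoid B' S)
    rw [IsScalarTower.algebraMap_apply k B L, ← IsScalarTower.algebraMap_apply B L E,
      IsScalarTower.algebraMap_apply B B' E, ← IsScalarTower.algebraMap_apply k B B',
      ← IsScalarTower.algebraMap_apply k B' E]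

/-- No minimal prime of the localization of B' lies over m: by integrality it would come from a
minimal prime of B' that is maximal. -/
theorem exists_localDelta_atPrime_eq (k : Type u) {B B' : Type u} [Field k] [CommRing B]
    [IsNoetherianRing B] [Algebra k B] [CommRing B'] [_root_.IsReduced B'] [Algebra B B']
    [Algebra k B'] [IsScalarTower k B B'] [Module.Finite B B']
    [Module.Finite k (LinearMap.ker (Algebra.linearMap B B'))]
    [Module.Finite k (B' ⧸ LinearMap.range (Algebra.linearMap B B'))]
    (hB : HasFinitelyManyINNS k B) (hB' : NoIsolatedPoints B') (m : Ideal B) [m.IsMaximal]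
    [Module.Finite (Localization.AtPrime m) (Normalization (Localization.AtPrime m))] :
    ∃ e : ℕ, localDelta k (Localization.AtPrime m) =
      Module.finrank k (Localization (Algebra.algebraMapSubmonoid B' m.primeCompl) ⧸
        LinearMap.range (Algebra.linearMap (Localization.AtPrime m)
          (Localization (Algebra.algebraMapSubmonoid B' m.primeCompl)))) -
      Module.finrank k (LinearMap.ker (Algebra.linearMap (Localization.AtPrime m)
          (Localization (Algebra.algebraMapSubmonoid B' m.primeCompl)))) + e ∧
      (e = 0 ↔ IsNormalRing (Localization (Algebra.algebraMapSubmonoid B' m.primeCompl))) := by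
  let L := Localization.AtPrime m
  let E := Localization (Algebra.algebraMapSubmonoid B' m.primeCompl)
  have hLE : Module.Finite L E := Module.Finite.of_isLocalization B B' m.primeCompl
  have hred : _root_.IsReduced E :=
    isReduced_localizationPreserves (Algebra.algebraMapSubmonoid B' m.primeCompl) E inferInstance
  have : Module.Finite k (LinearMap.ker (Algebra.linearMap L E)) :=
    finite_of_isLocalizedModule k m.primeCompl (kerToLocalization (B' := B') L E m.primeCompl)
  have : Module.Finite k (E ⧸ LinearMap.range (Algebra.linearMap L E)) :=
    finite_of_isLocalizedModule k m.primeCompl (cokerToLocalization (B' := B') L E m.primeCompl)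
  have := finite_normalizationCoker_atPrime k hB m
  refine exists_localDelta_eq k (L := L) (E := E)
    (eq_zero_of_forall_smul_eq_zero (maximalIdeal L) fun q hq hqL => ?_)
  have h1 : q.comap (algebraMap B' E) ∈ minimalPrimes B' := by
    have h2 := IsLocalization.minimalPrimes_map (Algebra.algebraMapSubmonoid B' m.primeCompl) E
      (⊥ : Ideal B')
    rw [Ideal.map_bot] at h2
    exact h2.le hq
  have hp : (q.comap (algebraMap B' E)).IsPrime := h1.isPrime
  refine hB' _ h1 (Ideal.isMaximal_of_isIntegral_of_isMaximal_comap (R := B) _ ?_)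
  have h2 : (q.comap (algebraMap B' E)).comap (algebraMap B B') = m := by
    rw [Ideal.comap_comap, ← IsScalarTower.algebraMap_eq, IsScalarTower.algebraMap_eq B L E,
      ← Ideal.comap_comap, hqL]
    exact IsLocalization.AtPrime.under_maximalIdeal L m
  rw [h2]
  infer_instance

end Delta


/-! ### Summation of the local δ over closed points -/

section Delta

open IsLocalRing

theorem isNormalRing_iff_forall_localization {B B' : Type u} [CommRing B] [CommRing B']
    [Algebra B B'] [Algebra.IsIntegral B B'] :
    IsNormalRing B' ↔ ∀ m : MaximalSpectrum B,
      IsNormalRing (Localization (Algebra.algebraMapSubmonoid B' m.asIdeal.primeCompl)) := by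
  refine ⟨fun h m => h.of_isLocalization (Algebra.algebraMapSubmonoid B' m.asIdeal.primeCompl) _,
    fun h => IsNormalRing.of_forall_isMaximal fun M hM => ?_⟩
  let m : MaximalSpectrum B := ⟨M.comap (algebraMap B B'), Ideal.isMaximal_comap_of_isIntegral_of_isMaximal M⟩
  refine ⟨Algebra.algebraMapSubmonoid B' m.asIdeal.primeCompl, _, inferInstance, inferInstance,
    inferInstance, ?_, h m⟩
  rintro _ ⟨s, hs, rfl⟩ hsM
  exact hs hsM

theorem subsingleton_of_isLocalizedModule_of_not_le {B M P : Type*} [CommRing B] [AddCommGroup M]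
    [Module B M] [AddCommGroup P] [Module B P] (m : Ideal B) [m.IsPrime] (l : M →ₗ[B] P)
    [IsLocalizedModule m.primeCompl l] (h : ¬ Module.annihilator B M ≤ m) : Subsingleton P := by
  obtain ⟨a, ha, ham⟩ := Set.not_subset.mp h
  refine subsingleton_of_forall_eq 0 fun y => ?_
  obtain ⟨⟨x, s⟩, hx⟩ := IsLocalizedModule.surj m.primeCompl l y
  have hx : (s : B) • y = l x := hx
  refine IsLocalizedModule.smul_injective l (⟨a, ham⟩ * s : m.primeCompl) ?_
  change (a * (s : B)) • y = (a * (s : B)) • (0 : P)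
  rw [mul_smul, hx, ← map_smul, Module.mem_annihilator.mp ha, map_zero, smul_zero]

/-- The delta invariant of an algebra in terms of a finite algebra with finite-dimensional kernel
and cokernel. -/
theorem exists_delta_eq (k : Type u) {B B' : Type u} [Field k] [CommRing B]
    [IsNoetherianRing B] [Algebra k B] [CommRing B'] [_root_.IsReduced B'] [Algebra B B']
    [Algebra k B'] [IsScalarTower k B B'] [Module.Finite B B']
    [hker : Module.Finite k (LinearMap.ker (Algebra.linearMap B B'))]
    [hcok : Module.Finite k (B' ⧸ LinearMap.range (Algebra.linearMap B B'))]
    (hB : HasFinitelyManyINNS k B) (hB' : NoIsolatedPoints B')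
    (hN : ∀ m : MaximalSpectrum B, Module.Finite (Localization.AtPrime m.asIdeal)
      (Normalization (Localization.AtPrime m.asIdeal))) :
    ∃ e : ℕ, delta k B = Module.finrank k (B' ⧸ LinearMap.range (Algebra.linearMap B B')) -
      Module.finrank k (LinearMap.ker (Algebra.linearMap B B')) + e ∧
      (e = 0 ↔ IsNormalRing B') := by
  let L := fun m : MaximalSpectrum B => Localization.AtPrime m.asIdeal
  let E := fun m : MaximalSpectrum B =>
    Localization (Algebra.algebraMapSubmonoid B' m.asIdeal.primeCompl)
  let lk := fun m : MaximalSpectrum B =>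
    kerToLocalization (B' := B') (L m) (E m) m.asIdeal.primeCompl
  let lc := fun m : MaximalSpectrum B =>
    cokerToLocalization (B' := B') (L m) (E m) m.asIdeal.primeCompl
  choose e he he0 using fun m : MaximalSpectrum B =>
    exists_localDelta_atPrime_eq k hB hB' m.asIdeal
  have hfin1 := finite_setOf_annihilator_le k (B := B)
    (M := LinearMap.ker (Algebra.linearMap B B'))
  have hfin2 := finite_setOf_annihilator_le k (B := B)
    (M := B' ⧸ LinearMap.range (Algebra.linearMap B B'))
  have hfin3 : {m : MaximalSpectrum B | ¬ IsNormalDomain (L m)}.Finite := by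
    refine Set.Finite.of_finite_image (f := MaximalSpectrum.toPrimeSpectrum)
      (hB.1.subset ?_) (MaximalSpectrum.toPrimeSpectrum_injective.injOn)
    rintro _ ⟨m, hm, rfl⟩
    exact hm
  -- T contains all points where the kernel, the cokernel or non-normality is visible. Elsewhere the
  -- local rings of B and B' agree and are normal, so nothing is contributed.
  let T := ((hfin1.union hfin2).union hfin3).toFinset
  have hout : ∀ m ∉ T, Subsingleton (LinearMap.ker (Algebra.linearMap (L m) (E m))) ∧
      Subsingleton (E m ⧸ LinearMap.range (Algebra.linearMap (L m) (E m))) ∧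
      IsNormalRing (E m) := by
    intro m hm
    simp only [T, Set.Finite.mem_toFinset, Set.mem_union, Set.mem_ofPred_eq, not_or, not_not] at hm
    have h1 := subsingleton_of_isLocalizedModule_of_not_le m.asIdeal (lk m) hm.1.1
    have h2 := subsingleton_of_isLocalizedModule_of_not_le m.asIdeal (lc m) hm.1.2
    refine ⟨h1, h2, ?_⟩
    refine hm.2.isNormalRing.of_ringEquiv (RingEquiv.ofBijective (algebraMap (L m) (E m)) ⟨?_, ?_⟩)
    · exact LinearMap.ker_eq_bot.mp ((Submodule.subsingleton_iff_eq_bot).mp h1)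
    · exact LinearMap.range_eq_top.mp (Submodule.Quotient.subsingleton_iff.mp h2)
  have hsum : delta k B = ∑ m ∈ T, localDelta k (L m) := by
    refine finsum_eq_sum_of_support_subset _ fun m hm => ?_
    by_contra hmT
    obtain ⟨h1, h2, h3⟩ := hout m hmT
    refine hm ((he m).trans ?_)
    rw [(he0 m).mpr h3, Module.finrank_zero_of_subsingleton,
      Module.finrank_zero_of_subsingleton]
    rfl
  have hT1 : ∀ m : MaximalSpectrum B,
      Module.annihilator B (LinearMap.ker (Algebra.linearMap B B')) ≤ m.asIdeal → m ∈ T :=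
    fun m hm => by simp [T, hm]
  have hT2 : ∀ m : MaximalSpectrum B, Module.annihilator B
      (B' ⧸ LinearMap.range (Algebra.linearMap B B')) ≤ m.asIdeal → m ∈ T :=
    fun m hm => by simp only [T, Set.Finite.mem_toFinset]; exact Or.inl (Or.inr hm)
  refine ⟨∑ m ∈ T, e m, ?_, ?_⟩
  · rw [hsum, finrank_eq_sum_of_isLocalizedModule k T hT1 _ lk,
      finrank_eq_sum_of_isLocalizedModule k T hT2 _ lc, Finset.sum_congr rfl fun m _ => he m,
      Finset.sum_add_distrib, Finset.sum_sub_distrib]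
    push_cast
    rfl
  · rw [Finset.sum_eq_zero_iff, isNormalRing_iff_forall_localization (B := B)]
    refine ⟨fun h m => ?_, fun h m _ => (he0 m).mpr (h m)⟩
    by_cases hm : m ∈ T
    · exact (he0 m).mp (h m hm)
    · exact (hout m hm).2.2

end Delta


/-! ### Reduced quotients of integrally closed rings -/

section Associated

/-- Cayley–Hamilton for multiplication by x on M. The ring F need not be a domain, so faithfulness
of M is ensured by the regular element a. -/
theorem isIntegral_of_mul_mem_submodule {N F : Type*} [CommRing N] [CommRing F] [Algebra N F]
    (M : Submodule N F) (hM : M.FG) {a : F} (ha : a ∈ M) (hreg : ∀ y : F, y * a = 0 → y = 0) (x : F)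
    (hx : ∀ n ∈ M, x * n ∈ M) : IsIntegral N x := by
  let A' : Subalgebra N F :=
    { carrier := { x | ∀ n ∈ M, x * n ∈ M }
      mul_mem' := fun {a b} ha hb n hn => (mul_assoc a b n).symm ▸ ha _ (hb _ hn)
      one_mem' := fun n hn => (one_mul n).symm ▸ hn
      add_mem' := fun {a b} ha hb n hn => (add_mul a b n).symm ▸ M.add_mem (ha _ hn) (hb _ hn)
      zero_mem' := fun n _ => (zero_mul n).symm ▸ M.zero_mem
      algebraMap_mem' := fun r n hn => Algebra.smul_def r n ▸ M.smul_mem r hn }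
  let f : A' →ₐ[N] Module.End N M :=
    AlgHom.ofLinearMap
      { toFun := fun x => (LinearMap.mulLeft N x.1).restrict x.prop
        map_add' := by intro x y; ext; exact add_mul _ _ _
        map_smul' := by intro r s; ext; apply smul_mul_assoc }
      (by ext; apply one_mul)
      (by intro x y; ext; apply mul_assoc)
  have hf : ∀ s : A', f s = 0 → s = 0 := fun s hs => by
    have : s.1 * a = 0 := congr_arg Subtype.val (LinearMap.congr_fun hs ⟨a, ha⟩)
    exact Subtype.ext (hreg _ this)
  have : Module.Finite N M := by rwa [Module.Finite.iff_fg]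
  obtain ⟨p, hp, hp0⟩ := LinearMap.exists_monic_and_aeval_eq_zero N (f ⟨x, hx⟩)
  rw [Polynomial.aeval_algHom_apply] at hp0
  refine ⟨p, hp, ?_⟩
  have h1 := congrArg A'.val (hf _ hp0)
  rwa [← Polynomial.aeval_algHom_apply, map_zero] at h1

/-- The associated primes of a quotient of an integrally closed ring by a principal ideal are
minimal. -/
theorem mem_minimalPrimes_of_isAssociatedPrime {N F C : Type*} [CommRing N] [IsNoetherianRing N]
    [CommRing F] [Algebra N F] [CommRing C] (hinj : Function.Injective (algebraMap N F))
    (hcl : ∀ z : F, IsIntegral N z → ∃ d, algebraMap N F d = z) (f : N →+* C)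
    (hf : Function.Surjective f) (w : N) (hw : IsUnit (algebraMap N F w))
    (hker : RingHom.ker f = Ideal.span {w}) {q : Ideal C} (hq : IsAssociatedPrime q C) :
    q ∈ minimalPrimes C := by
  have hC : IsNoetherianRing C := isNoetherianRing_of_surjective _ _ f hf
  obtain ⟨hqp, x, hx⟩ := isAssociatedPrime_iff.mp hq
  obtain ⟨y, rfl⟩ := hf x
  have hmem : ∀ a : N, f a ∈ q ↔ w ∣ a * y := fun a => by
    rw [hx, Submodule.mem_colon_singleton, Submodule.mem_bot, smul_eq_mul, ← map_mul,
      ← RingHom.mem_ker, hker, Ideal.mem_span_singleton]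
  have hw0 : f w = 0 := by
    rw [← RingHom.mem_ker, hker]; exact Ideal.mem_span_singleton_self w
  obtain ⟨v, hv⟩ := hw.exists_right_inv
  -- With z = y/w, the preimage of q in N is {a | az ∈ N}.
  let z : F := v * algebraMap N F y
  have hz : ∀ a d : N, a * y = w * d → algebraMap N F a * z = algebraMap N F d := fun a d h => by
    have := congrArg (algebraMap N F) h
    rw [map_mul, map_mul] at this
    linear_combination v * this + algebraMap N F d * hv
  -- If z maps an ideal containing w into itself, then z is integral, hence in N. That would put 1
  -- in q.
  have hcl' : ∀ J : Ideal N, w ∈ J → (∀ a ∈ J, ∃ d ∈ J, a * y = w * d) → False := by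
    intro J hwJ hJ
    obtain ⟨d, hd⟩ := hcl z (isIntegral_of_mul_mem_submodule (Submodule.map (Algebra.linearMap N F) J)
      ((IsNoetherian.noetherian J).map _) ⟨w, hwJ, rfl⟩ (fun y hy => hw.mul_left_eq_zero.mp hy) z (by
        rintro _ ⟨a, ha, rfl⟩
        obtain ⟨d, hdJ, hd⟩ := hJ a ha
        exact ⟨d, hdJ, by
          rw [mul_comm]
          exact (hz a d hd).symm⟩))
    refine hqp.ne_top ((Ideal.eq_top_iff_one _).mpr ?_)
    rw [← map_one f, hmem, one_mul]
    refine ⟨d, hinj ?_⟩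
    rw [map_mul, hd]
    linear_combination -algebraMap N F y * hv
  -- So z does not preserve q: some a in q has d = az outside q. Then bd = a(bz) for every b in q,
  -- so near q the ideal is generated by a alone.
  have h1 : ∃ a d : N, f a ∈ q ∧ a * y = w * d ∧ f d ∉ q := by
    by_contra! hcon
    refine hcl' (q.comap f) (by rw [Ideal.mem_comap, hw0]; exact zero_mem q) fun a ha => ?_
    obtain ⟨d, hd⟩ := (hmem a).mp ha
    exact ⟨d, hcon a d ha hd, hd⟩
  obtain ⟨a, d, ha, had, hd⟩ := h1
  refine ⟨⟨hqp, bot_le⟩, fun p ⟨hp, _⟩ hpq => ?_⟩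
  have hdiv : ∀ b e : N, b * y = w * e → a * e = b * d := fun b e hb => hinj (by
    rw [map_mul, map_mul, ← hz b e hb, ← hz a d had]
    ring)
  -- A smaller prime p missing a would be preserved by z, by the identity `hdiv`. Hence p contains
  -- a, and then all of q because d is outside q.
  have hap : f a ∈ p := by
    by_contra hap
    refine hcl' (p.comap f) (by rw [Ideal.mem_comap, hw0]; exact zero_mem p) fun b hb => ?_
    obtain ⟨e, he⟩ := (hmem b).mp (hpq hb)
    refine ⟨e, (hp.mem_or_mem (show f a * f e ∈ p from ?_)).resolve_left hap, he⟩
    rw [← map_mul, hdiv b e he, map_mul]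
    exact Ideal.mul_mem_right _ p hb
  intro c hc
  obtain ⟨b, rfl⟩ := hf c
  obtain ⟨e, he⟩ := (hmem b).mp hc
  refine (hp.mem_or_mem (show f b * f d ∈ p from ?_)).resolve_right fun h => hd (hpq h)
  rw [← map_mul, ← hdiv b e he, map_mul]
  exact Ideal.mul_mem_right _ p hap

/-- Finite-dimensional modules are supported at maximal ideals, so the kernel and the cokernel are
each killed by an element outside p. Their product serves for both. -/
theorem exists_notMem_forall_mul (k : Type*) {B B' : Type*} [Field k] [CommRing B]
    [Algebra k B] [CommRing B'] [Algebra B B'] [Algebra k B'] [IsScalarTower k B B']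
    [hker : Module.Finite k (LinearMap.ker (Algebra.linearMap B B'))]
    [hcok : Module.Finite k (B' ⧸ LinearMap.range (Algebra.linearMap B B'))]
    (p : Ideal B) [p.IsPrime] (hp : ¬ p.IsMaximal) :
    ∃ f ∉ p, (∀ y : B', ∃ b, algebraMap B B' b = f • y) ∧
      ∀ b, algebraMap B B' b = 0 → f * b = 0 := by
  obtain ⟨f, hf, hfp⟩ := Set.not_subset.mp fun h => hp (isMaximal_of_annihilator_le k
    (M := LinearMap.ker (Algebra.linearMap B B')) p h)
  obtain ⟨g, hg, hgp⟩ := Set.not_subset.mp fun h => hp (isMaximal_of_annihilator_le k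
    (M := B' ⧸ LinearMap.range (Algebra.linearMap B B')) p h)
  refine ⟨f * g, fun h => (Ideal.IsPrime.mem_or_mem ‹_› h).elim hfp hgp, fun y => ?_, fun b hb => ?_⟩
  · have := Module.mem_annihilator.mp hg (Submodule.Quotient.mk y)
    rw [← Submodule.Quotient.mk_smul, Submodule.Quotient.mk_eq_zero] at this
    obtain ⟨b, hb⟩ := this
    refine ⟨f * b, ?_⟩
    have hb : algebraMap B B' b = g • y := hb
    rw [map_mul, hb, mul_smul, Algebra.smul_def f]
  · have h0 : f * b = 0 := congrArg Subtype.val (Module.mem_annihilator.mp hf ⟨b, hb⟩)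
    linear_combination g * h0

/-- An algebra whose kernel and cokernel are finite-dimensional is reduced if it has no embedded
primes and no isolated points. -/
theorem isReduced_of_forall_isAssociatedPrime (k : Type u) {B B' : Type u} [Field k] [CommRing B]
    [IsNoetherianRing B] [Algebra k B] [CommRing B'] [Algebra B B']
    [Algebra k B'] [IsScalarTower k B B'] [Module.Finite B B']
    [hker : Module.Finite k (LinearMap.ker (Algebra.linearMap B B'))]
    [hcok : Module.Finite k (B' ⧸ LinearMap.range (Algebra.linearMap B B'))]
    (hB : HasFinitelyManyINNS k B) (hB' : NoIsolatedPoints B')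
    (hass : ∀ q : Ideal B', IsAssociatedPrime q B' → q ∈ minimalPrimes B') :
    _root_.IsReduced B' := by
  have : IsNoetherianRing B' := IsNoetherianRing.of_finite B B'
  refine ⟨fun y hy => ?_⟩
  by_contra hy0
  obtain ⟨q, hq, hle⟩ := exists_le_isAssociatedPrime_of_isNoetherianRing B' y hy0
  have hqp : q.IsPrime := hq.isPrime
  let p := q.comap (algebraMap B B')
  have hpm : ¬ p.IsMaximal := fun h =>
    hB' q (hass q hq) (Ideal.isMaximal_of_isIntegral_of_isMaximal_comap q h)
  have hpp : p.IsPrime := hqp.comap _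
  have hnorm : IsNormalDomain (Localization.AtPrime p) := by
    by_contra hn
    have : Module.Finite k p.ResidueField := (hB.2 ⟨p, hpp⟩ hn).2
    exact hpm (isMaximal_of_finite_residueField k p)
  have hred := hnorm.isNormalRing.isReduced
  obtain ⟨f, hfp, hf1, hf2⟩ := exists_notMem_forall_mul k (B' := B') p hpm
  obtain ⟨b, hb⟩ := hf1 y
  have hbn : IsNilpotent (f * b) := by
    obtain ⟨n, hn⟩ := hy
    refine ⟨n + 1, ?_⟩
    have h1 : algebraMap B B' (b ^ (n + 1)) = 0 := by
      rw [map_pow, hb, Algebra.smul_def, mul_pow, pow_succ y, hn, zero_mul, mul_zero]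
    rw [mul_pow]
    linear_combination f ^ n * hf2 _ h1
  have h0 := (hbn.map (algebraMap B (Localization.AtPrime p))).eq_zero
  obtain ⟨s, hs⟩ := (IsLocalization.map_eq_zero_iff p.primeCompl _ _).mp h0
  have hmem : algebraMap B B' (s * (f * f)) ∈ q := hle (by
    rw [Submodule.mem_colon_singleton, Submodule.mem_bot, smul_eq_mul]
    have h1 := congrArg (algebraMap B B') hs
    rw [map_mul, map_mul, hb, Algebra.smul_def, map_zero] at h1
    rw [map_mul, map_mul]
    linear_combination h1)
  have h2 : (s : B) * (f * f) ∈ p := hmem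
  exact (hpp.mem_or_mem h2).elim s.2 fun h => (hpp.mem_or_mem h).elim hfp hfp

end Associated


/-! ### The normalization of the part of dimension greater than `i` -/

section HigherPart

open nonZeroDivisors

theorem isReduced_quotient_nilradical (C : Type*) [CommRing C] :
    _root_.IsReduced (C ⧸ nilradical C) :=
  (Ideal.isRadical_iff_quotient_reduced _).mp (Ideal.radical_isRadical _)

/-- An integral equation for z lifts to F₀ with an error y in the kernel of g. An idempotent that
kills y and maps to 1 corrects any lift of z to an integral one. -/
theorem exists_isIntegral_map_eq {D₀ D F₀ F : Type*} [CommRing D₀] [_root_.IsReduced D₀]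
    [IsNoetherianRing D₀] [CommRing D] [CommRing F₀] [CommRing F] [Algebra D₀ F₀]
    [IsFractionRing D₀ F₀] [Algebra D F] [IsFractionRing D F] (π : D₀ →+* D)
    (hπ : Function.Surjective π) (g : F₀ →+* F) (hg : ∀ d, g (algebraMap D₀ F₀ d) =
      algebraMap D F (π d)) (z : F) (hz : IsIntegral D z) : ∃ w, IsIntegral D₀ w ∧ g w = z := by
  have hgs : Function.Surjective g := by
    intro y
    obtain ⟨⟨a, s⟩, h⟩ := IsLocalization.surj D⁰ y
    obtain ⟨a', ha'⟩ := hπ a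
    obtain ⟨s', hs'⟩ := hπ s
    obtain ⟨v, hv⟩ := exists_mul_mul_eq_self_of_isFractionRing D₀ (algebraMap D₀ F₀ s')
    obtain ⟨t, ht⟩ := (IsLocalization.map_units F s).exists_left_inv
    refine ⟨algebraMap D₀ F₀ a' * v, ?_⟩
    have h1 := congrArg g hv
    rw [map_mul, map_mul, hg, hs'] at h1
    rw [map_mul, hg, ha', ← h]
    linear_combination (y * t) * h1 - (y * algebraMap D F s * g v - y) * ht
  obtain ⟨x, rfl⟩ := hgs z
  obtain ⟨n, c, hc⟩ := isIntegral_iff_exists_pow_eq_sum.mp hz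
  choose c' hc' using fun i => hπ (c i)
  let y := x ^ n - ∑ i ∈ Finset.range n, algebraMap D₀ F₀ (c' i) * x ^ i
  have hy : g y = 0 := by
    simp only [y, map_sub, map_pow, map_sum, map_mul, hg, hc', hc, sub_self]
  obtain ⟨v, hv⟩ := exists_mul_mul_eq_self_of_isFractionRing D₀ y
  let f := 1 - y * v
  have hf : f * f = f := by
    simp only [f]
    linear_combination v * hv
  have hfy : f * y = 0 := by
    simp only [f]
    linear_combination -hv
  have hfp : ∀ i, f ^ (i + 1) = f := fun i => by
    induction i with
    | zero => simp
    | succ i ih => rw [pow_succ, ih, hf]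
  -- The equation is multiplied by x so that each term carries a positive power of f x, where
  -- f^(i+1) = f applies.
  refine ⟨f * x, isIntegral_iff_exists_pow_eq_sum.mpr ⟨n + 1,
    fun i => if i = 0 then 0 else c' (i - 1), ?_⟩, ?_⟩
  · rw [Finset.sum_range_succ']
    simp only [Nat.add_eq_zero_iff, one_ne_zero, and_false, if_false, Nat.add_sub_cancel, if_true,
      map_zero, zero_mul, add_zero, mul_pow, hfp]
    have h2 : ∑ i ∈ Finset.range n, algebraMap D₀ F₀ (c' i) * (f * x ^ (i + 1)) =
        f * x * ∑ i ∈ Finset.range n, algebraMap D₀ F₀ (c' i) * x ^ i := by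
      rw [Finset.mul_sum]
      exact Finset.sum_congr rfl fun i _ => by ring
    rw [h2]
    simp only [y] at hfy
    linear_combination x * hfy
  · rw [map_mul]
    simp only [f, map_sub, map_one, map_mul, hy]
    ring

theorem mem_higherIdeal_iff {R : Type u} [CommRing R] {i : ℕ} {x : R} :
    x ∈ higherIdeal R i ↔
      ∀ p ∈ minimalPrimes R, ((i : ℕ∞) : WithBot ℕ∞) < ringKrullDim (R ⧸ p) → x ∈ p := by
  rw [higherIdeal, Submodule.mem_sInf]
  exact ⟨fun h p hp hi => h p ⟨hp, hi⟩, fun h p hp => h p hp.1 hp.2⟩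

theorem isReduced_higherPart (R : Type u) [CommRing R] (i : ℕ) :
    _root_.IsReduced (HigherPart R i) := by
  refine (Ideal.isRadical_iff_quotient_reduced _).mp fun x ⟨n, hn⟩ => ?_
  exact mem_higherIdeal_iff.mpr fun p hp hi => by
    have : p.IsPrime := hp.isPrime
    exact this.mem_of_pow_mem n (mem_higherIdeal_iff.mp hn p hp hi)

theorem ker_algebraMap_normalization (R : Type u) [CommRing R] :
    RingHom.ker (algebraMap R (Normalization R)) = nilradical R := by
  ext x
  rw [RingHom.mem_ker, ← Ideal.Quotient.eq_zero_iff_mem]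
  constructor
  · intro h
    exact IsFractionRing.injective (R ⧸ nilradical R) (FractionRing (R ⧸ nilradical R))
      ((congrArg Subtype.val h).trans (map_zero _).symm)
  · intro h
    refine Subtype.ext ?_
    change algebraMap (R ⧸ nilradical R) (FractionRing (R ⧸ nilradical R))
      (Ideal.Quotient.mk _ x) = 0
    rw [h, map_zero]

theorem ker_algebraMap_normalization_higherPart (R : Type u) [CommRing R] (i : ℕ) :
    RingHom.ker (algebraMap R (Normalization (HigherPart R i))) = higherIdeal R i := by
  have := isReduced_higherPart R i
  have h : algebraMap R (Normalization (HigherPart R i)) =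
    (algebraMap (HigherPart R i) _).comp (algebraMap R (HigherPart R i)) :=
    IsScalarTower.algebraMap_eq _ _ _
  rw [h, ← RingHom.comap_ker, ker_algebraMap_normalization, nilradical_eq_zero]
  exact (RingHom.ker_eq_comap_bot _).symm.trans Ideal.mk_ker

theorem exists_mem_higherIdeal_of_mul_mem {R : Type u} [CommRing R] {i : ℕ} {s x : R}
    (hs : ∀ p ∈ minimalPrimes R, s ∉ p) (hx : s * x ∈ higherIdeal R i) : x ∈ higherIdeal R i :=
  mem_higherIdeal_iff.mpr fun p hp hi =>
    have : p.IsPrime := hp.isPrime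
    (this.mem_or_mem (mem_higherIdeal_iff.mp hx p hp hi)).resolve_left (hs p hp)

theorem mk_mem_nonZeroDivisors_higherPart {R : Type u} [CommRing R] {i : ℕ} {s : R}
    (hs : ∀ p ∈ minimalPrimes R, s ∉ p) : algebraMap R
      (HigherPart R i ⧸ nilradical (HigherPart R i)) s ∈
        (HigherPart R i ⧸ nilradical (HigherPart R i))⁰ := by
  have := isReduced_higherPart R i
  have hinj : ∀ x : R, algebraMap R (HigherPart R i ⧸ nilradical (HigherPart R i)) x = 0 ↔
      x ∈ higherIdeal R i := fun x => by
    rw [IsScalarTower.algebraMap_apply R (HigherPart R i)]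
    refine Ideal.Quotient.eq_zero_iff_mem.trans ?_
    rw [nilradical_eq_zero]
    exact Ideal.Quotient.eq_zero_iff_mem
  refine mem_nonZeroDivisors_iff_right.mpr fun x hx => ?_
  obtain ⟨x, rfl⟩ := Ideal.Quotient.mk_surjective x
  obtain ⟨x, rfl⟩ := Ideal.Quotient.mk_surjective x
  refine (hinj x).mpr (exists_mem_higherIdeal_of_mul_mem hs ((hinj _).mp ?_))
  rw [map_mul, mul_comm]
  exact hx

/-- The map from the normalization of `R` to that of `R^{>i}` is surjective. -/
theorem finite_coker_normalization_higherPart (A R : Type u) [CommRing A] [CommRing R] [Algebra A R]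
    [IsNoetherianRing R] (i : ℕ) [Module.Finite A (NormalizationCoker A R)] :
    Module.Finite A (Normalization (HigherPart R i) ⧸ LinearMap.range
      (IsScalarTower.toAlgHom A R (Normalization (HigherPart R i))).toLinearMap) := by
  let D₀ := R ⧸ nilradical R
  let D := HigherPart R i ⧸ nilradical (HigherPart R i)
  let F₀ := FractionRing D₀
  let F := FractionRing D
  have := isReduced_quotient_nilradical R
  have hDred : _root_.IsReduced D := isReduced_quotient_nilradical (HigherPart R i)
  let π : D₀ →+* D := Ideal.Quotient.lift (nilradical R) (algebraMap R D) fun x hx =>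
    ((mem_nilradical.mp hx).map (algebraMap R D)).eq_zero
  have hπ : Function.Surjective π := by
    intro x
    obtain ⟨x, rfl⟩ := Ideal.Quotient.mk_surjective x
    obtain ⟨x, rfl⟩ := Ideal.Quotient.mk_surjective x
    exact ⟨Ideal.Quotient.mk _ x, rfl⟩
  have hle : D₀⁰ ≤ D⁰.comap π := by
    intro s hs
    obtain ⟨s, rfl⟩ := Ideal.Quotient.mk_surjective s
    refine mk_mem_nonZeroDivisors_higherPart fun p hp hsp => ?_
    have hp' : p ∈ (nilradical R).minimalPrimes := by
      rw [nilradical, Ideal.radical_minimalPrimes]; exact hp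
    obtain ⟨y, hy, hsy⟩ := Ideal.exists_mul_mem_of_mem_minimalPrimes hp' hsp
    refine hy (Ideal.Quotient.eq_zero_iff_mem.mp ((mem_nonZeroDivisors_iff_right.mp hs) _ ?_))
    rw [← map_mul, mul_comm]
    exact Ideal.Quotient.eq_zero_iff_mem.mpr hsy
  let g : F₀ →+* F := IsLocalization.map F π hle
  have hg : ∀ d, g (algebraMap D₀ F₀ d) = algebraMap D F (π d) := IsLocalization.map_eq hle
  let G : Normalization R →ₗ[A] Normalization (HigherPart R i) :=
    { toFun := fun z => ⟨g z, by
        obtain ⟨p, hp, hpz⟩ := z.2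
        refine ⟨p.map π, hp.map π, ?_⟩
        rw [Polynomial.eval₂_map]
        have h1 := congrArg g hpz
        rw [Polynomial.hom_eval₂, map_zero] at h1
        rw [← h1]
        congr 1
        ext d
        exact (hg _).symm⟩
      map_add' := fun x y => Subtype.ext (map_add g x.1 y.1)
      map_smul' := fun a x => Subtype.ext (by
        change g (a • x.1) = a • g x.1
        rw [Algebra.smul_def, Algebra.smul_def, map_mul, IsScalarTower.algebraMap_apply A D₀ F₀, hg,
          IsScalarTower.algebraMap_apply A D F]
        rfl) }
  have hG : Function.Surjective G := by
    rintro ⟨z, hz⟩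
    obtain ⟨w, hw, rfl⟩ := exists_isIntegral_map_eq π hπ g hg z hz
    exact ⟨⟨w, hw⟩, rfl⟩
  refine Module.Finite.of_surjective (Submodule.mapQ (LinearMap.range
    (IsScalarTower.toAlgHom A R (Normalization R)).toLinearMap) _ G ?_) ?_
  · rintro _ ⟨r, rfl⟩
    exact ⟨r, Subtype.ext (hg (Ideal.Quotient.mk _ r)).symm⟩
  · intro y
    obtain ⟨y, rfl⟩ := Submodule.mkQ_surjective _ y
    obtain ⟨x, rfl⟩ := hG y
    exact ⟨Submodule.Quotient.mk x, rfl⟩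

/-- Nonzero elements of A are nonzerodivisors on the flat algebra R, while minimal primes consist of
zero divisors. -/
theorem notMem_of_mem_minimalPrimes_of_flat {A R : Type*} [CommRing A] [IsDomain A] [CommRing R]
    [Algebra A R] [Module.Flat A R] {a : A} (ha : a ≠ 0) {p : Ideal R} (hp : p ∈ minimalPrimes R) :
    algebraMap A R a ∉ p := fun h => by
  refine notMem_nonZeroDivisors_of_mem_mem_minimalPrimes h hp ?_
  refine mem_nonZeroDivisors_iff_right.mpr fun x hx => ?_
  rw [mul_comm, ← Algebra.smul_def] at hx
  exact (Module.Flat.isSMulRegular_of_nonZeroDivisors (mem_nonZeroDivisors_of_ne_zero ha))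
    (hx.trans (smul_zero a).symm)

theorem isUnit_algebraMap_fractionRing_higherPart {A : Type u} (R : Type u) [CommRing A] [IsDomain A]
    [CommRing R] [Algebra A R] [Module.Flat A R] (i : ℕ) {a : A} (ha : a ≠ 0) :
    IsUnit (algebraMap A (FractionRing (HigherPart R i ⧸ nilradical (HigherPart R i))) a) := by
  have := mk_mem_nonZeroDivisors_higherPart (i := i) fun p hp =>
    notMem_of_mem_minimalPrimes_of_flat (R := R) ha hp
  exact IsLocalization.map_units (FractionRing (HigherPart R i ⧸ nilradical (HigherPart R i)))
    (⟨_, this⟩ : (HigherPart R i ⧸ nilradical (HigherPart R i))⁰)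

theorem flat_normalization_higherPart (A R : Type u) [CommRing A] [IsDomain A]
    [IsPrincipalIdealRing A] [CommRing R] [Algebra A R] [Module.Flat A R] (i : ℕ) :
    Module.Flat A (Normalization (HigherPart R i)) := by
  have : Module.IsTorsionFree A (Normalization (HigherPart R i)) := by
    refine ⟨fun a ha x y hxy => Subtype.ext ?_⟩
    refine (isUnit_algebraMap_fractionRing_higherPart R i ha.ne_zero).mul_left_cancel ?_
    rw [← Algebra.smul_def, ← Algebra.smul_def]
    exact congrArg Subtype.val hxy
  infer_instance

theorem finite_of_finite_coker (A : Type*) {R N : Type*} [CommRing A] [CommRing R] [CommRing N]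
    [Algebra A R] [Algebra R N] [Algebra A N] [IsScalarTower A R N]
    [h : Module.Finite A (N ⧸ LinearMap.range (IsScalarTower.toAlgHom A R N).toLinearMap)] :
    Module.Finite R N := by
  let V : Submodule R N := LinearMap.range (Algebra.linearMap R N)
  have hV : Module.Finite R V := inferInstance
  have : Module.Finite A (N ⧸ V.restrictScalars A) := h
  have h1 : Module.Finite A (N ⧸ V) :=
    Module.Finite.equiv (Submodule.Quotient.restrictScalarsEquiv A V)
  have h2 : Module.Finite R (N ⧸ V) := Module.Finite.of_restrictScalars_finite A R _
  exact Module.Finite.of_submodule_quotient V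

theorem exists_algebraMap_eq_of_isIntegral_normalization (C : Type u) [CommRing C]
    (z : FractionRing (C ⧸ nilradical C)) (hz : IsIntegral (Normalization C) z) :
    ∃ d : Normalization C, algebraMap (Normalization C) (FractionRing (C ⧸ nilradical C)) d = z :=
  ⟨⟨z, isIntegral_trans z hz⟩, rfl⟩

theorem isNormalRing_normalization (C : Type u) [CommRing C] [IsNoetherianRing C] :
    IsNormalRing (Normalization C) := by
  have := isReduced_quotient_nilradical C
  have := isReduced_of_isFractionRing (C ⧸ nilradical C) (F := FractionRing (C ⧸ nilradical C))
  exact IsNormalRing.of_isIntegrallyClosedIn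
    (exists_mul_mul_eq_self_of_isFractionRing (C ⧸ nilradical C)) Subtype.val_injective
    (exists_algebraMap_eq_of_isIntegral_normalization C)

end HigherPart


/-! ### Fibres over a principal ideal domain -/

section Fiber

open TensorProduct nonZeroDivisors

variable {A : Type u} [CommRing A]

/-- Fibres are localizations of quotients of R. In this form of denominator clearing, Noetherianity
and the finiteness of normalization pass from R to the fibres. -/
theorem exists_includeRight_eq_mul (R : Type u) [CommRing R] [Algebra A R] (p : PrimeSpectrum A)
    (x : p.asIdeal.Fiber R) : ∃ r : R, IsUnit (1 ⊗ₜ[A] r : p.asIdeal.Fiber R) ∧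
      ∃ s : R, (1 ⊗ₜ[A] s : p.asIdeal.Fiber R) = (1 ⊗ₜ[A] r) * x := by
  obtain ⟨r, hr, s, hs⟩ := Ideal.Fiber.exists_smul_eq_one_tmul p.asIdeal x
  have hr0 : algebraMap A p.asIdeal.ResidueField r ≠ 0 := by simpa using hr
  have h1 : (1 ⊗ₜ[A] algebraMap A R r : p.asIdeal.Fiber R) =
      algebraMap p.asIdeal.ResidueField _ (algebraMap A p.asIdeal.ResidueField r) := by
    rw [← IsScalarTower.algebraMap_apply]
    exact ((Algebra.TensorProduct.includeRight : R →ₐ[A] p.asIdeal.Fiber R).commutes r)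
  refine ⟨algebraMap A R r, ?_, s, ?_⟩
  · rw [h1]
    exact hr0.isUnit.map _
  · rw [h1, ← hs, Algebra.smul_def, ← IsScalarTower.algebraMap_apply]

theorem isNoetherianRing_fiber (R : Type u) [CommRing R] [Algebra A R] [IsNoetherianRing R]
    (p : PrimeSpectrum A) : IsNoetherianRing (p.asIdeal.Fiber R) := by
  refine (isNoetherianRing_iff_ideal_fg _).mpr fun J => ?_
  let f := (Algebra.TensorProduct.includeRight : R →ₐ[A] p.asIdeal.Fiber R)
  have hJ : (J.comap f).map f = J := by
    refine le_antisymm Ideal.map_comap_le fun x hx => ?_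
    obtain ⟨r, hr, s, hs⟩ := exists_includeRight_eq_mul R p x
    have h2 : s ∈ J.comap f := show (1 ⊗ₜ[A] s : p.asIdeal.Fiber R) ∈ J by
      rw [hs]
      exact Ideal.mul_mem_left _ _ hx
    exact (Ideal.unit_mul_mem_iff_mem _ hr).mp (hs ▸ Ideal.mem_map_of_mem f h2)
  rw [← hJ]
  exact ((isNoetherianRing_iff_ideal_fg R).mp inferInstance _).map f.toRingHom

theorem includeRight_surjective (N : Type u) [CommRing N] [Algebra A N] (p : PrimeSpectrum A)
    [p.asIdeal.IsMaximal] :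
    Function.Surjective (Algebra.TensorProduct.includeRight : N →ₐ[A] p.asIdeal.Fiber N) :=
  TensorProduct.mk_surjective _ _ _ (Ideal.algebraMap_residueField_surjective p.asIdeal)

theorem ker_includeRight (N : Type u) [CommRing N] [Algebra A N] (p : PrimeSpectrum A)
    [p.asIdeal.IsMaximal] {w : A} (hw : p.asIdeal = Ideal.span {w}) :
    RingHom.ker (Algebra.TensorProduct.includeRight : N →ₐ[A] p.asIdeal.Fiber N) =
      Ideal.span {algebraMap A N w} := by
  ext x
  rw [RingHom.mem_ker, Ideal.mem_span_singleton]
  constructor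
  · intro h
    have hex : Function.Exact (LinearMap.mulLeft A w)
        (Algebra.linearMap A p.asIdeal.ResidueField) := by
      intro y
      rw [Algebra.linearMap_apply, Ideal.algebraMap_residueField_eq_zero, hw,
        Ideal.mem_span_singleton]
      exact ⟨fun ⟨c, hc⟩ => ⟨c, hc.symm⟩, fun ⟨c, hc⟩ => ⟨c, hc.symm⟩⟩
    have h1 := rTensor_exact N hex (Ideal.algebraMap_residueField_surjective p.asIdeal)
    obtain ⟨u, hu⟩ := (h1 (1 ⊗ₜ x)).mp (by
      rw [LinearMap.rTensor_tmul, Algebra.linearMap_apply, map_one]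
      exact h)
    have h2 := congrArg (TensorProduct.lid A N) hu
    obtain ⟨y, rfl⟩ : ∃ y : N, u = 1 ⊗ₜ y := ⟨TensorProduct.lid A N u, by
      rw [← TensorProduct.lid_symm_apply, LinearEquiv.symm_apply_apply]⟩
    refine ⟨y, ?_⟩
    simpa [Algebra.smul_def] using h2.symm
  · rintro ⟨y, rfl⟩
    have hw0 : algebraMap A p.asIdeal.ResidueField w = 0 := by
      rw [Ideal.algebraMap_residueField_eq_zero, hw]
      exact Ideal.mem_span_singleton_self w
    rw [map_mul, AlgHom.commutes, IsScalarTower.algebraMap_apply A p.asIdeal.ResidueField, hw0,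
      map_zero, zero_mul]

theorem IsNormalRing.fiber_bot [IsDomain A] {N : Type u} [CommRing N] [Algebra A N]
    (h : IsNormalRing N) {p : PrimeSpectrum A} (hp : p.asIdeal = ⊥) :
    IsNormalRing (p.asIdeal.Fiber N) := by
  obtain ⟨p, hpp⟩ := p
  subst hp
  let : Algebra N ((⊥ : Ideal A).Fiber N) := Algebra.TensorProduct.rightAlgebra
  exact h.of_isLocalization (Algebra.algebraMapSubmonoid N A⁰) _

theorem finite_fiberAlgHom {R N : Type u} [CommRing R] [Algebra A R] [CommRing N] [Algebra A N]
    (φ : R →ₐ[A] N) (hφ : φ.toRingHom.Finite) (p : PrimeSpectrum A) :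
    (fiberAlgHom p φ).toRingHom.Finite := by
  let : Algebra R N := φ.toRingHom.toAlgebra
  let : Algebra (p.asIdeal.Fiber R) (p.asIdeal.Fiber N) := (fiberAlgHom p φ).toRingHom.toAlgebra
  have h1 : Module.Finite R N := hφ
  obtain ⟨n, c, hc⟩ := h1.exists_fin
  change Module.Finite (p.asIdeal.Fiber R) (p.asIdeal.Fiber N)
  refine ⟨Submodule.fg_def.mpr ⟨Set.range fun i => (1 ⊗ₜ[A] c i : p.asIdeal.Fiber N),
    Set.finite_range _, eq_top_iff.mpr fun x _ => ?_⟩⟩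
  induction x using TensorProduct.induction_on with
  | zero => exact zero_mem _
  | add x y hx hy => exact add_mem (hx trivial) (hy trivial)
  | tmul x y =>
    have hy : y ∈ Submodule.span R (Set.range c) := by rw [hc]; trivial
    obtain ⟨a, rfl⟩ := (Submodule.mem_span_range_iff_exists_fun R).mp hy
    rw [TensorProduct.tmul_sum]
    refine Submodule.sum_mem _ fun i _ => ?_
    have h2 : (x ⊗ₜ[A] (a i • c i) : p.asIdeal.Fiber N) =
        (x ⊗ₜ[A] a i : p.asIdeal.Fiber R) • (1 ⊗ₜ[A] c i : p.asIdeal.Fiber N) := by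
      rw [Algebra.smul_def, Algebra.smul_def]
      change _ = fiberAlgHom p φ (x ⊗ₜ[A] a i) * _
      rw [Algebra.TensorProduct.map_tmul, Algebra.TensorProduct.tmul_mul_tmul, mul_one]
      rfl
    rw [h2]
    exact Submodule.smul_mem _ _ (Submodule.subset_span ⟨i, rfl⟩)

end Fiber


/-! ### Constancy of the delta invariant -/

section DeltaConstant

open TensorProduct nonZeroDivisors

theorem finite_normalization_localization_fiber (A R : Type u) [CommRing A] [CommRing R] [Algebra A R]
    (hNagata : IsNagata R) (p : PrimeSpectrum A)
    (m : Ideal (p.asIdeal.Fiber R)) [m.IsPrime] :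
    Module.Finite (Localization.AtPrime m) (Normalization (Localization.AtPrime m)) := by
  have := hNagata.1
  have := isNoetherianRing_fiber R p
  refine finite_normalization_of_isNagata hNagata ((algebraMap (p.asIdeal.Fiber R)
    (Localization.AtPrime m)).comp (Algebra.TensorProduct.includeRight :
      R →ₐ[A] p.asIdeal.Fiber R).toRingHom) fun b => ?_
  obtain ⟨⟨x, s⟩, hb⟩ := IsLocalization.surj m.primeCompl b
  obtain ⟨r, hr, x', hx'⟩ := exists_includeRight_eq_mul R p x
  obtain ⟨t, ht, s', hs'⟩ := exists_includeRight_eq_mul R p s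
  let f := algebraMap (p.asIdeal.Fiber R) (Localization.AtPrime m)
  refine ⟨r * s', ?_, t * x', ?_⟩
  · change IsUnit (f (1 ⊗ₜ (r * s')))
    rw [← one_mul (1 : p.asIdeal.ResidueField), ← Algebra.TensorProduct.tmul_mul_tmul, hs', map_mul,
      map_mul]
    exact (hr.map f).mul ((ht.map f).mul (IsLocalization.map_units _ s))
  · change f (1 ⊗ₜ (t * x')) = f (1 ⊗ₜ (r * s')) * b
    rw [← one_mul (1 : p.asIdeal.ResidueField), ← Algebra.TensorProduct.tmul_mul_tmul,
      ← Algebra.TensorProduct.tmul_mul_tmul, hs', hx']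
    simp only [map_mul]
    rw [← hb]
    ring

variable (A R : Type u) [CommRing A] [IsDomain A] [IsPrincipalIdealRing A] [CommRing R] [Algebra A R]
  [Module.Flat A R]

/-- The generic fibre is a localization of the normal ring N. A closed fibre is N/wN with w
invertible in the total ring of fractions, so it has no embedded primes. -/
theorem isReduced_fiber_normalization_higherPart [IsNoetherianRing R] (i : ℕ)
    [Module.Finite R (Normalization (HigherPart R i))] (p : PrimeSpectrum A)
    (hB : HasFinitelyManyINNS p.asIdeal.ResidueField (p.asIdeal.Fiber R))
    (hIso : NoIsolatedPoints (p.asIdeal.Fiber (Normalization (HigherPart R i))))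
    [Algebra (p.asIdeal.Fiber R) (p.asIdeal.Fiber (Normalization (HigherPart R i)))]
    [IsScalarTower p.asIdeal.ResidueField (p.asIdeal.Fiber R)
      (p.asIdeal.Fiber (Normalization (HigherPart R i)))]
    [Module.Finite (p.asIdeal.Fiber R) (p.asIdeal.Fiber (Normalization (HigherPart R i)))]
    [Module.Finite p.asIdeal.ResidueField (LinearMap.ker (Algebra.linearMap (p.asIdeal.Fiber R)
      (p.asIdeal.Fiber (Normalization (HigherPart R i)))))]
    [Module.Finite p.asIdeal.ResidueField (p.asIdeal.Fiber (Normalization (HigherPart R i)) ⧸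
      LinearMap.range (Algebra.linearMap (p.asIdeal.Fiber R)
      (p.asIdeal.Fiber (Normalization (HigherPart R i)))))] :
    _root_.IsReduced (p.asIdeal.Fiber (Normalization (HigherPart R i))) := by
  let N := Normalization (HigherPart R i)
  by_cases hp : p.asIdeal = ⊥
  · exact ((isNormalRing_normalization (HigherPart R i)).fiber_bot hp).isReduced
  · have : p.asIdeal.IsMaximal := IsPrime.to_maximal_ideal hp
    have : IsNoetherianRing (p.asIdeal.Fiber R) := isNoetherianRing_fiber R p
    have : IsNoetherianRing N := IsNoetherianRing.of_finite R N
    let w := Submodule.IsPrincipal.generator p.asIdeal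
    have hw : p.asIdeal = Ideal.span {w} := (Ideal.span_singleton_generator _).symm
    have hw0 : w ≠ 0 := fun h => hp (by rw [hw, h, Ideal.span_singleton_eq_bot])
    refine isReduced_of_forall_isAssociatedPrime p.asIdeal.ResidueField (B := p.asIdeal.Fiber R) hB
      hIso fun q hq => ?_
    refine mem_minimalPrimes_of_isAssociatedPrime (N := N)
      (F := FractionRing (HigherPart R i ⧸ nilradical (HigherPart R i))) Subtype.val_injective
      (exists_algebraMap_eq_of_isIntegral_normalization _)
      (Algebra.TensorProduct.includeRight : N →ₐ[A] p.asIdeal.Fiber N).toRingHom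
      (includeRight_surjective N p) (algebraMap A N w) ?_ (ker_includeRight N p hw) hq
    exact isUnit_algebraMap_fractionRing_higherPart R i hw0

/-- The delta invariant of the fibres is constant if and only if the fibres of the normalization
are normal. -/
theorem deltaConstant_iff (hNagata : IsNagata R)
    (hCoker : Module.Finite A (NormalizationCoker A R))
    (hKer : Module.Finite A
      (RingHom.ker (algebraMap R (Normalization (HigherPart R 1)))))
    (hFib : ∀ p ∈ Set.range (PrimeSpectrum.comap (algebraMap A R)),
      HasFinitelyManyINNS p.asIdeal.ResidueField (p.asIdeal.Fiber R))
    (hIso : ∀ p : PrimeSpectrum A,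
      NoIsolatedPoints (p.asIdeal.Fiber (Normalization (HigherPart R 1)))) :
    DeltaConstant A R ↔
      ∀ p : PrimeSpectrum A, IsNormalRing (p.asIdeal.Fiber (Normalization (HigherPart R 1))) := by
  let N := Normalization (HigherPart R 1)
  have := hNagata.1
  have := finite_coker_normalization_higherPart A R 1
  have hRN : Module.Finite R N := finite_of_finite_coker A
  have : Module.Finite A (LinearMap.ker (IsScalarTower.toAlgHom A R N).toLinearMap) := hKer
  have : Module.Flat A N := flat_normalization_higherPart A R 1
  let φ := IsScalarTower.toAlgHom A R N
  obtain ⟨χ, hχ⟩ := exists_finrank_coker_sub_finrank_ker_eq A φ.toLinearMap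
  have key : ∀ p : PrimeSpectrum A, ∃ e : ℕ,
      delta p.asIdeal.ResidueField (p.asIdeal.Fiber R) = χ + e ∧
        (e = 0 ↔ IsNormalRing (p.asIdeal.Fiber N)) := by
    intro p
    let k := p.asIdeal.ResidueField
    let B := p.asIdeal.Fiber R
    let B' := p.asIdeal.Fiber N
    let : Algebra B B' := (fiberAlgHom p φ).toRingHom.toAlgebra
    have : IsScalarTower k B B' := IsScalarTower.of_algebraMap_eq fun x =>
      ((fiberAlgHom p φ).commutes x).symm
    have : Module.Finite B B' := finite_fiberAlgHom φ (RingHom.finite_algebraMap.mpr hRN) p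
    obtain ⟨h1, h2, h3⟩ := hχ k
    let ek : LinearMap.ker (φ.toLinearMap.baseChange k) ≃ₗ[k]
        LinearMap.ker (Algebra.linearMap B B') :=
      (Submodule.restrictScalarsEquiv k B B (LinearMap.ker (Algebra.linearMap B B'))).restrictScalars k
    let ec : (B' ⧸ LinearMap.range (φ.toLinearMap.baseChange k)) ≃ₗ[k]
        B' ⧸ LinearMap.range (Algebra.linearMap B B') :=
      Submodule.Quotient.restrictScalarsEquiv k (LinearMap.range (Algebra.linearMap B B'))
    have : Module.Finite k (LinearMap.ker (Algebra.linearMap B B')) := Module.Finite.equiv ek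
    have : Module.Finite k (B' ⧸ LinearMap.range (Algebra.linearMap B B')) :=
      Module.Finite.equiv ec
    -- Over points outside the image the fibre is empty and the condition is vacuous.
    have hB : HasFinitelyManyINNS k B := by
      by_cases hp : p ∈ Set.range (PrimeSpectrum.comap (algebraMap A R))
      · exact hFib p hp
      · have hemp : IsEmpty (PrimeSpectrum B) :=
          ⟨fun q => hp ⟨_, (PrimeSpectrum.preimageOrderIsoFiber A R p |>.symm q).2⟩⟩
        exact ⟨Set.toFinite _, fun q => hemp.elim q⟩
    have := isReduced_fiber_normalization_higherPart A R 1 p hB (hIso p)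
    have := isNoetherianRing_fiber R p
    obtain ⟨e, he, he0⟩ := exists_delta_eq k (B := B) (B' := B') hB (hIso p) fun m =>
      finite_normalization_localization_fiber A R hNagata p m.asIdeal
    refine ⟨e, ?_, he0⟩
    rw [he, ← h3, ek.finrank_eq, ec.finrank_eq]
  choose e he he0 using key
  -- The generic fibre is always normal, which pins the constant value of δ to χ.
  have h0 : e ⊥ = 0 := (he0 ⊥).mpr ((isNormalRing_normalization (HigherPart R 1)).fiber_bot rfl)
  constructor
  · intro h p
    refine (he0 p).mp ?_
    have := h p ⊥
    rw [he, he, h0] at this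
    omega
  · intro h p q
    rw [he, he, (he0 p).mpr (h p), (he0 q).mpr (h q)]

end DeltaConstant


/-! ### Birational homomorphisms -/

section Birational

open TensorProduct nonZeroDivisors

theorem le_of_comap_le_of_forall_smul {B B' : Type*} [CommRing B] [CommRing B'] [Algebra B B']
    {f : B} (hf : ∀ y : B', ∃ b, algebraMap B B' b = f • y) {q q' : Ideal B'} [q'.IsPrime]
    (hfq : algebraMap B B' f ∉ q')
    (h : q.comap (algebraMap B B') ≤ q'.comap (algebraMap B B')) : q ≤ q' := by
  intro y hy
  obtain ⟨b, hb⟩ := hf y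
  have h1 : b ∈ q'.comap (algebraMap B B') := h (by
    rw [Ideal.mem_comap, hb, Algebra.smul_def]
    exact q.mul_mem_left _ hy)
  rw [Ideal.mem_comap, hb, Algebra.smul_def] at h1
  exact (Ideal.IsPrime.mem_or_mem ‹_› h1).resolve_left hfq

/-- Multiplication by f carries B' into the image of B and kills the kernel, so B and B' become
equal wherever f is invertible. -/
theorem localRingHom_bijective_of_forall_smul {B B' : Type*} [CommRing B] [CommRing B']
    [Algebra B B'] {f : B} (hf : ∀ y : B', ∃ b, algebraMap B B' b = f • y)
    (hf0 : ∀ b, algebraMap B B' b = 0 → f * b = 0) (P : Ideal B) [P.IsPrime] (q : Ideal B')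
    [q.IsPrime] (h : P = q.comap (algebraMap B B')) (hfq : algebraMap B B' f ∉ q) :
    Function.Bijective (Localization.localRingHom P q (algebraMap B B') h) := by
  subst h
  have hlift : ∀ c ∉ q, ∃ v, v ∈ (q.comap (algebraMap B B')).primeCompl ∧
      algebraMap B B' v = f • c := fun c hc => by
    obtain ⟨v, hv⟩ := hf c
    refine ⟨v, fun h => ?_, hv⟩
    have h : algebraMap B B' v ∈ q := h
    rw [hv, Algebra.smul_def] at h
    exact (Ideal.IsPrime.mem_or_mem ‹_› h).elim hfq hc
  constructor
  · refine (injective_iff_map_eq_zero _).mpr fun x hx => ?_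
    obtain ⟨x, s, rfl⟩ := IsLocalization.exists_mk'_eq (q.comap (algebraMap B B')).primeCompl x
    rw [Localization.localRingHom_mk', IsLocalization.mk'_eq_zero_iff] at hx
    obtain ⟨c, hc⟩ := hx
    obtain ⟨v, hv, hvc⟩ := hlift c c.2
    rw [IsLocalization.mk'_eq_zero_iff]
    refine ⟨⟨f, hfq⟩ * ⟨v, hv⟩, ?_⟩
    change f * v * x = 0
    rw [mul_assoc]
    refine hf0 _ ?_
    rw [map_mul, hvc, smul_mul_assoc, hc, smul_zero]
  · intro z
    obtain ⟨y, c, rfl⟩ := IsLocalization.exists_mk'_eq q.primeCompl z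
    obtain ⟨v, hv, hvc⟩ := hlift c c.2
    obtain ⟨u, hu⟩ := hf y
    refine ⟨IsLocalization.mk' _ u ⟨v, hv⟩, ?_⟩
    rw [Localization.localRingHom_mk', IsLocalization.mk'_eq_iff_eq]
    simp only [hu, hvc, Algebra.smul_def]
    congr 1
    ring

/-- An integral homomorphism of algebras over a field with finite kernel and cokernel is
birational if its target has no isolated points. -/
theorem isBirationalHom_of_finite (k : Type*) {B B' : Type*} [Field k] [CommRing B]
    [Algebra k B] [CommRing B'] [Algebra B B'] [Algebra k B'] [IsScalarTower k B B']
    [Algebra.IsIntegral B B']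
    [Module.Finite k (LinearMap.ker (Algebra.linearMap B B'))]
    [Module.Finite k (B' ⧸ LinearMap.range (Algebra.linearMap B B'))]
    (hsurj : Function.Surjective (PrimeSpectrum.comap (algebraMap B B')))
    (hB' : ∀ p ∈ minimalPrimes B', ¬ p.IsMaximal) :
    IsBirationalHom (algebraMap B B') := by
  -- A minimal prime of B' is not maximal, so by integrality neither is its contraction. The
  -- finite-dimensional discrepancy is therefore invisible there.
  have key : ∀ q : PrimeSpectrum B', q.asIdeal ∈ minimalPrimes B' →
      ∃ f, algebraMap B B' f ∉ q.asIdeal ∧ (∀ y : B', ∃ b, algebraMap B B' b = f • y) ∧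
        ∀ b, algebraMap B B' b = 0 → f * b = 0 := by
    intro q hq
    obtain ⟨f, h1, h2, h3⟩ := exists_notMem_forall_mul k (B' := B')
      (PrimeSpectrum.comap (algebraMap B B') q).asIdeal fun h =>
        hB' _ hq (Ideal.isMaximal_of_isIntegral_of_isMaximal_comap q.asIdeal h)
    exact ⟨f, h1, h2, h3⟩
  refine ⟨⟨fun q hq => ?_, fun q hq q' hq' h => ?_, fun p hp => ?_⟩, fun q hq => ?_⟩
  · obtain ⟨f, hfq, hf, -⟩ := key q hq
    refine ⟨⟨(PrimeSpectrum.comap (algebraMap B B') q).2, bot_le⟩, fun P hP hle => ?_⟩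
    obtain ⟨q₀, hq₀⟩ := hsurj ⟨P, hP.1⟩
    have hP' : q₀.asIdeal.comap (algebraMap B B') = P := congrArg PrimeSpectrum.asIdeal hq₀
    have h1 : q₀.asIdeal ≤ q.asIdeal := le_of_comap_le_of_forall_smul hf hfq (hP' ▸ hle)
    rw [← hP']
    exact Ideal.comap_mono (hq.2 ⟨q₀.2, bot_le⟩ h1)
  · obtain ⟨f, hfq, hf, -⟩ := key q hq
    have h1 : q'.asIdeal.comap (algebraMap B B') = q.asIdeal.comap (algebraMap B B') :=
      congrArg PrimeSpectrum.asIdeal h.symm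
    have h2 : q'.asIdeal ≤ q.asIdeal := le_of_comap_le_of_forall_smul hf hfq h1.le
    exact PrimeSpectrum.ext (le_antisymm (hq.2 hq'.1 h2) h2)
  · obtain ⟨q, rfl⟩ := hsurj p
    obtain ⟨q₀, hq₀, hle⟩ := Ideal.exists_minimalPrimes_le (I := ⊥) (J := q.asIdeal) bot_le
    refine ⟨⟨q₀, hq₀.isPrime⟩, hq₀, PrimeSpectrum.ext ?_⟩
    have h1 : q₀.comap (algebraMap B B') ≤ q.asIdeal.comap (algebraMap B B') :=
      Ideal.comap_mono hle
    have := hq₀.isPrime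
    exact le_antisymm h1 (hp.2 ⟨Ideal.IsPrime.comap _, bot_le⟩ h1)
  · obtain ⟨f, hfq, hf, hf0⟩ := key q hq
    exact localRingHom_bijective_of_forall_smul hf hf0 _ q.asIdeal rfl hfq

theorem comap_fiberAlgHom_surjective {A R N : Type u} [CommRing A] [CommRing R] [Algebra A R]
    [CommRing N] [Algebra A N] (φ : R →ₐ[A] N)
    (hφ : Function.Surjective (PrimeSpectrum.comap φ.toRingHom)) (p : PrimeSpectrum A) :
    Function.Surjective (PrimeSpectrum.comap (fiberAlgHom p φ).toRingHom) := by
  intro q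
  let P := (PrimeSpectrum.preimageOrderIsoFiber A R p).symm q
  obtain ⟨Q, hQ⟩ := hφ P.1
  have hQp : PrimeSpectrum.comap (algebraMap A N) Q = p := by
    rw [← P.2, ← hQ, ← PrimeSpectrum.comap_comp_apply]
    congr 1
    exact φ.comp_algebraMap.symm
  refine ⟨PrimeSpectrum.preimageOrderIsoFiber A N p ⟨Q, hQp⟩, ?_⟩
  apply (PrimeSpectrum.preimageOrderIsoFiber A R p).symm.injective
  refine Subtype.ext ?_
  change PrimeSpectrum.comap _ (PrimeSpectrum.comap _ _) = P.1
  have h1 := congrArg Subtype.val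
    ((PrimeSpectrum.preimageOrderIsoFiber A N p).symm_apply_apply ⟨Q, hQp⟩)
  refine Eq.trans ?_ ((congrArg (PrimeSpectrum.comap φ.toRingHom) h1).trans hQ)
  change _ = PrimeSpectrum.comap _ (PrimeSpectrum.comap _ _)
  rw [← PrimeSpectrum.comap_comp_apply, ← PrimeSpectrum.comap_comp_apply]
  congr 1

theorem comap_surjective_of_ker_le_nilradical {R N : Type*} [CommRing R] [CommRing N] [Algebra R N]
    [Algebra.IsIntegral R N] (h : RingHom.ker (algebraMap R N) ≤ nilradical R) :
    Function.Surjective (PrimeSpectrum.comap (algebraMap R N)) := by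
  intro P
  obtain ⟨Q, -, hQ, hQP⟩ := Ideal.exists_ideal_over_prime_of_isIntegral P.asIdeal (⊥ : Ideal N)
    (by
      rw [← RingHom.ker_eq_comap_bot]
      exact h.trans (nilradical_le_prime _))
  exact ⟨⟨Q, hQ⟩, PrimeSpectrum.ext hQP⟩

theorem isFiberwiseNormalizationHom_of_isNormalRing (A R N : Type u) [CommRing A] [IsDomain A]
    [IsPrincipalIdealRing A] [CommRing R] [Algebra A R] [Module.Flat A R] [CommRing N]
    [Algebra A N] [Module.Flat A N] [Algebra R N] [IsScalarTower A R N]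
    [Module.Finite A (LinearMap.ker (IsScalarTower.toAlgHom A R N).toLinearMap)]
    [Module.Finite A (N ⧸ LinearMap.range (IsScalarTower.toAlgHom A R N).toLinearMap)]
    (hker : RingHom.ker (algebraMap R N) ≤ nilradical R)
    (hIso : ∀ p : PrimeSpectrum A, NoIsolatedPoints (p.asIdeal.Fiber N))
    (hN : ∀ p : PrimeSpectrum A, IsNormalRing (p.asIdeal.Fiber N)) :
    IsFiberwiseNormalizationHom (IsScalarTower.toAlgHom A R N) := by
  let φ := IsScalarTower.toAlgHom A R N
  have hRN : Module.Finite R N := finite_of_finite_coker A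
  have hfin : φ.toRingHom.Finite := RingHom.finite_algebraMap.mpr hRN
  refine ⟨hfin, inferInstance, hN, fun p _ => ?_⟩
  -- Only the finiteness of the kernel and cokernel on the fibres is used here, not the value of χ.
  obtain ⟨χ, hχ⟩ := exists_finrank_coker_sub_finrank_ker_eq A φ.toLinearMap
  let k := p.asIdeal.ResidueField
  let B := p.asIdeal.Fiber R
  let B' := p.asIdeal.Fiber N
  let : Algebra B B' := (fiberAlgHom p φ).toRingHom.toAlgebra
  have : IsScalarTower k B B' := IsScalarTower.of_algebraMap_eq fun x =>
    ((fiberAlgHom p φ).commutes x).symm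
  have : Module.Finite B B' := finite_fiberAlgHom φ hfin p
  obtain ⟨h1, h2, -⟩ := hχ k
  have : Module.Finite k (LinearMap.ker (Algebra.linearMap B B')) := h1
  have : Module.Finite k (B' ⧸ LinearMap.range (Algebra.linearMap B B')) :=
    let e : (B' ⧸ LinearMap.range (φ.toLinearMap.baseChange k)) ≃ₗ[k]
        B' ⧸ LinearMap.range (Algebra.linearMap B B') :=
      Submodule.Quotient.restrictScalarsEquiv k (LinearMap.range (Algebra.linearMap B B'))
    Module.Finite.equiv e
  exact isBirationalHom_of_finite k (B := B) (B' := B')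
    (comap_fiberAlgHom_surjective φ (comap_surjective_of_ker_le_nilradical hker) p) (hIso p)

end Birational


/-! ### From birationality on the generic fibre to the total space -/

section GenericFiber

open TensorProduct nonZeroDivisors

theorem IsBirationalHom.mem_of_algebraMap_eq_zero {B B' : Type*} [CommRing B] [CommRing B']
    [Algebra B B'] (h : IsBirationalHom (algebraMap B B')) {P : Ideal B} (hP : P ∈ minimalPrimes B)
    {b : B} (hb : algebraMap B B' b = 0) : b ∈ P := by
  obtain ⟨q, -, hq⟩ := h.1.surjOn (show (⟨P, hP.isPrime⟩ : PrimeSpectrum B) ∈ _ from hP)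
  have hq : q.asIdeal.comap (algebraMap B B') = P := congrArg PrimeSpectrum.asIdeal hq
  rw [← hq, Ideal.mem_comap, hb]
  exact zero_mem _

theorem IsBirationalHom.comap_mem_minimalPrimes {B B' : Type*} [CommRing B] [CommRing B']
    [Algebra B B'] (h : IsBirationalHom (algebraMap B B')) {q : Ideal B'}
    (hq : q ∈ minimalPrimes B') : q.comap (algebraMap B B') ∈ minimalPrimes B :=
  h.1.mapsTo (show (⟨q, hq.isPrime⟩ : PrimeSpectrum B') ∈ _ from hq)

theorem IsBirationalHom.exists_notMem_smul_eq {B B' : Type*} [CommRing B] [CommRing B']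
    [Algebra B B'] [Algebra.IsIntegral B B'] (h : IsBirationalHom (algebraMap B B'))
    {P : Ideal B} (hP : P ∈ minimalPrimes B) (y : B') :
    ∃ s ∉ P, ∃ b, algebraMap B B' b = s • y := by
  have hPp : P.IsPrime := hP.isPrime
  obtain ⟨q, hq, hqP⟩ := h.1.surjOn (show (⟨P, hP.isPrime⟩ : PrimeSpectrum B) ∈ _ from hP)
  obtain rfl : q.asIdeal.comap (algebraMap B B') = P := congrArg PrimeSpectrum.asIdeal hqP
  have hq : q.asIdeal ∈ minimalPrimes B' := hq
  -- q is the only prime over P: a minimal prime below another one also lies over P, so equals q,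
  -- and incomparability excludes a strict inclusion.
  have huniq : ∀ q' : Ideal B', q'.IsPrime →
      q'.comap (algebraMap B B') = q.asIdeal.comap (algebraMap B B') → q' = q.asIdeal := by
    intro q' hq' he
    obtain ⟨q₀, hq₀, hle⟩ := Ideal.exists_minimalPrimes_le (I := ⊥) (J := q') bot_le
    have h1 : q₀.comap (algebraMap B B') = q.asIdeal.comap (algebraMap B B') := by
      have hle' := (Ideal.comap_mono (f := algebraMap B B') hle).trans he.le
      exact le_antisymm hle' (hP.2 ⟨(h.comap_mem_minimalPrimes hq₀).isPrime, bot_le⟩ hle')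
    have h2 : (⟨q₀, hq₀.isPrime⟩ : PrimeSpectrum B') = q :=
      h.1.injOn hq₀ hq (PrimeSpectrum.ext h1)
    have h3 : q₀ = q.asIdeal := congrArg PrimeSpectrum.asIdeal h2
    by_contra hne
    have hlt : q₀ < q' := lt_of_le_of_ne hle fun h => hne (h.symm.trans h3)
    have := hq₀.isPrime
    have h4 := Ideal.IsIntegral.comap_lt_comap (R := B) hlt
    rw [h1, he] at h4
    exact lt_irrefl _ h4
  have hq2 : Function.Bijective (Localization.localRingHom (q.asIdeal.comap (algebraMap B B'))
    q.asIdeal (algebraMap B B') rfl) := h.2 q hq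
  obtain ⟨x, hx⟩ := hq2.2 (algebraMap B' _ y)
  obtain ⟨b, s, rfl⟩ := IsLocalization.exists_mk'_eq
    (q.asIdeal.comap (algebraMap B B')).primeCompl x
  rw [Localization.localRingHom_mk', IsLocalization.mk'_eq_iff_eq_mul, ← map_mul,
    IsLocalization.eq_iff_exists q.asIdeal.primeCompl] at hx
  obtain ⟨c, hc⟩ := hx
  -- The denominator c lives in B'. If the ideal (c) met B only inside P, lying over would put c in
  -- the unique prime q, so some multiple of c comes from B outside P.
  obtain ⟨a, ha, haq⟩ : ∃ a, algebraMap B B' a ∈ Ideal.span {(c : B')} ∧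
      a ∉ q.asIdeal.comap (algebraMap B B') := by
    by_contra! hcon
    obtain ⟨q', hq', hq'p, he⟩ := Ideal.exists_ideal_over_prime_of_isIntegral
      (q.asIdeal.comap (algebraMap B B')) (Ideal.span {(c : B')}) hcon
    rw [huniq q' hq'p he] at hq'
    exact c.2 (hq' (Ideal.mem_span_singleton_self _))
  obtain ⟨d, hd⟩ := Ideal.mem_span_singleton'.mp ha
  refine ⟨a * s, hPp.mul_notMem haq s.2, a * b, ?_⟩
  rw [Algebra.smul_def, map_mul, map_mul, ← hd]
  change d * c * algebraMap B B' b = d * c * algebraMap B B' s * y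
  have hc : (c : B') * algebraMap B B' b = c * (y * algebraMap B B' s) := hc
  rw [mul_assoc, hc]
  ring

variable {A R M : Type u} [CommRing A] [IsDomain A] [CommRing R] [Algebra A R] [CommRing M]
  [Algebra A M]

theorem includeRight_fiber_bot_injective (M : Type u) [CommRing M] [Algebra A M] [Module.Flat A M] :
    Function.Injective (Algebra.TensorProduct.includeRight :
      M →ₐ[A] (⊥ : PrimeSpectrum A).asIdeal.Fiber M) :=
  Algebra.TensorProduct.includeRight_injective ((injective_iff_map_eq_zero _).mpr fun _ hx =>
    Ideal.algebraMap_residueField_eq_zero.mp hx)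

theorem exists_minimalPrimes_fiber_bot [Module.Flat A R] {P : Ideal R} (hP : P ∈ minimalPrimes R) :
    ∃ P' ∈ minimalPrimes ((⊥ : PrimeSpectrum A).asIdeal.Fiber R),
      ∀ r : R, (1 ⊗ₜ r : (⊥ : PrimeSpectrum A).asIdeal.Fiber R) ∈ P' ↔ r ∈ P := by
  let e := PrimeSpectrum.preimageOrderIsoFiber A R ⊥
  have hbot : ∀ Q : PrimeSpectrum R, Q.asIdeal ≤ P →
      PrimeSpectrum.comap (algebraMap A R) Q = ⊥ := fun Q hQ => by
    refine PrimeSpectrum.ext (eq_bot_iff.mpr fun a ha => ?_)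
    by_contra ha0
    exact notMem_of_mem_minimalPrimes_of_flat ha0 hP (hQ ha)
  let x : PrimeSpectrum.comap (algebraMap A R) ⁻¹' {⊥} := ⟨⟨P, hP.isPrime⟩, hbot _ le_rfl⟩
  have hmem : ∀ r : R, (1 ⊗ₜ r : (⊥ : PrimeSpectrum A).asIdeal.Fiber R) ∈ (e x).asIdeal ↔
      r ∈ P := fun r => by
    have h1 : (e.symm (e x)).1.asIdeal = P := congrArg (fun y => y.1.asIdeal) (e.symm_apply_apply x)
    conv_rhs => rw [← h1]
    rfl
  refine ⟨(e x).asIdeal, ⟨⟨(e x).2, bot_le⟩, fun Q hQ hle => ?_⟩, hmem⟩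
  have h2 : e.symm ⟨Q, hQ.1⟩ ≤ x := by
    rw [OrderIso.symm_apply_le]
    exact hle
  have h3 : x ≤ e.symm ⟨Q, hQ.1⟩ :=
    hP.2 ⟨(e.symm ⟨Q, hQ.1⟩).1.2, bot_le⟩ h2
  rw [OrderIso.le_symm_apply] at h3
  exact h3

theorem comap_includeRight_mem_minimalPrimes
    {P' : Ideal ((⊥ : PrimeSpectrum A).asIdeal.Fiber R)} (hP' : P' ∈ minimalPrimes _) :
    P'.comap (Algebra.TensorProduct.includeRight :
      R →ₐ[A] (⊥ : PrimeSpectrum A).asIdeal.Fiber R) ∈ minimalPrimes R := by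
  let e := PrimeSpectrum.preimageOrderIsoFiber A R ⊥
  let x := e.symm ⟨P', hP'.isPrime⟩
  have hx : PrimeSpectrum.comap (algebraMap A R) x.1 = ⊥ := x.2
  refine ⟨⟨x.1.2, bot_le⟩, fun Q hQ hle => ?_⟩
  have hQ' : PrimeSpectrum.comap (algebraMap A R) ⟨Q, hQ.1⟩ = ⊥ := by
    refine le_bot_iff.mp ?_
    rw [← hx]
    exact Ideal.comap_mono (f := algebraMap A R) hle
  let y : PrimeSpectrum.comap (algebraMap A R) ⁻¹' {⊥} := ⟨⟨Q, hQ.1⟩, hQ'⟩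
  have h1 : e y ≤ ⟨P', hP'.isPrime⟩ := by
    rw [← OrderIso.le_symm_apply]
    exact hle
  have h2 : (⟨P', hP'.isPrime⟩ : PrimeSpectrum _) ≤ e y := hP'.2 ⟨(e y).2, bot_le⟩ h1
  rw [← OrderIso.symm_apply_le] at h2
  exact h2

theorem mem_of_isBirationalHom_fiber_bot [Module.Flat A R] {φ : R →ₐ[A] M}
    (h : IsBirationalHom (fiberAlgHom ⊥ φ).toRingHom) {P : Ideal R} (hP : P ∈ minimalPrimes R)
    {b : R} (hb : φ b = 0) : b ∈ P := by
  obtain ⟨P', hP', hmem⟩ := exists_minimalPrimes_fiber_bot (A := A) hP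
  let : Algebra ((⊥ : PrimeSpectrum A).asIdeal.Fiber R) ((⊥ : PrimeSpectrum A).asIdeal.Fiber M) :=
    (fiberAlgHom ⊥ φ).toRingHom.toAlgebra
  refine (hmem b).mp (IsBirationalHom.mem_of_algebraMap_eq_zero h hP' ?_)
  refine (Algebra.TensorProduct.map_tmul _ _ _ _).trans ?_
  rw [hb, tmul_zero]

theorem exists_notMem_of_isBirationalHom_fiber_bot [Module.Flat A R] [Module.Flat A M] {φ : R →ₐ[A] M}
    (hφ : φ.toRingHom.Finite) (h : IsBirationalHom (fiberAlgHom ⊥ φ).toRingHom) {P : Ideal R}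
    (hP : P ∈ minimalPrimes R) (y : M) : ∃ s ∉ P, ∃ b, φ b = φ s * y := by
  obtain ⟨P', hP', hmem⟩ := exists_minimalPrimes_fiber_bot (A := A) hP
  have hPp := hP.isPrime
  have hPp' := hP'.isPrime
  let : Algebra ((⊥ : PrimeSpectrum A).asIdeal.Fiber R) ((⊥ : PrimeSpectrum A).asIdeal.Fiber M) :=
    (fiberAlgHom ⊥ φ).toRingHom.toAlgebra
  have hfin : Module.Finite ((⊥ : PrimeSpectrum A).asIdeal.Fiber R)
    ((⊥ : PrimeSpectrum A).asIdeal.Fiber M) := finite_fiberAlgHom φ hφ ⊥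
  obtain ⟨s, hs, b, hb⟩ := IsBirationalHom.exists_notMem_smul_eq h hP' (1 ⊗ₜ y)
  have hb : fiberAlgHom ⊥ φ b = fiberAlgHom ⊥ φ s * 1 ⊗ₜ y := hb
  obtain ⟨r₁, hr₁, s', hs'⟩ := exists_includeRight_eq_mul R ⊥ s
  obtain ⟨r₂, hr₂, b', hb'⟩ := exists_includeRight_eq_mul R ⊥ b
  have hunit : ∀ r : R, IsUnit (1 ⊗ₜ r : (⊥ : PrimeSpectrum A).asIdeal.Fiber R) → r ∉ P :=
    fun r hr hrP => hPp'.ne_top (Ideal.eq_top_of_isUnit_mem _ ((hmem r).mpr hrP) hr)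
  refine ⟨r₂ * s', hPp.mul_notMem (hunit _ hr₂) fun h => ?_, r₁ * b', ?_⟩
  · rw [← hmem, hs'] at h
    exact hs ((Ideal.unit_mul_mem_iff_mem _ hr₁).mp h)
  · apply includeRight_fiber_bot_injective (A := A) M
    have hinc : ∀ r : R, (1 ⊗ₜ φ r : (⊥ : PrimeSpectrum A).asIdeal.Fiber M) =
      fiberAlgHom ⊥ φ (1 ⊗ₜ r) := fun r => by
        rw [Algebra.TensorProduct.map_tmul, AlgHom.id_apply]
    simp only [map_mul, Algebra.TensorProduct.includeRight_apply]
    rw [hinc, hinc, hinc, hinc, hs', hb', map_mul, map_mul, hb]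
    ring

/-- Minimal primes of the generic fibre of M contract to minimal primes of R, so s avoids all of
them and is a nonzerodivisor on that reduced fibre, into which M embeds. -/
theorem eq_zero_of_isBirationalHom_fiber_bot [Module.Flat A M] {φ : R →ₐ[A] M}
    (h : IsBirationalHom (fiberAlgHom ⊥ φ).toRingHom)
    (hred : _root_.IsReduced ((⊥ : PrimeSpectrum A).asIdeal.Fiber M)) {s : R}
    (hs : ∀ P ∈ minimalPrimes R, s ∉ P) {y : M} (hy : φ s * y = 0) : y = 0 := by
  let : Algebra ((⊥ : PrimeSpectrum A).asIdeal.Fiber R) ((⊥ : PrimeSpectrum A).asIdeal.Fiber M) :=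
    (fiberAlgHom ⊥ φ).toRingHom.toAlgebra
  have key : (1 ⊗ₜ y : (⊥ : PrimeSpectrum A).asIdeal.Fiber M) ∈ nilradical _ := by
    rw [nilradical_eq_sInf, Ideal.mem_sInf]
    intro q hq
    have hqp : q.IsPrime := hq
    obtain ⟨q₀, hq₀, hle⟩ := Ideal.exists_minimalPrimes_le (I := ⊥) (J := q) bot_le
    have hq₀p := hq₀.isPrime
    refine hle ((hq₀p.mem_or_mem (x := 1 ⊗ₜ φ s) ?_).resolve_left fun h1 => ?_)
    · rw [Algebra.TensorProduct.tmul_mul_tmul, hy, tmul_zero]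
      exact zero_mem _
    · refine hs _ (comap_includeRight_mem_minimalPrimes
        (IsBirationalHom.comap_mem_minimalPrimes h hq₀)) ?_
      change fiberAlgHom ⊥ φ (1 ⊗ₜ s) ∈ q₀
      rwa [Algebra.TensorProduct.map_tmul]
  rw [nilradical_eq_zero] at key
  exact includeRight_fiber_bot_injective (A := A) M (key.trans (tmul_zero _ _).symm)

end GenericFiber


/-! ### Simultaneous normalizations are normalizations -/

section IntegrallyClosed

open TensorProduct nonZeroDivisors Finset

/-- The integral equation of z = d/w makes w divide a power of d. Since M/wM is reduced, w divides
d. -/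
theorem dvd_of_isIntegral_of_isReduced_fiber {A M F : Type u} [CommRing A] [CommRing M]
    [Algebra A M] [CommRing F] [Algebra M F] (hinj : Function.Injective (algebraMap M F))
    (p : PrimeSpectrum A) [p.asIdeal.IsMaximal] {w : A} (hw : p.asIdeal = Ideal.span {w})
    (hred : _root_.IsReduced (p.asIdeal.Fiber M)) {z : F} (hz : IsIntegral M z) {d : M}
    (hd : algebraMap M F (algebraMap A M w) * z = algebraMap M F d) : algebraMap A M w ∣ d := by
  obtain ⟨n, c, hrel⟩ := exists_pow_eq_sum_of_isIntegral hinj hd hz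
  have h1 : algebraMap A M w ∣ d ^ n := by
    rw [hrel]
    refine dvd_sum fun i hi => Dvd.dvd.mul_left (dvd_pow_self _ ?_) _
    have := mem_range.mp hi
    omega
  have hker := ker_includeRight M p hw
  rw [← Ideal.mem_span_singleton, ← hker, RingHom.mem_ker] at h1 ⊢
  rw [map_pow] at h1
  exact IsNilpotent.eq_zero ⟨n, h1⟩

/-- A flat algebra over a principal ideal domain with normal fibres is integrally closed. -/
theorem exists_algebraMap_eq_of_isIntegral_of_fiber {A M F : Type u} [CommRing A] [IsDomain A]
    [IsPrincipalIdealRing A] [CommRing M] [Algebra A M] [Module.Flat A M] [CommRing F]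
    [Algebra M F] [IsFractionRing M F] (hM : ∀ p : PrimeSpectrum A, IsNormalRing (p.asIdeal.Fiber M))
    (z : F) (hz : IsIntegral M z) : ∃ d, algebraMap M F d = z := by
  have hinj := IsFractionRing.injective M F
  have hunit : ∀ w : A, w ≠ 0 → IsUnit (algebraMap M F (algebraMap A M w)) := fun w hw => by
    refine IsLocalization.map_units F (⟨algebraMap A M w, ?_⟩ : M⁰)
    refine mem_nonZeroDivisors_iff_right.mpr fun x hx => ?_
    rw [mul_comm, ← Algebra.smul_def] at hx
    exact (Module.Flat.isSMulRegular_of_nonZeroDivisors (mem_nonZeroDivisors_of_ne_zero hw))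
      (hx.trans (smul_zero w).symm)
  -- A denominator from A is removed one prime factor at a time, each by reducedness of the
  -- corresponding closed fibre.
  have key : ∀ w : A, w ≠ 0 → ∀ z : F, IsIntegral M z →
      (∃ d, algebraMap M F d = algebraMap M F (algebraMap A M w) * z) →
      ∃ d, algebraMap M F d = z := by
    intro w
    induction w using UniqueFactorizationMonoid.induction_on_prime with
    | h₁ => exact fun h => absurd rfl h
    | h₂ w hw =>
      rintro - z - ⟨d, hd⟩
      obtain ⟨v, hv⟩ := hw.exists_left_inv
      refine ⟨algebraMap A M v * d, ?_⟩
      rw [map_mul, hd, ← mul_assoc, ← map_mul, ← map_mul, hv, map_one, map_one, one_mul]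
    | h₃ w π hw hπ ih =>
      rintro - z hz ⟨d, hd⟩
      refine ih hw z hz ?_
      have hd' : algebraMap M F (algebraMap A M π) * (algebraMap M F (algebraMap A M w) * z) =
          algebraMap M F d := by
        rw [hd, map_mul, map_mul, mul_assoc]
      let p : PrimeSpectrum A :=
        ⟨Ideal.span {π}, (Ideal.span_singleton_prime hπ.ne_zero).mpr hπ⟩
      have : p.asIdeal.IsMaximal := PrincipalIdealRing.isMaximal_of_irreducible hπ.irreducible
      obtain ⟨e, rfl⟩ := dvd_of_isIntegral_of_isReduced_fiber hinj p rfl (hM p).isReduced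
        (isIntegral_algebraMap.mul hz) hd'
      refine ⟨e, ((hunit π hπ.ne_zero).mul_left_cancel ?_).symm⟩
      rw [hd', map_mul]
  obtain ⟨⟨a, b⟩, hab⟩ := IsLocalization.surj M⁰ z
  have hab : algebraMap M F b * z = algebraMap M F a := by rw [← hab, mul_comm]
  obtain ⟨n, c, hrel⟩ := exists_pow_eq_sum_of_isIntegral hinj hab hz
  let E := (⊥ : PrimeSpectrum A).asIdeal.Fiber M
  let : Algebra M E := Algebra.TensorProduct.rightAlgebra
  have : IsLocalization (Algebra.algebraMapSubmonoid M A⁰) ((⊥ : Ideal A).Fiber M) :=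
    inferInstance
  have : IsLocalization (Algebra.algebraMapSubmonoid M A⁰) E := this
  -- Normality of the generic fibre makes b divide a after multiplication by some w in A, so z
  -- acquires a denominator from A.
  obtain ⟨_, ⟨w, hw, rfl⟩, hdvd⟩ := exists_dvd_mul_of_algebraMap_dvd
    (Algebra.algebraMapSubmonoid M A⁰) E
    (hM ⊥ (algebraMap M E a) (algebraMap M E b) n (fun i => algebraMap M E (c i)) (by
      rw [← map_pow, hrel]
      simp [map_sum]))
  obtain ⟨d, hd⟩ := hdvd
  refine key w (nonZeroDivisors.ne_zero hw) z hz ⟨d, ?_⟩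
  refine (IsLocalization.map_units F b).mul_left_cancel ?_
  rw [← map_mul, ← hd, map_mul, ← hab]
  ring

end IntegrallyClosed


/-! ### A simultaneous normalization is the integral closure of the reduced base -/

section Comparison

open TensorProduct nonZeroDivisors

theorem image_comap_minimalPrimes_of_surjective {R D : Type*} [CommRing R] [CommRing D] {f : R →+* D}
    (hsurj : Function.Surjective f) (hker : RingHom.ker f = nilradical R) :
    Ideal.comap f '' minimalPrimes D = minimalPrimes R := by
  have h1 := Ideal.comap_minimalPrimes_eq_of_surjective hsurj (⊥ : Ideal D)
  rw [← RingHom.ker_eq_comap_bot, hker, nilradical, Ideal.radical_minimalPrimes] at h1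
  exact h1.symm

theorem IsFiberwiseNormalizationHom.nonempty_algEquiv {A R M : Type u} (D F : Type u) [CommRing A]
    [IsDomain A] [IsPrincipalIdealRing A] [CommRing R] [IsNoetherianRing R] [Algebra A R]
    [Module.Flat A R] [CommRing M] [Algebra A M] [CommRing D] [Algebra R D] [Algebra A D]
    [IsScalarTower A R D] [CommRing F] [Algebra D F] [IsFractionRing D F] [Algebra A F]
    [IsScalarTower A D F] {φ : R →ₐ[A] M} (hφ : IsFiberwiseNormalizationHom φ)
    (hsurj : Function.Surjective (algebraMap R D))
    (hker : RingHom.ker (algebraMap R D) = nilradical R)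
    (hbot : ⊥ ∈ Set.range (PrimeSpectrum.comap (algebraMap A R))) :
    Nonempty (integralClosure D F ≃ₐ[A] M) := by
  have := hφ.flat
  have hbir := hφ.birational ⊥ hbot
  have hred := (hφ.normal ⊥).isReduced
  have hmin := image_comap_minimalPrimes_of_surjective hsurj hker
  have hMred : _root_.IsReduced M :=
    isReduced_of_injective _ (includeRight_fiber_bot_injective (A := A) M)
  let ψ : D →ₐ[A] M := AlgHom.liftOfSurjective (IsScalarTower.toAlgHom A R D) hsurj φ
    (hker.le.trans fun x hx => ((mem_nilradical.mp hx).map φ).eq_zero)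
  have hψ : ∀ r, ψ (algebraMap R D r) = φ r :=
    AlgHom.liftOfSurjective_apply (IsScalarTower.toAlgHom A R D) hsurj φ _
  let : Algebra D M := ψ.toRingHom.toAlgebra
  have : IsScalarTower A D M := IsScalarTower.of_algebraMap_eq fun x => (ψ.commutes x).symm
  have hDnoeth : IsNoetherianRing D := isNoetherianRing_of_surjective R D _ hsurj
  have hDred : _root_.IsReduced D := ⟨fun d ⟨n, hn⟩ => by
    obtain ⟨r, rfl⟩ := hsurj d
    rw [← map_pow, ← RingHom.mem_ker, hker] at hn
    rw [← RingHom.mem_ker, hker]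
    exact Ideal.radical_isRadical _ ⟨n, hn⟩⟩
  have hfin : Module.Finite D M := by
    refine RingHom.Finite.of_comp_finite (f := algebraMap R D) ?_
    have : ψ.toRingHom.comp (algebraMap R D) = φ.toRingHom := RingHom.ext hψ
    change (ψ.toRingHom.comp (algebraMap R D)).Finite
    rw [this]
    exact hφ.finite
  have hinj : Function.Injective (algebraMap D M) := by
    refine (injective_iff_map_eq_zero _).mpr fun d hd => ?_
    obtain ⟨r, rfl⟩ := hsurj d
    rw [← RingHom.mem_ker, hker, nilradical, ← Ideal.sInf_minimalPrimes, Ideal.mem_sInf]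
    exact fun {P} hP => mem_of_isBirationalHom_fiber_bot hbir hP ((hψ r).symm.trans hd)
  -- Birationality makes M/D vanish at every minimal prime of D, so a nonzerodivisor s satisfies sM
  -- ⊆ D. Then D and M share a total ring of fractions.
  obtain ⟨s, hs, hs0⟩ : ∃ s ∈ Module.annihilator D (M ⧸ LinearMap.range (Algebra.linearMap D M)),
      s ∈ D⁰ := by
    refine exists_mem_nonZeroDivisors_of_not_le fun p hp => ?_
    have hpp := hp.isPrime
    refine mt (Module.mem_support_iff_of_finite (p := ⟨p, hpp⟩)).mpr ?_
    rw [Module.notMem_support_iff']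
    intro y
    obtain ⟨y, rfl⟩ := Submodule.Quotient.mk_surjective _ y
    obtain ⟨s, hs, b, hb⟩ := exists_notMem_of_isBirationalHom_fiber_bot hφ.finite hbir
      (hmin ▸ Set.mem_image_of_mem _ hp) y
    refine ⟨algebraMap R D s, hs, ?_⟩
    rw [← Submodule.Quotient.mk_smul, Submodule.Quotient.mk_eq_zero]
    refine ⟨algebraMap R D b, ?_⟩
    exact (hψ b).trans (hb.trans (congrArg (· * y) (hψ s).symm))
  let F' := FractionRing M
  have hFrac : IsFractionRing D F' := by
    refine isFractionRing_of_smul_mem_range (E := M) hinj (s := s) (fun y => ?_) fun y hy => ?_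
    · have := Module.mem_annihilator.mp hs (Submodule.Quotient.mk y)
      rwa [← Submodule.Quotient.mk_smul, Submodule.Quotient.mk_eq_zero] at this
    · obtain ⟨s, rfl⟩ := hsurj s
      refine eq_zero_of_isBirationalHom_fiber_bot hbir hred (s := s) (fun P hP hsP => ?_) ?_
      · rw [← hmin] at hP
        obtain ⟨p, hp, rfl⟩ := hP
        exact notMem_nonZeroDivisors_of_mem_mem_minimalPrimes (show algebraMap R D s ∈ p from hsP) hp hs0
      · rw [← hψ]
        exact hy
  have hcl : IsIntegralClosure M D F' := by
    refine ⟨IsFractionRing.injective M F', fun {x} => ⟨fun hx => ?_, ?_⟩⟩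
    · exact exists_algebraMap_eq_of_isIntegral_of_fiber hφ.normal x hx.tower_top
    · rintro ⟨y, rfl⟩
      exact (Algebra.IsIntegral.isIntegral y).algebraMap
  let e₁ : integralClosure D F ≃ₐ[D] integralClosure D F' :=
    (IsLocalization.algEquiv D⁰ F F').mapIntegralClosure
  exact ⟨(e₁.trans (IsIntegralClosure.equiv D (integralClosure D F') F' M)).restrictScalars A⟩

theorem IsFiberwiseNormalizationHom.isNormalRing_fiber {A R M : Type u} (D F : Type u) [CommRing A]
    [IsDomain A] [IsPrincipalIdealRing A] [CommRing R] [IsNoetherianRing R] [Algebra A R]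
    [Module.Flat A R] [CommRing M] [Algebra A M] [CommRing D] [Algebra R D] [Algebra A D]
    [IsScalarTower A R D] [CommRing F] [Algebra D F] [IsFractionRing D F] [Algebra A F]
    [IsScalarTower A D F] {φ : R →ₐ[A] M} (hφ : IsFiberwiseNormalizationHom φ)
    (hsurj : Function.Surjective (algebraMap R D))
    (hker : RingHom.ker (algebraMap R D) = nilradical R) (p : PrimeSpectrum A) :
    IsNormalRing (p.asIdeal.Fiber (integralClosure D F)) := by
  by_cases hbot : ⊥ ∈ Set.range (PrimeSpectrum.comap (algebraMap A R))
  · obtain ⟨e⟩ := hφ.nonempty_algEquiv D F hsurj hker hbot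
    let e' : p.asIdeal.Fiber M ≃ₐ[p.asIdeal.ResidueField] p.asIdeal.Fiber (integralClosure D F) :=
      Algebra.TensorProduct.congr AlgEquiv.refl e.symm
    exact (hφ.normal p).of_ringEquiv e'.toRingEquiv
  -- Minimal primes of a flat algebra lie over zero, so an image missing the generic point is empty.
  · have hR : Subsingleton R := by
      by_contra hR
      rw [not_subsingleton_iff_nontrivial] at hR
      obtain ⟨P, hP⟩ := Ideal.nonempty_minimalPrimes (bot_ne_top (α := Ideal R))
      refine hbot ⟨⟨P, hP.isPrime⟩, PrimeSpectrum.ext (eq_bot_iff.mpr fun a ha => ?_)⟩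
      by_contra ha0
      exact notMem_of_mem_minimalPrimes_of_flat ha0 hP ha
    have hD : Subsingleton D := hsurj.subsingleton
    have : Subsingleton (integralClosure D F) :=
      RingHom.codomain_trivial (algebraMap D (integralClosure D F))
    have : Subsingleton (p.asIdeal.Fiber (integralClosure D F)) :=
      RingHom.codomain_trivial (Algebra.TensorProduct.includeRight : integralClosure D F →ₐ[A]
        p.asIdeal.Fiber (integralClosure D F)).toRingHom
    exact IsNormalRing.of_subsingleton

end Comparison


/-! ### Criteria for simultaneous normalization -/

section Main

theorem ker_algebraMap_higherPart_quotient_nilradical (R : Type u) [CommRing R] {i : ℕ} (h : higherIdeal R i = nilradical R) :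
    RingHom.ker (algebraMap R (HigherPart R i ⧸ nilradical (HigherPart R i))) = nilradical R := by
  have := isReduced_higherPart R i
  have hk : RingHom.ker (algebraMap (HigherPart R i)
    (HigherPart R i ⧸ nilradical (HigherPart R i))) = ⊥ := Ideal.mk_ker.trans (nilradical_eq_zero _)
  rw [IsScalarTower.algebraMap_eq R (HigherPart R i), ← RingHom.comap_ker, hk]
  exact (RingHom.ker_eq_comap_bot _).symm.trans (Ideal.mk_ker.trans h)

variable {A R : Type u} [CommRing A] [IsDomain A] [CommRing R] [Algebra A R] [Module.Flat A R]

/-- An element y outside P but in all other minimal primes lies in the kernel of R → N. Multiples of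
y already cover the field R/P, which is thus finite over A, and it contains A by flatness. -/
theorem isField_of_isField_quotient [IsNoetherianRing R] {i : ℕ}
    (hKer : Module.Finite A (RingHom.ker (algebraMap R (Normalization (HigherPart R i)))))
    {P : Ideal R} (hP : P ∈ minimalPrimes R) (hPi : ¬ ((i : ℕ∞) : WithBot ℕ∞) < ringKrullDim (R ⧸ P))
    (hfield : IsField (R ⧸ P)) : IsField A := by
  have hPm : P.IsMaximal := Ideal.Quotient.maximal_of_isField P hfield
  obtain ⟨y, hy, hy'⟩ := exists_mem_forall_mem_forall_notMem (Set.singleton_subset_iff.mpr hP)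
  have hyK : y ∈ RingHom.ker (algebraMap R (Normalization (HigherPart R i))) := by
    rw [ker_algebraMap_normalization_higherPart, mem_higherIdeal_iff]
    exact fun Q hQ hQi => hy' Q hQ fun h => hPi (by rwa [← Set.mem_singleton_iff.mp h])
  let l : RingHom.ker (algebraMap R (Normalization (HigherPart R i))) →ₗ[A] R ⧸ P :=
    (Ideal.Quotient.mkₐ A P).toLinearMap ∘ₗ
      (Submodule.subtype (RingHom.ker (algebraMap R _))).restrictScalars A
  have hl : Function.Surjective l := by
    intro x
    obtain ⟨x, rfl⟩ := Ideal.Quotient.mk_surjective x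
    obtain ⟨z, hz⟩ := hfield.mul_inv_cancel
      (a := Ideal.Quotient.mk P y) (fun h => hy P rfl (Ideal.Quotient.eq_zero_iff_mem.mp h))
    obtain ⟨z, rfl⟩ := Ideal.Quotient.mk_surjective z
    refine ⟨⟨x * z * y, Ideal.mul_mem_left _ _ hyK⟩, ?_⟩
    change Ideal.Quotient.mk P (x * z * y) = _
    rw [mul_assoc, mul_comm z, map_mul, map_mul, hz, mul_one]
  have : Module.Finite A (R ⧸ P) := Module.Finite.of_surjective l hl
  refine isField_of_isIntegral_of_isField (R := A) (S := R ⧸ P)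
    ((injective_iff_map_eq_zero _).mpr fun a ha => ?_) hfield
  by_contra ha0
  exact notMem_of_mem_minimalPrimes_of_flat ha0 hP (Ideal.Quotient.eq_zero_iff_mem.mp ha)

theorem higherIdeal_one_eq_nilradical [IsNoetherianRing R]
    (hKer : Module.Finite A (RingHom.ker (algebraMap R (Normalization (HigherPart R 1)))))
    (hA : ¬ IsField A) (hdim : ∀ p ∈ minimalPrimes R, ringKrullDim (R ⧸ p) ≠ 1) :
    higherIdeal R 1 = nilradical R := by
  have key : ∀ P ∈ minimalPrimes R, ((1 : ℕ) : ℕ∞) < ringKrullDim (R ⧸ P) := by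
    intro P hP
    by_contra hPi
    have hPp := hP.isPrime
    refine hA (isField_of_isField_quotient hKer hP hPi ?_)
    have h1 : ringKrullDim (R ⧸ P) < 1 := lt_of_le_of_ne (not_lt.mp hPi) (hdim P hP)
    have h2 : ringKrullDim (R ⧸ P) ≤ (0 : ℕ) := by
      generalize ringKrullDim (R ⧸ P) = d at h1
      induction d with
      | bot => exact bot_le
      | coe n =>
        have : n < 1 := by exact_mod_cast h1
        rw [Order.lt_one_iff.mp this]
        rfl
    have : Ring.KrullDimLE 0 (R ⧸ P) := Order.krullDimLE_iff _ _ |>.mpr h2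
    exact Ring.KrullDimLE.isField_of_isDomain
  rw [nilradical, ← Ideal.sInf_minimalPrimes, higherIdeal]
  congr 1
  exact Set.ext fun P => ⟨fun h => h.1, fun h => ⟨h, key P h⟩⟩

variable [IsPrincipalIdealRing A]

theorem flat_higherPart (i : ℕ) : Module.Flat A (HigherPart R i) := by
  have hred := isReduced_higherPart R i
  have := flat_normalization_higherPart A R i
  have hinj : Function.Injective (algebraMap (HigherPart R i) (Normalization (HigherPart R i))) := by
    rw [RingHom.injective_iff_ker_eq_bot, ker_algebraMap_normalization, nilradical_eq_zero]
    rfl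
  have : Module.IsTorsionFree A (HigherPart R i) := hinj.moduleIsTorsionFree _ fun a x => by
    rw [Algebra.smul_def, Algebra.smul_def, map_mul, ← IsScalarTower.algebraMap_apply]
  infer_instance

theorem admitsSimultaneousNormalization_higherPart_iff [IsNoetherianRing R]
    (hCoker : Module.Finite A (NormalizationCoker A R))
    (hIso : ∀ p : PrimeSpectrum A,
      NoIsolatedPoints (p.asIdeal.Fiber (Normalization (HigherPart R 1))))
    (hPerfect : ∀ p : PrimeSpectrum A, PerfectField p.asIdeal.ResidueField) :
    AdmitsSimultaneousNormalization (structureMap A (HigherPart R 1)) ↔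
      ∀ p : PrimeSpectrum A, IsNormalRing (p.asIdeal.Fiber (Normalization (HigherPart R 1))) := by
  let R₁ := HigherPart R 1
  let N := Normalization R₁
  have hred := isReduced_higherPart R 1
  have : Module.Flat A R₁ := flat_higherPart 1
  have : Module.Flat A N := flat_normalization_higherPart A R 1
  constructor
  · intro h
    obtain ⟨M, _, _, φ, hφ⟩ := h.exists_hom
    exact hφ.isNormalRing_fiber (R₁ ⧸ nilradical R₁) (FractionRing (R₁ ⧸ nilradical R₁))
      Ideal.Quotient.mk_surjective Ideal.mk_ker
  · intro h
    have hker : RingHom.ker (algebraMap R₁ N) = ⊥ := by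
      rw [ker_algebraMap_normalization, nilradical_eq_zero]
      rfl
    have hinj : LinearMap.ker (IsScalarTower.toAlgHom A R₁ N).toLinearMap = ⊥ :=
      LinearMap.ker_eq_bot.mpr ((RingHom.injective_iff_ker_eq_bot (algebraMap R₁ N)).mpr hker)
    have h1 : Module.Finite A (LinearMap.ker (IsScalarTower.toAlgHom A R₁ N).toLinearMap) := by
      rw [hinj]
      infer_instance
    -- R maps onto R^{>1}, so both have the same image in N and finiteness of the cokernel carries
    -- over.
    have hrange : LinearMap.range (IsScalarTower.toAlgHom A R N).toLinearMap =
        LinearMap.range (IsScalarTower.toAlgHom A R₁ N).toLinearMap := by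
      refine le_antisymm ?_ ?_
      · rintro _ ⟨r, rfl⟩
        exact ⟨Ideal.Quotient.mk _ r, rfl⟩
      · rintro _ ⟨r, rfl⟩
        obtain ⟨r, rfl⟩ := Ideal.Quotient.mk_surjective r
        exact ⟨r, rfl⟩
    have h2 : Module.Finite A (N ⧸ LinearMap.range (IsScalarTower.toAlgHom A R₁ N).toLinearMap) := by
      rw [← hrange]
      exact finite_coker_normalization_higherPart A R 1
    exact (isFiberwiseNormalizationHom_of_isNormalRing A R₁ N (hker.le.trans bot_le) hIso
      h).admitsSimultaneousNormalization hPerfect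

theorem admitsSimultaneousNormalization_iff [IsNoetherianRing R]
    (hCoker : Module.Finite A (NormalizationCoker A R))
    (hKer : Module.Finite A (RingHom.ker (algebraMap R (Normalization (HigherPart R 1)))))
    (hIso : ∀ p : PrimeSpectrum A,
      NoIsolatedPoints (p.asIdeal.Fiber (Normalization (HigherPart R 1))))
    (hPerfect : ∀ p : PrimeSpectrum A, PerfectField p.asIdeal.ResidueField)
    (hnil : higherIdeal R 1 = nilradical R) :
    AdmitsSimultaneousNormalization (structureMap A R) ↔
      ∀ p : PrimeSpectrum A, IsNormalRing (p.asIdeal.Fiber (Normalization (HigherPart R 1))) := by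
  let D := HigherPart R 1 ⧸ nilradical (HigherPart R 1)
  let N := Normalization (HigherPart R 1)
  have : Module.Flat A N := flat_normalization_higherPart A R 1
  constructor
  · intro h
    obtain ⟨M, _, _, φ, hφ⟩ := h.exists_hom
    exact hφ.isNormalRing_fiber D (FractionRing D)
      (Ideal.Quotient.mk_surjective.comp Ideal.Quotient.mk_surjective)
      (ker_algebraMap_higherPart_quotient_nilradical R hnil)
  · intro h
    have h1 : Module.Finite A (LinearMap.ker (IsScalarTower.toAlgHom A R N).toLinearMap) := hKer
    have h2 := finite_coker_normalization_higherPart A R 1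
    exact (isFiberwiseNormalizationHom_of_isNormalRing A R N
      ((ker_algebraMap_normalization_higherPart R 1).trans hnil).le hIso
      h).admitsSimultaneousNormalization hPerfect

end Main

end INNS

theorem corollary3p5 (A R : Type u) [CommRing A] [IsDomain A] [IsPrincipalIdealRing A]
    [CommRing R] [Algebra A R] [Module.Flat A R]
    (hNagata : INNS.IsNagata R)
    (hCoker : Module.Finite A (INNS.NormalizationCoker A R))
    (hKer : Module.Finite A
      (RingHom.ker (algebraMap R (INNS.Normalization (INNS.HigherPart R 1)))))
    (hFib : ∀ p ∈ Set.range (PrimeSpectrum.comap (algebraMap A R)),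
      INNS.HasFinitelyManyINNS p.asIdeal.ResidueField (p.asIdeal.Fiber R))
    (hIso : ∀ p : PrimeSpectrum A,
      INNS.NoIsolatedPoints (p.asIdeal.Fiber (INNS.Normalization (INNS.HigherPart R 1))))
    (hPerfect : ∀ p : PrimeSpectrum A, PerfectField p.asIdeal.ResidueField) :
    (INNS.DeltaConstant A R ↔
      INNS.AdmitsSimultaneousNormalization (INNS.structureMap A (INNS.HigherPart R 1))) ∧
    (¬ IsField A → (∀ p ∈ minimalPrimes R, ringKrullDim (R ⧸ p) ≠ 1) →
      (INNS.AdmitsSimultaneousNormalization (INNS.structureMap A R) ↔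
        INNS.DeltaConstant A R)) := by
  have := hNagata.1
  have h := INNS.deltaConstant_iff A R hNagata hCoker hKer hFib hIso
  refine ⟨h.trans
    (INNS.admitsSimultaneousNormalization_higherPart_iff hCoker hIso hPerfect).symm,
    fun hA hdim => ?_⟩
  exact (INNS.admitsSimultaneousNormalization_iff hCoker hKer hIso hPerfect
    (INNS.higherIdeal_one_eq_nilradical hKer hA hdim)).trans h.symm
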